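/- **Setting.** Let $\Phi\subset\mathfrak h^*$ be (the complexification of) a finite, reduced, crystallographic root system spanning $\mathfrak h^*$, with Weyl group $W$, coroots $\alpha^\vee\in\mathfrak h$, a chosen system of positive roots $\Phi^+$, and coweight lattice $P^\vee=\{h\in\mathfrak h:\alpha(h)\in\mathbb Z\ \forall\alpha\in\Phi\}$. A subset $\Psi\subset\Phi$ is a *root subsystem* if $\langle\Psi\rangle_{\mathbb Z}\cap\Phi=\Psi$; put $\Psi^+=\Psi\cap\Phi^+$. Let $\operatorname{Im}\tau>0$, $\Lambda_\tau=\mathbb Z+\mathbb Z\tau$, $T=\mathfrak h/(P^\vee+\tau P^\vee)$, and let $T_{\rm reg}\subset T$ be the image of $\mathfrak h_{\rm reg}=\{z\in\mathfrak h:\alpha(z)\notin\Lambda_\tau\ \forall\alpha\in\Phi\}$. With $u=e^{2\pi iz}$, $q=e^{2\pi i\tau}$ let $$\theta(z|\tau)=u^{1/2}\prod_{s>0}(1-q^su)\prod_{s\ge0}(1-q^su^{-1})\,\frac1{2\pi i}\prod_{s>0}(1-q^s)^{-2},\qquad k(z,x|\tau)=\frac{\theta(z+x|\tau)}{\theta(z|\tau)\theta(x|\tau)}-\frac1x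 ,$$ where $u^{1/2}=e^{\pi iz}$. For fixed $z\notin\Lambda_\tau$, $k(z,x|\tau)$ is holomorphic near $x=0$ and is regarded as a power series in $x$. Let $A$ be an associative unital $\mathbb C$-algebra with commutator bracket, complete and separated for an exhaustive descending filtration $(F^nA)_{n\in\mathbb Z}$ by subspaces with $1\in F^0A$ and $F^mA\cdot F^nA\subset F^{m+n}A$ (for example, the completion of a graded algebra). Let $t_\alpha\in A$ $(\alpha\in\Phi)$ with $t_{-\alpha}=t_\alpha$, and let $x,y:\mathfrak h\to A$ be linear maps with $x(\mathfrak h)\subset F^1A$. Write $x_u=x(u)$ and consider, for dual bases $(u_i)$, $(u^i)$ of $\mathfrak h^*$, $\mathfrak h$, $$\nabla_{KZB,\tau}=d-\sum_{\alpha\in\Phi^+}k\big(\alpha,\operatorname{ad}(\tfrac{x_{\alpha^\vee}}2)\big|\tau\big)(t_\alpha)\,d\alpha+\sum_i y(u^i)\,du_i=d+\omega$$ on $\mathfrak h_{\rm reg}$. It is called a *flat connection on $T_{\rm reg}$* if * the multipliers $n+\tau m\mapsto e^{-2\pi i x(m)}$ $(n,m\in P^\vee)$ are multiplicative, hence define an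 action of $P^\vee+\tau P^\vee$ on the trivial bundle over $\mathfrak h_{\rm reg}$, that is, a principal bundle over $T_{\rm reg}$; * the connection descends to this bundle: $\omega(z+n+\tau m)=e^{-2\pi i x(m)}\,\omega(z)\,e^{2\pi i x(m)}$ for all $z\in\mathfrak h_{\rm reg}$, $n,m\in P^\vee$; * its curvature $d\omega+\omega\wedge\omega$ vanishes on $\mathfrak h_{\rm reg}$. **Theorem.** 1. $\nabla_{KZB,\tau}$ is a flat connection on $T_{\rm reg}$ if and only if the following relations hold in $A$: * (tt) $[t_\alpha,\sum_{\beta\in\Psi^+}t_\beta]=0$ for every root subsystem $\Psi\subset\Phi$ and every $\alpha\in\Psi$; * (xx) $[x(u),x(v)]=0$ and (yy) $[y(u),y(v)]=0$ for all $u,v\in\mathfrak h$; * (yx) $[y(u),x(v)]=\sum_{\gamma\in\Phi^+}\gamma(v)\gamma(u)\,t_\gamma$ for all $u,v\in\mathfrak h$; * (tx) $[t_\alpha,x(u)]=0$ and (ty) $[t_\alpha,y(u)]=0$ for all $\alpha\in\Phi$ and $u\in\mathfrak h$ with $\alpha(u)=0$. 2. Let $W$ act on $A$ by continuous algebra automorphisms.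 Then $\nabla_{KZB,\tau}$ is $W$-equivariant, meaning that $w\big(e^{-2\pi i x(m)}\big)=e^{-2\pi i x(wm)}$ for all $w\in W$, $m\in P^\vee$ (so that $(z,a)\mapsto(wz,w(a))$ is compatible with the multipliers) and that $\omega(wz)(wu)=w\big(\omega(z)(u)\big)$ for all $w\in W$, $z\in\mathfrak h_{\rm reg}$, $u\in\mathfrak h$, if and only if $$w(t_\gamma)=t_{w\gamma},\qquad w(x(u))=x(wu),\qquad w(y(v))=y(wv)\qquad\text{for all }w\in W,\ \gamma\in\Phi,\ u,v\in\mathfrak h .$$ -/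

import Mathlib

open scoped UpperHalfPlane Topology

noncomputable section

namespace KZB

/-! ### Complete filtered algebras -/

/-- A complete separated exhaustive descending filtration `⋯ ⊇ F 0 ⊇ F 1 ⊇ F 2 ⊇ ⋯`, compatible with
the product, on a complex associative algebra. The completion of a graded algebra carries one, with
`F n` the part of degree at least `n`. -/
structure CompleteFiltration (A : Type*) [Ring A] [Algebra ℂ A] where
  /-- The pieces of the filtration. -/
  F : ℤ → Submodule ℂ A
  antitone : Antitone F
  one_mem : (1 : A) ∈ F 0
  mul_mem : ∀ {m n : ℤ} {a b : A}, a ∈ F m → b ∈ F n → a * b ∈ F (m + n)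
  exhaustive : ∀ a : A, ∃ n, a ∈ F n
  separated : ∀ a : A, (∀ n, a ∈ F n) → a = 0
  complete : ∀ s : ℕ → A, (∀ n, ∃ k, ∀ i ≥ k, ∀ j ≥ k, s i - s j ∈ F n) →
    ∃ a, ∀ n, ∃ k, ∀ i ≥ k, s i - a ∈ F n

namespace CompleteFiltration

variable {A : Type*} [Ring A] [Algebra ℂ A] (𝓕 : CompleteFiltration A)

/-- Convergence of a sequence in the topology for which the `F n` are the basic neighbourhoods
of `0`. -/
def ConvergesTo (s : ℕ → A) (a : A) : Prop :=
  ∀ n, ∃ k, ∀ i ≥ k, s i - a ∈ 𝓕.F n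

open Classical in
/-- The sum of an infinite series (`0` if the series does not converge). -/
def series (f : ℕ → A) : A :=
  if h : ∃ a, 𝓕.ConvergesTo (fun n => ∑ i ∈ Finset.range n, f i) a then h.choose else 0

/-- The exponential series. -/
def exp (a : A) : A :=
  𝓕.series fun n => ((n.factorial : ℂ)⁻¹) • a ^ n

/-- The function `g : V → A` has derivative `a` at `z` in the direction `v`: this holds after
applying any continuous linear functional, that is, one that vanishes on some `F n`. As these
functionals separate points, `a` is unique. -/
def HasDerivInDirection {V : Type*} [AddCommGroup V] [Module ℂ V]
    (g : V → A) (z v : V) (a : A) : Prop :=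
  ∀ φ : A →ₗ[ℂ] ℂ, (∃ n, ∀ c ∈ 𝓕.F n, φ c = 0) →
    HasDerivAt (fun s : ℂ => φ (g (z + s • v))) (φ a) 0

/-- The connection `d + ω`, with `ω` an `A`-valued `1`-form (`ω z u` is the value at the point `z`
on the tangent vector `u`), has zero curvature `dω + ω ∧ ω` on `U`. -/
def ZeroCurvatureOn {V : Type*} [AddCommGroup V] [Module ℂ V]
    (ω : V → V → A) (U : Set V) : Prop :=
  ∀ z ∈ U, ∀ u v : V, ∃ a b : A,
    𝓕.HasDerivInDirection (fun p => ω p v) z u a ∧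
    𝓕.HasDerivInDirection (fun p => ω p u) z v b ∧
    a - b + ⁅ω z u, ω z v⁆ = 0

end CompleteFiltration

/-! ### The theta function and the function `k` -/

/-- The odd theta function `θ(z|τ)`, normalized by `∂θ/∂z (0|τ) = 1`, as an infinite product in
`u = exp (2πiz)` and `q = exp (2πiτ)`. -/
def theta (τ : ℍ) (z : ℂ) : ℂ :=
  let q : ℂ := Complex.exp (2 * Real.pi * Complex.I * τ)
  let u : ℂ := Complex.exp (2 * Real.pi * Complex.I * z)
  Complex.exp (Real.pi * Complex.I * z) * (∏' s : ℕ, (1 - q ^ (s + 1) * u)) *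
    (∏' s : ℕ, (1 - q ^ s * u⁻¹)) * (1 / (2 * Real.pi * Complex.I)) *
    ((∏' s : ℕ, (1 - q ^ (s + 1))) ^ 2)⁻¹

/-- `k(z,x|τ) = θ(z+x|τ) / (θ(z|τ) θ(x|τ)) - 1/x`, for `x` not in the lattice `ℤ + ℤτ`. -/
def k (τ : ℍ) (z x : ℂ) : ℂ :=
  theta τ (z + x) / (theta τ z * theta τ x) - 1 / x

/-- The `n`-th Taylor coefficient at `x = 0` of `x ↦ k(z,x|τ)`, whose singularity at `x = 0` is
removable for `z` not in `ℤ + ℤτ`. -/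
def kCoeff (τ : ℍ) (z : ℂ) (n : ℕ) : ℂ :=
  iteratedDeriv n (Function.update (k τ z) 0 (Filter.limUnder (𝓝[≠] 0) (k τ z))) 0 / n.factorial

/-! ### Root systems -/

section Roots

variable {ι Hd H : Type*} [AddCommGroup Hd] [Module ℂ Hd] [AddCommGroup H] [Module ℂ H]

/-- The coweight lattice, dual to the root lattice. -/
def coweightLattice (P : RootPairing ι ℂ Hd H) : AddSubgroup H where
  carrier := {h | ∀ i, ∃ n : ℤ, P.root' i h = n}
  zero_mem' i := ⟨0, by simp⟩
  add_mem' {a b} ha hb i := by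
    obtain ⟨m, hm⟩ := ha i
    obtain ⟨n, hn⟩ := hb i
    exact ⟨m + n, by rw [map_add, hm, hn]; push_cast; rfl⟩
  neg_mem' {a} ha i := by
    obtain ⟨m, hm⟩ := ha i
    exact ⟨-m, by rw [map_neg, hm]; push_cast; rfl⟩

/-- The preimage in `𝔥` of the elliptic configuration space `T_reg`: the points at which no root
takes a value in `ℤ + ℤτ`. -/
def regularSet (P : RootPairing ι ℂ Hd H) (τ : ℍ) : Set H :=
  {z | ∀ i, ∀ m n : ℤ, P.root' i z ≠ m + n * (τ : ℂ)}

/-- A set of roots is a root subsystem if every root that is an integral combination of its members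
belongs to it. -/
def IsRootSubsystem (P : RootPairing ι ℂ Hd H) (Ψ : Finset ι) : Prop :=
  ∀ i, P.root i ∈ AddSubgroup.closure (P.root '' (Ψ : Set ι)) → i ∈ Ψ

/-- The action of the Weyl group on `𝔥`, for which the reflection in a root `α` acts by
`u ↦ u - α(u) α^∨`. (`RootPairing.Equiv.coweightEquiv` is the transpose of the action on `𝔥^*`, whence
the inverse.) -/
def weylAct (P : RootPairing ι ℂ Hd H) (w : P.weylGroup) (u : H) : H :=
  RootPairing.Equiv.coweightEquiv P P ((w⁻¹ : P.weylGroup) : P.Aut) u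

end Roots

/-! ### The connection -/

section Connection

variable {ι Hd H A : Type*} [Fintype ι] [AddCommGroup Hd] [Module ℂ Hd] [AddCommGroup H]
  [Module ℂ H] [Ring A] [Algebra ℂ A]

/-- `k(z, ad X|τ)(c)`, by substitution of `ad X` in the Taylor series of `k(z,·|τ)`. -/
def kAd (𝓕 : CompleteFiltration A) (τ : ℍ) (z : ℂ) (X c : A) : A :=
  𝓕.series fun n => kCoeff τ z n • (fun c => ⁅X, c⁆)^[n] c

open Classical in
/-- The form `ω = -∑_{α > 0} k(α, ad (x(α^∨)/2)|τ)(t_α) dα + ∑ᵢ y(uⁱ) duᵢ` of the KZB connection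
`d + ω`, at the point `z` and on the tangent vector `u`. For dual bases `(uᵢ)` and `(uⁱ)`, the value
of `∑ᵢ y(uⁱ) duᵢ` on `u` is `∑ᵢ uᵢ(u) y(uⁱ) = y(u)`. -/
def kzbForm (P : RootPairing ι ℂ Hd H) (b : P.Base) (τ : ℍ) (𝓕 : CompleteFiltration A)
    (t : ι → A) (x y : H →ₗ[ℂ] A) (z u : H) : A :=
  -(∑ i ∈ Finset.univ.filter fun i => b.IsPos i,
      P.root' i u • kAd 𝓕 τ (P.root' i z) (x ((1 / 2 : ℂ) • P.coroot i)) (t i)) + y u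

/-- The multiplier `e^{-2πi x(m)}` by which a lattice vector `n + τm`, with `n` and `m` coweights,
acts on the fibres of the principal bundle. -/
def multiplier (𝓕 : CompleteFiltration A) (x : H →ₗ[ℂ] A) (m : H) : A :=
  𝓕.exp ((-(2 * Real.pi * Complex.I) : ℂ) • x m)

/-- The KZB connection is a flat connection on the principal bundle over `T_reg`. -/
structure IsFlatConnection (P : RootPairing ι ℂ Hd H) (b : P.Base) (τ : ℍ)
    (𝓕 : CompleteFiltration A) (t : ι → A) (x y : H →ₗ[ℂ] A) : Prop where
  /-- The multipliers define an action of the lattice on the trivial bundle over the preimage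
  of `T_reg`, whose quotient is the bundle over `T_reg`. -/
  bundle : ∀ m ∈ coweightLattice P, ∀ m' ∈ coweightLattice P,
    multiplier 𝓕 x (m + m') = multiplier 𝓕 x m * multiplier 𝓕 x m'
  /-- The connection is invariant under this action, so it descends to the bundle over `T_reg`:
  `ω(z + n + τm) = e^{-2πi x(m)} ω(z) e^{2πi x(m)}`. -/
  descends : ∀ z ∈ regularSet P τ, ∀ n ∈ coweightLattice P, ∀ m ∈ coweightLattice P, ∀ u : H,
    kzbForm P b τ 𝓕 t x y (z + n + (τ : ℂ) • m) u =
      multiplier 𝓕 x m * kzbForm P b τ 𝓕 t x y z u * multiplier 𝓕 x (-m)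
  /-- The curvature is zero. -/
  flat : 𝓕.ZeroCurvatureOn (kzbForm P b τ 𝓕 t x y) (regularSet P τ)

/-- The KZB connection is equivariant for an action `ρ` of the Weyl group on `A`: the action
`(z, a) ↦ (w z, ρ(w) a)` on the trivial bundle over the preimage of `T_reg` intertwines the actions of
`n + τm` and of `w (n + τm)`, and it preserves the connection. -/
structure IsEquivariant (P : RootPairing ι ℂ Hd H) (b : P.Base) (τ : ℍ)
    (𝓕 : CompleteFiltration A) (t : ι → A) (x y : H →ₗ[ℂ] A)
    (ρ : P.weylGroup →* (A ≃ₐ[ℂ] A)) : Prop where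
  bundle : ∀ w, ∀ m ∈ coweightLattice P,
    ρ w (multiplier 𝓕 x m) = multiplier 𝓕 x (weylAct P w m)
  form : ∀ w, ∀ z ∈ regularSet P τ, ∀ u : H,
    kzbForm P b τ 𝓕 t x y (weylAct P w z) (weylAct P w u) = ρ w (kzbForm P b τ 𝓕 t x y z u)

open Classical in
/-- The relations (tt), (xx), (yy), (yx), (tx), (ty). -/
structure Relations (P : RootPairing ι ℂ Hd H) (b : P.Base) (t : ι → A) (x y : H →ₗ[ℂ] A) :
    Prop where
  tt : ∀ Ψ : Finset ι, IsRootSubsystem P Ψ → ∀ i ∈ Ψ,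
    ⁅t i, ∑ j ∈ Ψ.filter fun j => b.IsPos j, t j⁆ = 0
  xx : ∀ u v : H, ⁅x u, x v⁆ = 0
  yy : ∀ u v : H, ⁅y u, y v⁆ = 0
  yx : ∀ u v : H, ⁅y u, x v⁆ =
    ∑ i ∈ Finset.univ.filter fun i => b.IsPos i, (P.root' i v * P.root' i u) • t i
  tx : ∀ i, ∀ u : H, P.root' i u = 0 → ⁅t i, x u⁆ = 0
  ty : ∀ i, ∀ u : H, P.root' i u = 0 → ⁅t i, y u⁆ = 0

end Connection

end KZB

end

/-! Write X_α = x(α^∨)/2. Every term k(α, ad X_α)(t_α) dα of the form ω depends on z only through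
α(z), so dω = 0 and the curvature is just the commutator [ω(u), ω(v)] (`zeroCurvatureOn_iff`).

Relations imply flatness. The function 1 + x k(z,x) = θ(z+x)x/(θ(z)θ(x)) is multiplied by an
exponential under lattice translations of z. By (xx) and (tx), conjugation by the multipliers
produces these exponentials, and the inhomogeneous term (e^{cx} - 1)/x comes from [x(m), y(u)] by
(yx); this is `kzbForm_add_lattice`. In the commutator, (yx) turns [y, (ad X_α)^{d+1} t_α] into
brackets of two t's, so each homogeneous component is a sum over pairs of roots. The pairs are
grouped by the plane they span. In a plane, the contribution is a polynomial in two commuting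
derivations applied to [t_α, t_β]; linear functionals reduce its vanishing to the scalar identity
`IsPlaneConfig.sum_pairPoly_eq_zero`. The generating function of that identity is, up to rational
terms, a sum of products of Kronecker functions θ(z+x)/(θ(z)θ(x)). It vanishes by Liouville's
theorem (`IsPlaneConfig.kroneckerSum_eq_zero`): on a line in a coweight direction it is
quasi-periodic with a nontrivial multiplier, and (tt) makes its residues vanish. Only [y(u), y(v)]
remains (`adEnd_kzbForm`), and it is zero by (yy).

Flatness implies the relations. Replacing a coweight m by Nm turns identities between exponentials
into identities between power series in N, whose coefficients agree. This gives (xx) from the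
cocycle condition, and from invariance an infinitesimal form (`adEnd_x_kzbForm`), whose residues
along walls give (tx) and whose remainder is (yx). The residue of the curvature along the wall of α
says that t_α commutes with the regular part of ω on the wall; a second residue, at a point of the
wall chosen so that the singular roots of a given plane are exactly those of Ψ, gives (tt). Then
(tt) removes the k-terms from the first residue, which leaves (ty), and `adEnd_kzbForm` gives (yy).

Equivariance. Since k(-z,-x) = -k(z,x), the sum over positive roots is half the sum over all roots,
and w permutes the latter. The converse holds because the multipliers determine x and the residues
of ω determine t, hence y. -/

noncomputable section

namespace KZB

/-! ### The theta function -/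

/-- The infinite product `∏ (1 - q^s w)` over `s ≥ 0`. -/
def qPochhammer (q w : ℂ) : ℂ := ∏' s : ℕ, (1 - q ^ s * w)

section QPochhammer

variable {q : ℂ}

lemma summable_norm_qPochhammer (hq : ‖q‖ < 1) (w : ℂ) : Summable fun s : ℕ => ‖-(q ^ s * w)‖ := by
  simpa using (summable_geometric_of_lt_one (norm_nonneg q) hq).mul_right ‖w‖

lemma multipliable_qPochhammer (hq : ‖q‖ < 1) (w : ℂ) : Multipliable fun s : ℕ => 1 - q ^ s * w := by
  simpa [sub_eq_add_neg] using multipliable_one_add_of_summable (summable_norm_qPochhammer hq w)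

lemma qPochhammer_eq_mul (hq : ‖q‖ < 1) (w : ℂ) :
    qPochhammer q w = (1 - w) * qPochhammer q (q * w) := by
  have h : (fun s : ℕ => 1 - q ^ (s + 1) * w) = fun s : ℕ => 1 - q ^ s * (q * w) := by
    funext s; ring
  rw [qPochhammer, tprod_eq_zero_mul' (by rw [h]; exact multipliable_qPochhammer hq _), h]
  simp [qPochhammer]

lemma qPochhammer_eq_zero_iff (hq : ‖q‖ < 1) (w : ℂ) :
    qPochhammer q w = 0 ↔ ∃ s : ℕ, q ^ s * w = 1 := by
  constructor
  · intro h
    by_contra! hne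
    refine tprod_one_add_ne_zero_of_summable (f := fun s : ℕ => -(q ^ s * w)) (fun s => ?_)
      (summable_norm_qPochhammer hq w) (by simpa [qPochhammer, sub_eq_add_neg] using h)
    rw [← sub_eq_add_neg, sub_ne_zero]
    exact (hne s).symm
  · rintro ⟨s, hs⟩
    exact tprod_of_exists_eq_zero ⟨s, by simp [hs]⟩

lemma differentiable_qPochhammer (hq : ‖q‖ < 1) : Differentiable ℂ (qPochhammer q) := by
  rw [← differentiableOn_univ]
  refine differentiableOn_of_locally_differentiableOn fun w _ => ?_
  -- On this ball the factors differ from 1 by at most ‖q‖^s (‖w‖ + 1), so the product converges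
  -- locally uniformly there.
  refine ⟨Metric.ball 0 (‖w‖ + 1), Metric.isOpen_ball, by simp, ?_⟩
  rw [Set.univ_inter]
  have h := Summable.hasProdLocallyUniformlyOn_nat_one_add
    (f := fun (s : ℕ) (w : ℂ) => -(q ^ s * w)) (K := Metric.ball 0 (‖w‖ + 1))
    (u := fun s => ‖q‖ ^ s * (‖w‖ + 1)) Metric.isOpen_ball
    ((summable_geometric_of_lt_one (norm_nonneg q) hq).mul_right _)
    (.of_forall fun s x hx => by
      have : ‖x‖ ≤ ‖w‖ + 1 := by simpa using (mem_ball_zero_iff.mp hx).le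
      simpa using mul_le_mul_of_nonneg_left this (by positivity))
    (fun s => by fun_prop)
  have h' := h.differentiableOn (.of_forall fun _ => by
    simpa [Finset.prod_fn] using DifferentiableOn.finsetProd (fun _ _ => by fun_prop))
    Metric.isOpen_ball
  refine h'.congr fun x _ => ?_
  simp [qPochhammer, sub_eq_add_neg]

end QPochhammer

section Theta

variable (τ : ℍ)

/-- The nome `q = exp (2πiτ)`. -/
def nome : ℂ := Complex.exp (2 * Real.pi * Complex.I * τ)

lemma norm_nome_lt_one : ‖nome τ‖ < 1 := by
  rw [nome, Complex.norm_exp, Real.exp_lt_one_iff]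
  have h := τ.im_pos
  have : (2 * Real.pi * Complex.I * (τ : ℂ)).re = -(2 * Real.pi * τ.im) := by simp
  rw [this]
  have := Real.pi_pos
  have : 0 < 2 * Real.pi * τ.im := by positivity
  linarith

/-- The constant factor of the theta function. -/
def thetaConst : ℂ := 1 / (2 * Real.pi * Complex.I) * ((qPochhammer (nome τ) (nome τ)) ^ 2)⁻¹

lemma theta_eq (z : ℂ) : theta τ z = Complex.exp (Real.pi * Complex.I * z) *
    qPochhammer (nome τ) (nome τ * Complex.exp (2 * Real.pi * Complex.I * z)) *
    qPochhammer (nome τ) (Complex.exp (2 * Real.pi * Complex.I * z))⁻¹ * thetaConst τ := by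
  simp only [theta, qPochhammer, thetaConst, nome, pow_succ, mul_assoc]

/-- Splitting off the factor s = 0 of the second product leaves an expression in which the oddness
of θ and its zero at the origin are visible. -/
lemma theta_eq_symm (z : ℂ) : theta τ z =
    (Complex.exp (Real.pi * Complex.I * z) - Complex.exp (-(Real.pi * Complex.I * z))) *
    (qPochhammer (nome τ) (nome τ * Complex.exp (2 * Real.pi * Complex.I * z)) *
    qPochhammer (nome τ) (nome τ * Complex.exp (-(2 * Real.pi * Complex.I * z)))) *
      thetaConst τ := by
  rw [theta_eq, qPochhammer_eq_mul (norm_nome_lt_one τ) (_⁻¹), ← Complex.exp_neg]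
  have h : Complex.exp (-(Real.pi * Complex.I * z)) =
      Complex.exp (Real.pi * Complex.I * z) * Complex.exp (-(2 * Real.pi * Complex.I * z)) := by
    rw [← Complex.exp_add]; congr 1; ring
  rw [h]; ring

lemma differentiable_theta : Differentiable ℂ (theta τ) := by
  have h := differentiable_qPochhammer (norm_nome_lt_one τ)
  have : theta τ = fun z => (Complex.exp (Real.pi * Complex.I * z) -
      Complex.exp (-(Real.pi * Complex.I * z))) *
    (qPochhammer (nome τ) (nome τ * Complex.exp (2 * Real.pi * Complex.I * z)) *
    qPochhammer (nome τ) (nome τ * Complex.exp (-(2 * Real.pi * Complex.I * z)))) *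
      thetaConst τ := funext (theta_eq_symm τ)
  rw [this]
  refine Differentiable.mul (Differentiable.mul (by fun_prop) (Differentiable.mul ?_ ?_))
    (by fun_prop)
  · exact h.comp (by fun_prop)
  · exact h.comp (by fun_prop)

lemma analyticAt_theta (z : ℂ) : AnalyticAt ℂ (theta τ) z :=
  (differentiable_theta τ).analyticAt z

@[simp] lemma theta_neg (z : ℂ) : theta τ (-z) = -theta τ z := by
  rw [theta_eq_symm, theta_eq_symm]
  simp only [mul_neg, neg_neg]
  ring

@[simp] lemma theta_zero : theta τ 0 = 0 := by simp [theta_eq_symm]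

lemma theta_add_one (z : ℂ) : theta τ (z + 1) = -theta τ z := by
  have h1 : Complex.exp (2 * Real.pi * Complex.I * (z + 1)) =
      Complex.exp (2 * Real.pi * Complex.I * z) := by
    rw [mul_add, mul_one, Complex.exp_add, Complex.exp_two_pi_mul_I, mul_one]
  have h2 : Complex.exp (Real.pi * Complex.I * (z + 1)) =
      -Complex.exp (Real.pi * Complex.I * z) := by
    rw [mul_add, mul_one, Complex.exp_add, Complex.exp_pi_mul_I, mul_neg_one]
  rw [theta_eq, theta_eq, h1, h2]
  ring

/-- The translation replaces u by qu, which shifts each product by one factor; the quotient of the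
two stray factors is (1 - (qu)⁻¹)/(1 - qu) = -(qu)⁻¹. -/
lemma theta_add_tau (z : ℂ) : theta τ (z + τ) =
    -Complex.exp (-(Real.pi * Complex.I * τ) - 2 * Real.pi * Complex.I * z) * theta τ z := by
  have hq := norm_nome_lt_one τ
  set u := Complex.exp (2 * Real.pi * Complex.I * z) with hu
  have hu0 : u ≠ 0 := Complex.exp_ne_zero _
  have hq0 : nome τ ≠ 0 := Complex.exp_ne_zero _
  have h1 : Complex.exp (2 * Real.pi * Complex.I * (z + τ)) = nome τ * u := by
    rw [mul_add, Complex.exp_add, nome, hu, mul_comm]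
  have h2 : Complex.exp (Real.pi * Complex.I * (z + τ)) =
      Complex.exp (-(Real.pi * Complex.I * τ) - 2 * Real.pi * Complex.I * z) *
        (nome τ * u * Complex.exp (Real.pi * Complex.I * z)) := by
    rw [hu, nome, ← Complex.exp_add, ← Complex.exp_add, ← Complex.exp_add]; congr 1; ring
  rw [theta_eq, theta_eq, h1, h2, ← hu, qPochhammer_eq_mul hq (nome τ * u),
    qPochhammer_eq_mul hq (nome τ * u)⁻¹]
  have h3 : nome τ * (nome τ * u)⁻¹ = u⁻¹ := by field_simp
  rw [h3]
  field_simp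
  ring

lemma theta_add_int (z : ℂ) (n : ℤ) : theta τ (z + n) = (-1) ^ n * theta τ z := by
  induction n using Int.induction_on with
  | zero => simp
  | succ n ih =>
    push_cast at ih ⊢
    rw [← add_assoc, theta_add_one, ih, zpow_add₀ (by norm_num)]; simp
  | pred n ih =>
    push_cast at ih ⊢
    have := theta_add_one τ (z + (-(n : ℂ) - 1))
    rw [show z + (-(n : ℂ) - 1) + 1 = z + -(n : ℂ) by ring, ih] at this
    rw [zpow_sub₀ (by norm_num), zpow_one, div_neg, div_one, neg_mul, this, neg_neg]

/-- The constant c is left implicit: it cancels in θ(z+x)/θ(z), and for zeros and derivatives only c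
≠ 0 matters. -/
lemma exists_theta_add_lattice (m n : ℤ) : ∃ c : ℂ, c ≠ 0 ∧ ∀ z, theta τ (z + (m + n * τ)) =
    c * Complex.exp (-(2 * Real.pi * Complex.I) * (n * z)) * theta τ z := by
  suffices h : ∃ c : ℂ, c ≠ 0 ∧ ∀ z, theta τ (z + n * τ) =
      c * Complex.exp (-(2 * Real.pi * Complex.I) * (n * z)) * theta τ z by
    obtain ⟨c, hc, h⟩ := h
    refine ⟨(-1) ^ m * c, mul_ne_zero (zpow_ne_zero _ (by norm_num)) hc, fun z => ?_⟩
    rw [show z + (m + n * (τ : ℂ)) = z + n * τ + m by ring, theta_add_int, h]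
    ring
  induction n using Int.induction_on with
  | zero => exact ⟨1, one_ne_zero, fun z => by simp⟩
  | succ n ih =>
    obtain ⟨c, hc, h⟩ := ih
    refine ⟨-Complex.exp (-(Real.pi * Complex.I * τ) - 2 * Real.pi * Complex.I * (n * τ)) * c,
      mul_ne_zero (neg_ne_zero.mpr (Complex.exp_ne_zero _)) hc, fun z => ?_⟩
    push_cast at h ⊢
    rw [show z + ((n : ℂ) + 1) * τ = z + n * τ + τ by ring, theta_add_tau, h]
    have : Complex.exp (-(Real.pi * Complex.I * τ) - 2 * Real.pi * Complex.I * (z + n * τ)) *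
        Complex.exp (-(2 * Real.pi * Complex.I) * (n * z)) =
        Complex.exp (-(Real.pi * Complex.I * τ) - 2 * Real.pi * Complex.I * (n * τ)) *
        Complex.exp (-(2 * Real.pi * Complex.I) * ((n + 1) * z)) := by
      rw [← Complex.exp_add, ← Complex.exp_add]; congr 1; ring
    linear_combination (-c * theta τ z) * this
  | pred n ih =>
    obtain ⟨c, hc, h⟩ := ih
    refine ⟨-Complex.exp (Real.pi * Complex.I * τ + 2 * Real.pi * Complex.I * ((-n - 1) * τ)) * c,
      mul_ne_zero (neg_ne_zero.mpr (Complex.exp_ne_zero _)) hc, fun z => ?_⟩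
    push_cast at h ⊢
    have h1 := theta_add_tau τ (z + (-(n : ℂ) - 1) * τ)
    rw [show z + (-(n : ℂ) - 1) * τ + τ = z + -(n : ℂ) * τ by ring, h] at h1
    have h2 : Complex.exp (-(Real.pi * Complex.I * τ) -
        2 * Real.pi * Complex.I * (z + (-(n : ℂ) - 1) * τ)) *
        Complex.exp (Real.pi * Complex.I * τ + 2 * Real.pi * Complex.I * ((-n - 1) * τ)) *
        Complex.exp (-(2 * Real.pi * Complex.I) * ((-(n : ℂ) - 1) * z)) =
        Complex.exp (-(2 * Real.pi * Complex.I) * (-n * z)) := by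
      rw [← Complex.exp_add, ← Complex.exp_add]; congr 1; ring
    rw [← h2] at h1
    have h3 := Complex.exp_ne_zero (-(Real.pi * Complex.I * τ) -
        2 * Real.pi * Complex.I * (z + (-(n : ℂ) - 1) * τ))
    apply mul_left_cancel₀ (neg_ne_zero.mpr h3)
    rw [← h1]
    ring

lemma thetaConst_ne_zero : thetaConst τ ≠ 0 := by
  have hq := norm_nome_lt_one τ
  refine mul_ne_zero (by simp [Real.pi_ne_zero]) (inv_ne_zero (pow_ne_zero _ ?_))
  rw [Ne, qPochhammer_eq_zero_iff hq]
  rintro ⟨s, hs⟩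
  have := congrArg norm hs
  rw [← pow_succ, norm_pow, norm_one] at this
  exact (pow_lt_one₀ (norm_nonneg _) hq (by lia)).ne this

lemma theta_eq_zero_iff (z : ℂ) : theta τ z = 0 ↔ ∃ m n : ℤ, z = m + n * τ := by
  have hq := norm_nome_lt_one τ
  constructor
  · intro h
    have key : ∃ n : ℤ, Complex.exp (2 * Real.pi * Complex.I * (z - n * τ)) = 1 := by
      rw [theta_eq] at h
      rcases mul_eq_zero.mp ((mul_eq_zero.mp h).resolve_right (thetaConst_ne_zero τ)) with h | h
      · have h' := (mul_eq_zero.mp h).resolve_left (Complex.exp_ne_zero _)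
        obtain ⟨s, hs⟩ := (qPochhammer_eq_zero_iff hq _).mp h'
        refine ⟨-(s + 1), ?_⟩
        rw [← hs, nome, ← Complex.exp_nat_mul, ← Complex.exp_add, ← Complex.exp_add]
        congr 1; push_cast; ring
      · obtain ⟨s, hs⟩ := (qPochhammer_eq_zero_iff hq _).mp h
        refine ⟨s, ?_⟩
        rw [nome, ← Complex.exp_nat_mul, ← Complex.exp_neg, ← Complex.exp_add] at hs
        rw [← inv_inj, inv_one, ← hs, ← Complex.exp_neg]
        congr 1; push_cast; ring
    obtain ⟨n, hn⟩ := key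
    obtain ⟨m, hm⟩ := Complex.exp_eq_one_iff.mp hn
    refine ⟨m, n, ?_⟩
    have h0 : (2 * Real.pi * Complex.I : ℂ) ≠ 0 := Complex.two_pi_I_ne_zero
    have : z - n * τ = m := mul_left_cancel₀ h0 (by rw [hm]; ring)
    linear_combination this
  · rintro ⟨m, n, rfl⟩
    obtain ⟨c, -, h⟩ := exists_theta_add_lattice τ m n
    simpa using h 0

/-- The sine factor has derivative 2πi at its zero, and the remaining products both become ∏(1 -
q^s) over s > 0; `thetaConst` is the inverse of their contribution. -/
lemma hasDerivAt_theta_zero : HasDerivAt (theta τ) 1 0 := by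
  have hq := differentiable_qPochhammer (norm_nome_lt_one τ)
  set g : ℂ → ℂ := fun z => (qPochhammer (nome τ) (nome τ * Complex.exp (2 * Real.pi * Complex.I * z)) *
    qPochhammer (nome τ) (nome τ * Complex.exp (-(2 * Real.pi * Complex.I * z)))) *
      thetaConst τ with hg
  have hgd : Differentiable ℂ g :=
    ((hq.comp (by fun_prop)).mul (hq.comp (by fun_prop))).mul (by fun_prop)
  have h1 : HasDerivAt (fun z : ℂ => Complex.exp (Real.pi * Complex.I * z) -
      Complex.exp (-(Real.pi * Complex.I * z))) (2 * Real.pi * Complex.I) 0 := by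
    have h := ((hasDerivAt_id (0 : ℂ)).const_mul (Real.pi * Complex.I : ℂ))
    have := h.cexp.sub h.neg.cexp
    refine this.congr_deriv ?_
    simp; ring
  have h2 := h1.mul (hgd 0).hasDerivAt
  have h3 : theta τ = (fun z : ℂ => Complex.exp (Real.pi * Complex.I * z) -
      Complex.exp (-(Real.pi * Complex.I * z))) * g := by
    funext z; rw [theta_eq_symm]; simp [hg, mul_assoc]
  rw [h3]
  refine h2.congr_deriv ?_
  have h0 := thetaConst_ne_zero τ
  simp only [thetaConst] at h0
  have h4 : qPochhammer (nome τ) (nome τ) ≠ 0 := by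
    intro h; simp [h] at h0
  simp only [hg, mul_zero, Complex.exp_zero, mul_one, neg_zero, sub_self, zero_mul, add_zero,
    thetaConst]
  have := Real.pi_ne_zero
  field_simp

lemma deriv_theta_zero : deriv (theta τ) 0 = 1 := (hasDerivAt_theta_zero τ).deriv

lemma theta_ne_zero_iff (z : ℂ) : theta τ z ≠ 0 ↔ ∀ m n : ℤ, z ≠ m + n * τ := by
  simp [theta_eq_zero_iff]

lemma eventually_theta_ne_zero : ∀ᶠ x in 𝓝[≠] (0 : ℂ), theta τ x ≠ 0 := by
  have := (hasDerivAt_theta_zero τ).eventually_ne one_ne_zero (c := 0)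
  simpa using this

end Theta

end KZB

end

noncomputable section

namespace KZB

/-! ### Taylor series at the origin -/

/-- The Taylor series of a function at the origin, as a formal power series. -/
def taylor (f : ℂ → ℂ) : PowerSeries ℂ := PowerSeries.mk fun n => iteratedDeriv n f 0 / n.factorial

lemma coeff_taylor (f : ℂ → ℂ) (n : ℕ) :
    PowerSeries.coeff n (taylor f) = iteratedDeriv n f 0 / n.factorial := by simp [taylor]

lemma taylor_congr {f g : ℂ → ℂ} (h : f =ᶠ[𝓝 0] g) : taylor f = taylor g := by
  ext n; simp only [coeff_taylor, h.iteratedDeriv_eq]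

lemma taylor_add {f g : ℂ → ℂ} (hf : AnalyticAt ℂ f 0) (hg : AnalyticAt ℂ g 0) :
    taylor (fun x => f x + g x) = taylor f + taylor g := by
  ext n
  simp only [coeff_taylor, map_add, iteratedDeriv_fun_add hf.contDiffAt hg.contDiffAt]
  ring

lemma taylor_sum {α : Type*} (s : Finset α) {f : α → ℂ → ℂ} (hf : ∀ a ∈ s, AnalyticAt ℂ (f a) 0) :
    taylor (fun x => ∑ a ∈ s, f a x) = ∑ a ∈ s, taylor (f a) := by
  classical
  induction s using Finset.induction_on with
  | empty => ext n; simp [coeff_taylor]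
  | insert a s ha ih =>
    simp only [Finset.sum_insert ha]
    rw [taylor_add (hf a (by simp)) (Finset.analyticAt_fun_sum _ fun b hb => hf b (by simp [hb])),
      ih fun b hb => hf b (by simp [hb])]

lemma taylor_mul {f g : ℂ → ℂ} (hf : AnalyticAt ℂ f 0) (hg : AnalyticAt ℂ g 0) :
    taylor (fun x => f x * g x) = taylor f * taylor g := by
  ext n
  rw [coeff_taylor, iteratedDeriv_fun_mul hf.contDiffAt hg.contDiffAt, PowerSeries.coeff_mul,
    Finset.Nat.sum_antidiagonal_eq_sum_range_succ_mk, Finset.sum_div]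
  refine Finset.sum_congr rfl fun i hi => ?_
  have hi' : i ≤ n := by simpa [Nat.lt_succ_iff] using hi
  rw [coeff_taylor, coeff_taylor, Nat.cast_choose ℂ hi']
  have h1 : (n.factorial : ℂ) ≠ 0 := by exact_mod_cast n.factorial_ne_zero
  field_simp

lemma taylor_const (c : ℂ) : taylor (fun _ => c) = PowerSeries.C c := by
  ext n
  rw [coeff_taylor, iteratedDeriv_const, PowerSeries.coeff_C]
  split_ifs with h <;> simp [h]

lemma taylor_id : taylor (fun x => x) = PowerSeries.X := by
  ext n
  rw [coeff_taylor, iteratedDeriv_fun_id, PowerSeries.coeff_X]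
  rcases n with _ | _ | n <;> simp

lemma taylor_const_mul {f : ℂ → ℂ} (hf : AnalyticAt ℂ f 0) (c : ℂ) :
    taylor (fun x => c * f x) = PowerSeries.C c * taylor f := by
  rw [taylor_mul analyticAt_const hf, taylor_const]

lemma iteratedDeriv_comp_mul_left' (n : ℕ) (f : ℂ → ℂ) (c : ℂ) :
    iteratedDeriv n (fun x => f (c * x)) = fun x => c ^ n * iteratedDeriv n f (c * x) := by
  induction n with
  | zero => simp
  | succ n ih =>
    funext x
    rw [iteratedDeriv_succ, ih, deriv_const_mul_field,
      deriv_comp_mul_left (f := iteratedDeriv n f), iteratedDeriv_succ, smul_eq_mul, pow_succ]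
    ring

lemma taylor_comp_mul (f : ℂ → ℂ) (c : ℂ) :
    taylor (fun x => f (c * x)) = PowerSeries.rescale c (taylor f) := by
  ext n
  simp [coeff_taylor, iteratedDeriv_comp_mul_left', mul_div_assoc]

lemma taylor_exp : taylor Complex.exp = PowerSeries.exp ℂ := by
  ext n
  rw [coeff_taylor, iteratedDeriv_eq_iterate, Complex.iter_deriv_exp, PowerSeries.coeff_exp]
  simp

lemma analyticAt_dslope_same {f : ℂ → ℂ} {a : ℂ} (hf : AnalyticAt ℂ f a) :
    AnalyticAt ℂ (dslope f a) a := by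
  obtain ⟨p, hp⟩ := hf
  exact ⟨_, hp.has_fpower_series_dslope_fslope⟩

/-! ### Taylor coefficients of `k` -/

section KCoeff

variable (τ : ℍ)

/-- The function `x / θ(x)`. -/
def invTheta (x : ℂ) : ℂ := (dslope (theta τ) 0 x)⁻¹

lemma analyticAt_invTheta : AnalyticAt ℂ (invTheta τ) 0 :=
  (analyticAt_dslope_same (analyticAt_theta τ 0)).inv (by simp [deriv_theta_zero])

lemma invTheta_zero : invTheta τ 0 = 1 := by simp [invTheta, deriv_theta_zero]

lemma invTheta_of_ne {x : ℂ} (hx : x ≠ 0) : invTheta τ x = x / theta τ x := by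
  rw [invTheta, dslope_of_ne _ hx, slope_def_field, theta_zero, sub_zero, sub_zero, inv_div]

lemma invTheta_neg (x : ℂ) : invTheta τ (-x) = invTheta τ x := by
  rcases eq_or_ne x 0 with rfl | hx
  · simp
  · rw [invTheta_of_ne τ hx, invTheta_of_ne τ (neg_ne_zero.mpr hx), theta_neg, neg_div_neg_eq]

/-- The function `x ↦ θ(z+x) x / (θ(z) θ(x)) - 1`. -/
def mulK (z x : ℂ) : ℂ := theta τ (z + x) / theta τ z * invTheta τ x - 1

lemma analyticAt_theta_shift (z : ℂ) : AnalyticAt ℂ (fun x => theta τ (z + x) / theta τ z) 0 :=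
  Differentiable.analyticAt (by have := differentiable_theta τ; fun_prop) 0

lemma analyticAt_mulK (z : ℂ) : AnalyticAt ℂ (mulK τ z) 0 :=
  ((analyticAt_theta_shift τ z).mul (analyticAt_invTheta τ)).sub analyticAt_const

/-- The function `k(z,·|τ)` with its removable singularity at the origin removed. -/
def kFun (z : ℂ) : ℂ → ℂ := dslope (mulK τ z) 0

lemma analyticAt_kFun (z : ℂ) : AnalyticAt ℂ (kFun τ z) 0 :=
  analyticAt_dslope_same (analyticAt_mulK τ z)

variable {τ} in
lemma mulK_zero {z : ℂ} (hz : theta τ z ≠ 0) : mulK τ z 0 = 0 := by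
  simp [mulK, invTheta_zero, hz]

variable {τ} in
lemma kFun_of_ne {z x : ℂ} (hz : theta τ z ≠ 0) (hx : x ≠ 0) : kFun τ z x = k τ z x := by
  rw [kFun, dslope_of_ne _ hx, slope_def_field, mulK_zero hz, sub_zero, sub_zero, mulK,
    invTheta_of_ne τ hx, k, sub_div]
  congr 1
  rcases eq_or_ne (theta τ x) 0 with h | h
  · simp [h]
  · field_simp

variable {τ} in
-- The punctured limit in the definition of `kCoeff` exists and is the value of the analytic
-- function `kFun` at 0, so the updated function is `kFun` itself.
lemma kCoeff_eq {z : ℂ} (hz : theta τ z ≠ 0) (n : ℕ) :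
    kCoeff τ z n = PowerSeries.coeff n (taylor (kFun τ z)) := by
  have hlim : Filter.Tendsto (k τ z) (𝓝[≠] 0) (𝓝 (kFun τ z 0)) := by
    refine ((analyticAt_kFun τ z).continuousAt.tendsto.mono_left nhdsWithin_le_nhds).congr' ?_
    filter_upwards [self_mem_nhdsWithin] with x hx using kFun_of_ne hz hx
  have : Function.update (k τ z) 0 (Filter.limUnder (𝓝[≠] 0) (k τ z)) = kFun τ z := by
    funext x
    rcases eq_or_ne x 0 with rfl | hx
    · simp [hlim.limUnder_eq]
    · rw [Function.update_of_ne hx, kFun_of_ne hz hx]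
  rw [kCoeff, this, coeff_taylor]

/-- The Taylor series of `k(z,·|τ)`. -/
def kSeries (z : ℂ) : PowerSeries ℂ := PowerSeries.mk (kCoeff τ z)

lemma coeff_kSeries (z : ℂ) (n : ℕ) : PowerSeries.coeff n (kSeries τ z) = kCoeff τ z n := by
  simp [kSeries]

variable {τ} in
lemma taylor_kFun {z : ℂ} (hz : theta τ z ≠ 0) : taylor (kFun τ z) = kSeries τ z := by
  ext n; rw [coeff_kSeries, kCoeff_eq hz]

/-- The Taylor series of `θ(z+x)/θ(z)`. -/
def thetaRatio (z : ℂ) : PowerSeries ℂ := taylor fun x => theta τ (z + x) / theta τ z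

variable {τ} in
-- Multiplication by x clears the pole and the term -1/x. Of the two factors on the right, only the
-- first depends on z and it carries all the quasi-periodicity.
lemma X_mul_kSeries {z : ℂ} (hz : theta τ z ≠ 0) :
    PowerSeries.X * kSeries τ z + 1 = thetaRatio τ z * taylor (invTheta τ) := by
  rw [thetaRatio, ← taylor_mul (analyticAt_theta_shift τ z) (analyticAt_invTheta τ),
    ← taylor_kFun hz, ← taylor_id, ← taylor_mul (f := fun x => x) analyticAt_id (analyticAt_kFun τ z),
    ← map_one (PowerSeries.C (R := ℂ)), ← taylor_const,
    ← taylor_add (f := fun x => x * kFun τ z x) (analyticAt_id.mul (analyticAt_kFun τ z))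
      analyticAt_const]
  congr 1
  funext x
  have := sub_smul_dslope (mulK τ z) 0 x
  rw [mulK_zero hz, sub_zero, sub_zero, smul_eq_mul] at this
  rw [kFun]
  rw [this, mulK, sub_add_cancel]

variable {τ} in
lemma thetaRatio_add_lattice {z : ℂ} (hz : theta τ z ≠ 0) (m n : ℤ) :
    thetaRatio τ (z + (m + n * τ)) =
      PowerSeries.rescale (-(2 * Real.pi * Complex.I) * n) (PowerSeries.exp ℂ) *
        thetaRatio τ z := by
  rw [thetaRatio, thetaRatio, ← taylor_exp, ← taylor_comp_mul,
    ← taylor_mul (Differentiable.analyticAt (by fun_prop) 0) (analyticAt_theta_shift τ z)]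
  congr 1
  funext x
  obtain ⟨c, hc, h⟩ := exists_theta_add_lattice τ m n
  rw [show z + (m + n * (τ : ℂ)) + x = z + x + (m + n * τ) by ring, h, h,
    show -(2 * Real.pi * Complex.I) * (n * (z + x)) = -(2 * Real.pi * Complex.I) * n * x +
      -(2 * Real.pi * Complex.I) * (n * z) by ring, Complex.exp_add]
  have := Complex.exp_ne_zero (-(2 * Real.pi * Complex.I) * (n * z))
  field_simp

variable {τ} in
lemma theta_add_lattice_ne_zero {z : ℂ} (hz : theta τ z ≠ 0) (m n : ℤ) :
    theta τ (z + (m + n * τ)) ≠ 0 := by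
  obtain ⟨c, hc, h⟩ := exists_theta_add_lattice τ m n
  rw [h]
  exact mul_ne_zero (mul_ne_zero hc (Complex.exp_ne_zero _)) hz

variable {τ} in
lemma kSeries_add_lattice {z : ℂ} (hz : theta τ z ≠ 0) (m n : ℤ) :
    PowerSeries.X * kSeries τ (z + (m + n * τ)) + 1 =
      PowerSeries.rescale (-(2 * Real.pi * Complex.I) * n) (PowerSeries.exp ℂ) *
        (PowerSeries.X * kSeries τ z + 1) := by
  rw [X_mul_kSeries (theta_add_lattice_ne_zero hz m n), X_mul_kSeries hz,
    thetaRatio_add_lattice hz, mul_assoc]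

variable {τ} in
lemma kCoeff_add_int {z : ℂ} (hz : theta τ z ≠ 0) (m : ℤ) (n : ℕ) :
    kCoeff τ (z + m) n = kCoeff τ z n := by
  have h := kSeries_add_lattice hz m 0
  have h2 := congrArg (PowerSeries.coeff (n + 1)) h
  simpa [PowerSeries.coeff_succ_X_mul, coeff_kSeries, PowerSeries.coeff_one] using h2

variable {τ} in
-- Coefficientwise form of k(-z,-x) = -k(z,x), which follows from the oddness of θ.
lemma kCoeff_neg {z : ℂ} (hz : theta τ z ≠ 0) (n : ℕ) :
    kCoeff τ (-z) n = (-1) ^ (n + 1) * kCoeff τ z n := by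
  have hz' : theta τ (-z) ≠ 0 := by simpa using hz
  have h1 : thetaRatio τ (-z) = PowerSeries.rescale (-1) (thetaRatio τ z) := by
    rw [thetaRatio, thetaRatio, ← taylor_comp_mul]
    congr 1; funext x
    rw [show -z + x = -(z + -1 * x) by ring, theta_neg, theta_neg, neg_div_neg_eq]
  have h2 : taylor (invTheta τ) = PowerSeries.rescale (-1) (taylor (invTheta τ)) := by
    rw [← taylor_comp_mul]
    congr 1; funext x
    rw [neg_one_mul, invTheta_neg]
  have h := X_mul_kSeries hz'
  rw [h1, h2, ← map_mul, ← X_mul_kSeries hz] at h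
  have h3 := congrArg (PowerSeries.coeff (n + 1)) h
  simpa [PowerSeries.coeff_succ_X_mul, coeff_kSeries, PowerSeries.coeff_one, pow_succ] using h3

/-- The entire function `θ(z) k_n(z)`, where `k_n` is the `n`-th Taylor coefficient of `k`. -/
def kNum (n : ℕ) (z : ℂ) : ℂ := ∑ ij ∈ Finset.HasAntidiagonal.antidiagonal (n + 1),
  iteratedDeriv ij.1 (theta τ) z / ij.1.factorial * PowerSeries.coeff ij.2 (taylor (invTheta τ))

variable {τ} in
-- Exhibits each Taylor coefficient as an entire function divided by θ, so that its poles are at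
-- most simple and lie on the lattice.
lemma kCoeff_eq_div {z : ℂ} (hz : theta τ z ≠ 0) (n : ℕ) :
    kCoeff τ z n = kNum τ n z / theta τ z := by
  have h := congrArg (PowerSeries.coeff (n + 1)) (X_mul_kSeries hz)
  rw [map_add, PowerSeries.coeff_succ_X_mul, coeff_kSeries, PowerSeries.coeff_one,
    if_neg (by lia), add_zero, PowerSeries.coeff_mul] at h
  rw [h, kNum, Finset.sum_div]
  refine Finset.sum_congr rfl fun ij _ => ?_
  have : iteratedDeriv ij.1 (fun x => theta τ (z + x) / theta τ z) 0 =
      iteratedDeriv ij.1 (theta τ) z / theta τ z := by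
    simp only [div_eq_inv_mul]
    rw [iteratedDeriv_const_mul_field, iteratedDeriv_comp_const_add]
    simp only [add_zero]
  rw [thetaRatio, coeff_taylor, this]
  ring

lemma differentiable_kNum (n : ℕ) : Differentiable ℂ (kNum τ n) := by
  unfold kNum
  refine Differentiable.fun_sum fun ij _ => ?_
  have : Differentiable ℂ (iteratedDeriv ij.1 (theta τ)) :=
    (differentiable_theta τ).contDiff.differentiable_iteratedDeriv (n := ⊤) ij.1
      (by exact WithTop.coe_lt_top _)
  fun_prop

/-- The sum is the coefficient of x^{n+1} in θ(x) · (x/θ(x)) = x. Hence at the origin only the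
constant Taylor coefficient of k has a pole, with residue 1. -/
lemma kNum_zero (n : ℕ) : kNum τ n 0 = if n = 0 then 1 else 0 := by
  have h : taylor (theta τ) * taylor (invTheta τ) = PowerSeries.X := by
    rw [← taylor_mul (analyticAt_theta τ 0) (analyticAt_invTheta τ), ← taylor_id]
    refine taylor_congr ?_
    have h1 := eventually_theta_ne_zero τ
    rw [eventually_nhdsWithin_iff] at h1
    filter_upwards [h1] with x hx
    rcases eq_or_ne x 0 with rfl | h0
    · simp
    · rw [invTheta_of_ne τ h0, mul_div_cancel₀ _ (hx h0)]
  have h2 := congrArg (PowerSeries.coeff (n + 1)) h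
  rw [PowerSeries.coeff_mul, PowerSeries.coeff_X] at h2
  simp only [coeff_taylor (theta τ)] at h2
  rw [kNum, h2]
  simp

variable {τ} in
lemma eventually_theta_ne_zero_of_ne {z : ℂ} (hz : theta τ z ≠ 0) : ∀ᶠ w in 𝓝 z, theta τ w ≠ 0 :=
  (differentiable_theta τ).continuous.continuousAt.eventually_ne hz

variable {τ} in
lemma differentiableAt_kCoeff {z : ℂ} (hz : theta τ z ≠ 0) (n : ℕ) :
    DifferentiableAt ℂ (fun w => kCoeff τ w n) z := by
  have h : DifferentiableAt ℂ (fun w => kNum τ n w / theta τ w) z :=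
    (differentiable_kNum τ n z).div (differentiable_theta τ z) hz
  refine h.congr_of_eventuallyEq ?_
  filter_upwards [eventually_theta_ne_zero_of_ne hz] with w hw using kCoeff_eq_div hw n

/-- The residue at an integer, along a line of slope c. Restricting to integers avoids the factors
produced by translations by τ, since `kCoeff` is periodic only under ℤ. -/
lemma tendsto_mul_kCoeff (m : ℤ) {c : ℂ} (hc : c ≠ 0) (n : ℕ) :
    Filter.Tendsto (fun s : ℂ => s * kCoeff τ (m + c * s) n) (𝓝[≠] 0)
      (𝓝 (if n = 0 then c⁻¹ else 0)) := by
  have hmap : Filter.Tendsto (fun s : ℂ => c * s) (𝓝[≠] 0) (𝓝[≠] 0) := by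
    refine tendsto_nhdsWithin_iff.mpr ⟨?_, ?_⟩
    · have : Filter.Tendsto (fun s : ℂ => c * s) (𝓝 0) (𝓝 (c * 0)) := by
        exact (continuous_const.mul continuous_id).tendsto 0
      rw [mul_zero] at this
      exact this.mono_left nhdsWithin_le_nhds
    · filter_upwards [self_mem_nhdsWithin] with s hs using mul_ne_zero hc hs
  have h1 : Filter.Tendsto (fun x => kNum τ n x * invTheta τ x) (𝓝 0)
      (𝓝 (kNum τ n 0 * invTheta τ 0)) :=
    ((differentiable_kNum τ n).continuous.continuousAt.mul
      (analyticAt_invTheta τ).continuousAt).tendsto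
  have h2 := ((h1.mono_left nhdsWithin_le_nhds).comp hmap).const_mul c⁻¹
  rw [invTheta_zero, kNum_zero, mul_one] at h2
  have h3 : c⁻¹ * (if n = 0 then (1 : ℂ) else 0) = if n = 0 then c⁻¹ else 0 := by
    split_ifs <;> simp
  rw [h3] at h2
  refine h2.congr' ?_
  filter_upwards [hmap.eventually (eventually_theta_ne_zero τ), self_mem_nhdsWithin] with s hs hs0
  rw [add_comm, kCoeff_add_int hs, kCoeff_eq_div hs, Function.comp_apply,
    invTheta_of_ne τ (mul_ne_zero hc hs0)]
  field_simp

end KCoeff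

end KZB

end

noncomputable section

namespace KZB

/-! ### Quasi-periodic functions -/

section QuasiPeriodic

variable (τ : ℍ)

/-- The Kronecker function `θ(z+x) / (θ(z) θ(x))`. -/
def kronecker (z x : ℂ) : ℂ := theta τ (z + x) / (theta τ z * theta τ x)

lemma kronecker_add_lattice (z x : ℂ) (m n : ℤ) : kronecker τ (z + (m + n * τ)) x =
    Complex.exp (-(2 * Real.pi * Complex.I) * (n * x)) * kronecker τ z x := by
  obtain ⟨c, hc, h⟩ := exists_theta_add_lattice τ m n
  rw [kronecker, kronecker, show z + (m + n * (τ : ℂ)) + x = z + x + (m + n * τ) by ring, h, h,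
    show -(2 * Real.pi * Complex.I) * (n * (z + x)) = -(2 * Real.pi * Complex.I) * (n * x) +
      -(2 * Real.pi * Complex.I) * (n * z) by ring, Complex.exp_add]
  have := Complex.exp_ne_zero (-(2 * Real.pi * Complex.I) * (n * z))
  -- When a denominator vanishes, both sides are 0 by the convention for division by zero, so no
  -- regularity is required.
  rcases eq_or_ne (theta τ z) 0 with h0 | h0
  · simp [h0]
  rcases eq_or_ne (theta τ x) 0 with h1 | h1
  · simp [h1]
  field_simp

lemma kronecker_neg (z x : ℂ) : kronecker τ (-z) (-x) = -kronecker τ z x := by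
  rw [kronecker, kronecker, ← neg_add, theta_neg, theta_neg, theta_neg, neg_mul_neg, neg_div]

variable {τ} in
-- Quasi-periodicity carries the simple zero at the origin to every lattice point.
lemma deriv_theta_ne_zero {z : ℂ} (hz : theta τ z = 0) : deriv (theta τ) z ≠ 0 := by
  obtain ⟨m, n, rfl⟩ := (theta_eq_zero_iff τ z).mp hz
  obtain ⟨c, hc, h⟩ := exists_theta_add_lattice τ m n
  have h1 : HasDerivAt (fun z => theta τ (z + (m + n * τ))) (deriv (theta τ) (m + n * τ)) 0 := by
    have h2 := (differentiable_theta τ (0 + (m + n * τ))).hasDerivAt.comp_add_const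
      (0 : ℂ) (m + n * (τ : ℂ))
    rwa [zero_add] at h2
  have h2 : HasDerivAt (fun z => c * Complex.exp (-(2 * Real.pi * Complex.I) * (n * z)) *
      theta τ z) c 0 := by
    have h3 : HasDerivAt (fun z : ℂ => c * Complex.exp (-(2 * Real.pi * Complex.I) * (n * z)))
        (deriv (fun z : ℂ => c * Complex.exp (-(2 * Real.pi * Complex.I) * (n * z))) 0) 0 :=
      DifferentiableAt.hasDerivAt (by fun_prop)
    refine (h3.mul (hasDerivAt_theta_zero τ)).congr_deriv ?_
    simp
  have h3 : (fun z => theta τ (z + (m + n * τ))) = fun z =>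
      c * Complex.exp (-(2 * Real.pi * Complex.I) * (n * z)) * theta τ z := funext h
  rw [h3] at h1
  rwa [h1.unique h2]

/-- A quotient of functions with a zero in the numerator and a simple zero in the denominator has
a removable singularity. -/
lemma exists_analyticAt_div {f g : ℂ → ℂ} {a : ℂ} (hf : AnalyticAt ℂ f a) (hg : AnalyticAt ℂ g a)
    (hf0 : f a = 0) (hg0 : g a = 0) (hg' : deriv g a ≠ 0) :
    ∃ h : ℂ → ℂ, AnalyticAt ℂ h a ∧ (fun s => f s / g s) =ᶠ[𝓝[≠] a] h := by
  refine ⟨fun s => dslope f a s / dslope g a s, (analyticAt_dslope_same hf).div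
    (analyticAt_dslope_same hg) (by simpa using hg'), ?_⟩
  filter_upwards [self_mem_nhdsWithin] with s hs
  have hs' : s - a ≠ 0 := sub_ne_zero.mpr hs
  rw [dslope_of_ne _ hs, dslope_of_ne _ hs, slope_def_field, slope_def_field, hf0, hg0, sub_zero,
    sub_zero]
  field_simp

/-- A function with removable singularities only agrees with an entire function near every point,
except possibly at the point itself. -/
lemma exists_differentiable_extension {g : ℂ → ℂ}
    (hg : ∀ a, ∃ h : ℂ → ℂ, AnalyticAt ℂ h a ∧ g =ᶠ[𝓝[≠] a] h) :
    ∃ G : ℂ → ℂ, Differentiable ℂ G ∧ ∀ a, g =ᶠ[𝓝[≠] a] G := by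
  have key : ∀ a, ∃ h : ℂ → ℂ, AnalyticAt ℂ h a ∧ g =ᶠ[𝓝[≠] a] h ∧
      (fun s => Filter.limUnder (𝓝[≠] s) g) =ᶠ[𝓝 a] h := by
    intro a
    obtain ⟨h, hh, he⟩ := hg a
    refine ⟨h, hh, he, ?_⟩
    have h1 := hh.eventually_analyticAt
    have h2 := eventually_eventually_nhdsWithin.mpr he
    rw [eventually_nhdsWithin_iff] at h2
    filter_upwards [h1, h2] with s hs1 hs2
    have hlim : Filter.Tendsto g (𝓝[≠] s) (𝓝 (h s)) := by
      rcases eq_or_ne s a with rfl | hsa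
      · exact (hs1.continuousAt.tendsto.mono_left nhdsWithin_le_nhds).congr'
          (he.mono fun _ => Eq.symm)
      · have h3 := hs2 hsa
        rw [nhdsWithin_eq_nhds.mpr (isOpen_compl_singleton.mem_nhds hsa)] at h3
        exact (hs1.continuousAt.tendsto.mono_left nhdsWithin_le_nhds).congr'
          ((h3.filter_mono nhdsWithin_le_nhds).mono fun _ => Eq.symm)
    exact hlim.limUnder_eq
  -- The extension is defined by punctured limits, so the local extensions need not be glued.
  refine ⟨fun s => Filter.limUnder (𝓝[≠] s) g, fun a => ?_, fun a => ?_⟩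
  · obtain ⟨h, hh, -, he⟩ := key a
    exact (hh.congr he.symm).differentiableAt
  · obtain ⟨h, -, he, he'⟩ := key a
    exact he.trans (he'.filter_mono nhdsWithin_le_nhds).symm

lemma tendsto_add_right_punctured (a c : ℂ) :
    Filter.Tendsto (fun s => s + c) (𝓝[≠] a) (𝓝[≠] (a + c)) := by
  refine tendsto_nhdsWithin_iff.mpr ⟨?_, ?_⟩
  · exact ((continuous_id.add continuous_const).tendsto a).mono_left nhdsWithin_le_nhds
  · filter_upwards [self_mem_nhdsWithin] with s hs
    simpa using hs

/-- An entire function with multipliers `1` and `exp (-2πip)`, where `p` is not in the lattice,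
vanishes. -/
lemma eq_zero_of_quasiPeriodic {G : ℂ → ℂ} (hG : Differentiable ℂ G) {p : ℂ} (hp : theta τ p ≠ 0)
    (h1 : ∀ s, G (s + 1) = G s)
    (hτ : ∀ s, G (s + τ) = Complex.exp (-(2 * Real.pi * Complex.I) * p) * G s) (s : ℂ) :
    G s = 0 := by
  have him : 0 < τ.im := τ.im_pos
  -- This real c makes cτ - p real, so after multiplication by exp(2πics) both multipliers have
  -- absolute value 1. The function H is then bounded by its maximum on a period parallelogram.
  set c : ℝ := p.im / τ.im with hc
  set H : ℂ → ℂ := fun s => Complex.exp (2 * Real.pi * Complex.I * (c * s)) * G s with hH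
  have hHd : Differentiable ℂ H := by fun_prop
  have e1 : ∀ s, H (s + 1) = Complex.exp (2 * Real.pi * Complex.I * c) * H s := by
    intro s
    simp only [hH]
    rw [h1, show 2 * Real.pi * Complex.I * (c * (s + 1)) = 2 * Real.pi * Complex.I * c +
      2 * Real.pi * Complex.I * (c * s) by ring, Complex.exp_add, mul_assoc]
  have eτ : ∀ s, H (s + τ) = Complex.exp (2 * Real.pi * Complex.I * (c * τ - p)) * H s := by
    intro s
    simp only [hH]
    rw [hτ, ← mul_assoc, ← Complex.exp_add, ← mul_assoc (Complex.exp _), ← Complex.exp_add]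
    congr 2
    ring
  have hcp : (c * (τ : ℂ) - p).im = 0 := by
    simp [hc]
    field_simp
    simp
  have norm_exp : ∀ w : ℂ, w.im = 0 → ‖Complex.exp (2 * Real.pi * Complex.I * w)‖ = 1 := by
    intro w hw
    rw [Complex.norm_exp]
    simp [hw]
  have n1 : ∀ s, ‖H (s + 1)‖ = ‖H s‖ := fun s => by
    rw [e1, norm_mul, norm_exp _ (by simp), one_mul]
  have nτ : ∀ s, ‖H (s + τ)‖ = ‖H s‖ := fun s => by rw [eτ, norm_mul, norm_exp _ hcp, one_mul]
  have n1' : ∀ (n : ℤ) s, ‖H (s + n)‖ = ‖H s‖ := by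
    intro n s
    have hper : Function.Periodic (fun s => ‖H s‖) 1 := n1
    simpa using hper.int_mul n s
  have nτ' : ∀ (n : ℤ) s, ‖H (s + n * τ)‖ = ‖H s‖ := by
    intro n s
    have hper : Function.Periodic (fun s => ‖H s‖) (τ : ℂ) := nτ
    simpa using hper.int_mul n s
  have hbdd : Bornology.IsBounded (Set.range H) := by
    have hK : IsCompact ((fun xy : ℝ × ℝ => (xy.1 : ℂ) + xy.2 * τ) ''
        (Set.Icc (0 : ℝ) 1 ×ˢ Set.Icc (0 : ℝ) 1)) :=
      (isCompact_Icc.prod isCompact_Icc).image (by fun_prop)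
    obtain ⟨C, hC⟩ := (hK.image hHd.continuous).isBounded.exists_norm_le
    refine isBounded_iff_forall_norm_le.mpr ⟨C, ?_⟩
    rintro _ ⟨s, rfl⟩
    set y : ℝ := s.im / τ.im
    set x : ℝ := s.re - y * τ.re
    have hs : s = x + y * τ := by
      apply Complex.ext
      · simp [x]
      · simp [y]; field_simp
    have hs' : s = ((Int.fract x : ℝ) : ℂ) + (Int.fract y : ℝ) * τ + (⌊x⌋ : ℤ) + (⌊y⌋ : ℤ) * τ := by
      have hx : (x : ℂ) = (Int.fract x : ℝ) + (⌊x⌋ : ℤ) := by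
        exact_mod_cast (Int.fract_add_floor x).symm
      have hy : (y : ℂ) = (Int.fract y : ℝ) + (⌊y⌋ : ℤ) := by
        exact_mod_cast (Int.fract_add_floor y).symm
      linear_combination hs + hx + (τ : ℂ) * hy
    rw [hs', nτ', n1']
    refine hC _ ⟨_, ⟨(Int.fract x, Int.fract y), ⟨⟨?_, ?_⟩, ?_, ?_⟩, rfl⟩, rfl⟩
    · exact Int.fract_nonneg _
    · exact (Int.fract_lt_one _).le
    · exact Int.fract_nonneg _
    · exact (Int.fract_lt_one _).le
  obtain ⟨C, hC⟩ := hHd.exists_const_forall_eq_of_bounded hbdd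
  -- A nonzero constant would force both multipliers of H to be 1, hence c ∈ ℤ and cτ - p ∈ ℤ, which
  -- would put p in the lattice.
  have hC0 : C = 0 := by
    by_contra hC0
    have f1 := e1 0
    have fτ := eτ 0
    rw [hC, hC] at f1 fτ
    have f1' : Complex.exp (2 * Real.pi * Complex.I * c) = 1 :=
      mul_right_cancel₀ hC0 (by rw [one_mul]; exact f1.symm)
    have fτ' : Complex.exp (2 * Real.pi * Complex.I * (c * τ - p)) = 1 :=
      mul_right_cancel₀ hC0 (by rw [one_mul]; exact fτ.symm)
    obtain ⟨n, hn⟩ := Complex.exp_eq_one_iff.mp f1'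
    obtain ⟨m, hm⟩ := Complex.exp_eq_one_iff.mp fτ'
    have h0 : (2 * Real.pi * Complex.I : ℂ) ≠ 0 := Complex.two_pi_I_ne_zero
    have hn' : (c : ℂ) = n := mul_left_cancel₀ h0 (by rw [hn]; ring)
    have hm' : c * (τ : ℂ) - p = m := mul_left_cancel₀ h0 (by rw [hm]; ring)
    refine hp ((theta_eq_zero_iff τ p).mpr ⟨-m, n, ?_⟩)
    rw [← hn']
    push_cast
    linear_combination -hm'
  have := hC s
  rw [hC0] at this
  exact (mul_eq_zero.mp this).resolve_left (Complex.exp_ne_zero _)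

/-- A quasi-periodic function with removable singularities and nontrivial multiplier vanishes. -/
lemma eq_zero_of_quasiPeriodic_of_removable {g : ℂ → ℂ}
    (hg : ∀ a, ∃ h : ℂ → ℂ, AnalyticAt ℂ h a ∧ g =ᶠ[𝓝[≠] a] h) {p : ℂ} (hp : theta τ p ≠ 0)
    (h1 : ∀ s, g (s + 1) = g s)
    (hτ : ∀ s, g (s + τ) = Complex.exp (-(2 * Real.pi * Complex.I) * p) * g s) {s : ℂ}
    (hs : ContinuousAt g s) : g s = 0 := by
  obtain ⟨G, hG, hgG⟩ := exists_differentiable_extension hg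
  have transfer : ∀ (c μ : ℂ), (∀ s, g (s + c) = μ * g s) → ∀ s, G (s + c) = μ * G s := by
    intro c μ h a
    have t1 : Filter.Tendsto (fun s => G (s + c)) (𝓝[≠] a) (𝓝 (G (a + c))) :=
      ((hG.continuous.comp (continuous_id.add continuous_const)).tendsto a).mono_left
        nhdsWithin_le_nhds
    have t2 : Filter.Tendsto (fun s => μ * G s) (𝓝[≠] a) (𝓝 (μ * G a)) :=
      ((continuous_const.mul hG.continuous).tendsto a).mono_left nhdsWithin_le_nhds
    refine tendsto_nhds_unique_of_eventuallyEq t1 t2 ?_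
    filter_upwards [hgG a, (tendsto_add_right_punctured a c).eventually (hgG (a + c))] with s e1 e2
    rw [← e1, ← e2, h]
  have hG0 := eq_zero_of_quasiPeriodic τ hG hp
    (fun s => by simpa using transfer 1 1 (by simpa using h1) s) (transfer _ _ hτ)
  have t1 : Filter.Tendsto g (𝓝[≠] s) (𝓝 (g s)) := hs.tendsto.mono_left nhdsWithin_le_nhds
  refine tendsto_nhds_unique_of_eventuallyEq t1 (tendsto_const_nhds (x := (0 : ℂ))) ?_
  filter_upwards [hgG s] with x hx
  rw [hx, hG0]

end QuasiPeriodic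

end KZB

end

noncomputable section

namespace KZB

/-! ### The theta function identity of a plane configuration -/

section PlaneConfig

variable {ι : Type*}

/-- The determinant of the vectors `(a i, b i)` and `(a j, b j)`. -/
def planeDet (a b : ι → ℂ) (i j : ι) : ℂ := a i * b j - a j * b i

/-- The first coordinate of `(p₁, p₂)` in the basis `(a i, b i)`, `(a j, b j)`. -/
def planeCoord (a b : ι → ℂ) (p₁ p₂ : ℂ) (i j : ι) : ℂ := (b j * p₁ - a j * p₂) / planeDet a b i j

/-- A finite set of vectors `(a i, b i)` in a plane, together with an antisymmetric matrix `T`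
satisfying the Kohno relations. -/
structure IsPlaneConfig (S : Finset ι) (a b : ι → ℂ) (T : ι → ι → ℂ) : Prop where
  det_ne_zero : ∀ i ∈ S, ∀ j ∈ S, j ≠ i → planeDet a b i j ≠ 0
  primitive : ∀ i ∈ S, ∃ m₁ m₂ : ℂ, a i * m₁ + b i * m₂ = 1 ∧
    ∀ j ∈ S, ∃ n : ℤ, a j * m₁ + b j * m₂ = n
  base : ∃ i ∈ S, a i = 1 ∧ b i = 0
  antisymm : ∀ i j, T i j = -T j i
  rel : ∀ i ∈ S, ∀ e : ℂ, ∑ j ∈ S with planeDet a b i j ^ 2 = e, T i j = 0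

lemma planeDet_swap (a b : ι → ℂ) (i j : ι) : planeDet a b j i = -planeDet a b i j := by
  simp only [planeDet]; ring

lemma planeDet_self (a b : ι → ℂ) (i : ι) : planeDet a b i i = 0 := by
  simp only [planeDet]; ring

namespace IsPlaneConfig

variable {S : Finset ι} {a b : ι → ℂ} {T : ι → ι → ℂ}

lemma diag (h : IsPlaneConfig S a b T) (i : ι) : T i i = 0 := by
  have := h.antisymm i i
  linear_combination this / 2

/-- An even function is constant on each fibre of j ↦ det(i,j)², and `rel` kills the sum of T i j
over each fibre. -/
lemma sum_even_eq_zero (h : IsPlaneConfig S a b T) {i : ι} (hi : i ∈ S) {f : ℂ → ℂ}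
    (hf : ∀ c, f (-c) = f c) :
    ∑ j ∈ S, T i j * f (planeDet a b i j) = 0 := by
  classical
  rw [← Finset.sum_fiberwise_of_maps_to (t := S.image fun j => planeDet a b i j ^ 2)
    (g := fun j => planeDet a b i j ^ 2) (fun j hj => Finset.mem_image_of_mem _ hj)]
  refine Finset.sum_eq_zero fun e he => ?_
  obtain ⟨j₀, hj₀, rfl⟩ := Finset.mem_image.mp he
  have : ∀ j ∈ S.filter (fun j => planeDet a b i j ^ 2 = planeDet a b i j₀ ^ 2),
      T i j * f (planeDet a b i j) = T i j * f (planeDet a b i j₀) := by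
    intro j hj
    rcases sq_eq_sq_iff_eq_or_eq_neg.mp (Finset.mem_filter.mp hj).2 with h1 | h1 <;> rw [h1]
    rw [hf]
  rw [Finset.sum_congr rfl this, ← Finset.sum_mul, h.rel i hi, zero_mul]

/-- The residue of the sum of products of Kronecker functions along a divisor `a i z₁ + b i z₂ ∈ Λ`
vanishes. -/
lemma residue_eq_zero (h : IsPlaneConfig S a b T) (τ : ℍ) {p₁ p₂ : ℂ}
    (hξ : ∀ i ∈ S, ∀ j ∈ S, j ≠ i → theta τ (planeCoord a b p₁ p₂ i j) ≠ 0) {i : ι} (hi : i ∈ S)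
    {z₁ z₂ : ℂ} (hz : theta τ (a i * z₁ + b i * z₂) = 0) :
    ∑ j ∈ S, planeDet a b i j * T i j * (theta τ (a i * z₁ + b i * z₂ + planeCoord a b p₁ p₂ i j) *
      (theta τ (planeCoord a b p₁ p₂ i j))⁻¹ *
      kronecker τ (a j * z₁ + b j * z₂) (planeCoord a b p₁ p₂ j i)) = 0 := by
  obtain ⟨l, l', hl⟩ := (theta_eq_zero_iff τ _).mp hz
  obtain ⟨m₁, m₂, hm, hmS⟩ := h.primitive i hi
  obtain ⟨c, -, hc⟩ := exists_theta_add_lattice τ l l'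
  set ℓ : ℂ := l + l' * τ with hℓ
  -- Here α_i(m) = 1 and ℓ = α_i(z), so z - ℓm lies in the kernel of α_i. Consequently α_j(z) = σ
  -- det(i,j) + ℓ α_j(m), where α_j(m) is an integer.
  set σ : ℂ := m₁ * (z₂ - ℓ * m₂) - m₂ * (z₁ - ℓ * m₁) with hσ
  set E := Complex.exp (-(2 * Real.pi * Complex.I) * (l' * (p₁ * m₁ + p₂ * m₂))) with hE
  set δ := b i * p₁ - a i * p₂ with hδ
  -- After lattice translations, the term of index j depends on j only through T i j and this
  -- function of det(i,j). It is even because the Kronecker function is odd in (z,x) jointly.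
  set f : ℂ → ℂ := fun d => d * kronecker τ (σ * d) (-(δ / d)) with hf
  have hfeven : ∀ d, f (-d) = f d := by
    intro d
    simp only [hf]
    rw [show σ * -d = -(σ * d) by ring, show -(δ / -d) = -(-(δ / d)) by rw [div_neg],
      kronecker_neg]
    ring
  have hterm : ∀ j ∈ S, planeDet a b i j * T i j *
      (theta τ (a i * z₁ + b i * z₂ + planeCoord a b p₁ p₂ i j) *
      (theta τ (planeCoord a b p₁ p₂ i j))⁻¹ *
      kronecker τ (a j * z₁ + b j * z₂) (planeCoord a b p₁ p₂ j i)) =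
      c * E * (T i j * f (planeDet a b i j)) := by
    intro j hj
    rcases eq_or_ne j i with rfl | hji
    · simp [h.diag]
    have hd := h.det_ne_zero i hi j hj hji
    obtain ⟨n, hn⟩ := hmS j hj
    have hζ : a j * z₁ + b j * z₂ = σ * planeDet a b i j + ((n * l : ℤ) + (n * l' : ℤ) * τ) := by
      have e1 : a i * (z₁ - ℓ * m₁) + b i * (z₂ - ℓ * m₂) = 0 := by
        linear_combination hl - ℓ * hm
      have e2 : (((n * l : ℤ) : ℂ) + (n * l' : ℤ) * τ) = ℓ * (a j * m₁ + b j * m₂) := by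
        rw [hn, hℓ]; push_cast; ring
      rw [e2, hσ, planeDet]
      linear_combination (a j * m₁ + b j * m₂) * e1 -
        (a j * (z₁ - ℓ * m₁) + b j * (z₂ - ℓ * m₂)) * hm
    have hji' : planeCoord a b p₁ p₂ j i = -(δ / planeDet a b i j) := by
      rw [planeCoord, planeDet_swap a b i j, div_neg]
    -- Since p = ξ_ij α_i + ξ_ji α_j, pairing with m shows that the combined exponent of the two
    -- translations does not depend on j.
    have hpm : planeCoord a b p₁ p₂ i j + n * -(δ / planeDet a b i j) = p₁ * m₁ + p₂ * m₂ := by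
      have e1 : (b j * p₁ - a j * p₂) - n * δ = (p₁ * m₁ + p₂ * m₂) * planeDet a b i j := by
        rw [← hn, hδ, planeDet]
        linear_combination -(b j * p₁ - a j * p₂) * hm
      rw [planeCoord]
      field_simp
      linear_combination e1
    have hexp : Complex.exp (-(2 * Real.pi * Complex.I) * (l' * planeCoord a b p₁ p₂ i j)) *
        Complex.exp (-(2 * Real.pi * Complex.I) *
          ((n * l' : ℤ) * -(δ / planeDet a b i j))) = E := by
      rw [← Complex.exp_add, hE, ← hpm]
      congr 1; push_cast; ring
    rw [hl, add_comm ℓ, hc, hζ, kronecker_add_lattice, hji', ← hexp]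
    have := hξ i hi j hj hji
    simp only [hf]
    field_simp
  rw [Finset.sum_congr rfl hterm, ← Finset.mul_sum, h.sum_even_eq_zero hi hfeven, mul_zero]

end IsPlaneConfig

lemma kronecker_eq_mul (τ : ℍ) (z x : ℂ) :
    kronecker τ z x = theta τ (z + x) / theta τ z * (theta τ x)⁻¹ := by
  rw [kronecker, div_mul_eq_div_div, div_eq_mul_inv _ (theta τ x)]

lemma analyticAt_kronecker_line {τ : ℍ} (x u n : ℂ) {s : ℂ} (hs : theta τ (u + s * n) ≠ 0) :
    AnalyticAt ℂ (fun s => kronecker τ (u + s * n) x) s := by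
  have hd := differentiable_theta τ
  simp only [kronecker_eq_mul]
  refine AnalyticAt.mul (AnalyticAt.div (Differentiable.analyticAt ?_ s)
    (Differentiable.analyticAt ?_ s) hs) analyticAt_const <;> fun_prop

/-- The sum over pairs of products of Kronecker functions attached to a plane configuration. -/
def kroneckerSum (τ : ℍ) (S : Finset ι) (a b : ι → ℂ) (T : ι → ι → ℂ) (p₁ p₂ : ℂ) (ζ : ι → ℂ) : ℂ :=
  ∑ i ∈ S, ∑ j ∈ S, planeDet a b i j * T i j *
    (kronecker τ (ζ i) (planeCoord a b p₁ p₂ i j) * kronecker τ (ζ j) (planeCoord a b p₁ p₂ j i))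

namespace IsPlaneConfig

variable {S : Finset ι} {a b : ι → ℂ} {T : ι → ι → ℂ}

/-- At s₀ at most one vector i is singular, and the line crosses its divisor transversally. The
antisymmetries of the determinant and of T make the summand symmetric in (i,j), so the singular
terms add up to 2N/θ(α_i) with θ having a simple zero; the numerator N vanishes at s₀ by
`residue_eq_zero`. -/
lemma removable_kroneckerSum (h : IsPlaneConfig S a b T) (τ : ℍ) {p₁ p₂ : ℂ}
    (hξ : ∀ i ∈ S, ∀ j ∈ S, j ≠ i → theta τ (planeCoord a b p₁ p₂ i j) ≠ 0) (z₁ z₂ m₁ m₂ s₀ : ℂ)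
    (hmult : ∀ i ∈ S, ∀ j ∈ S, i ≠ j →
      theta τ (a i * z₁ + b i * z₂ + s₀ * (a i * m₁ + b i * m₂)) = 0 →
      theta τ (a j * z₁ + b j * z₂ + s₀ * (a j * m₁ + b j * m₂)) ≠ 0)
    (htrans : ∀ i ∈ S, theta τ (a i * z₁ + b i * z₂ + s₀ * (a i * m₁ + b i * m₂)) = 0 →
      a i * m₁ + b i * m₂ ≠ 0) :
    ∃ F : ℂ → ℂ, AnalyticAt ℂ F s₀ ∧ (fun s => kroneckerSum τ S a b T p₁ p₂
      fun i => a i * z₁ + b i * z₂ + s * (a i * m₁ + b i * m₂)) =ᶠ[𝓝[≠] s₀] F := by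
  classical
  set u : ι → ℂ := fun i => a i * z₁ + b i * z₂ with hu
  set n : ι → ℂ := fun i => a i * m₁ + b i * m₂ with hn
  set f : ι → ι → ℂ → ℂ := fun i j s => planeDet a b i j * T i j *
    (kronecker τ (u i + s * n i) (planeCoord a b p₁ p₂ i j) *
      kronecker τ (u j + s * n j) (planeCoord a b p₁ p₂ j i)) with hf
  have hfan : ∀ i j, theta τ (u i + s₀ * n i) ≠ 0 → theta τ (u j + s₀ * n j) ≠ 0 →
      AnalyticAt ℂ (f i j) s₀ := fun i j hi hj => analyticAt_const.mul
    ((analyticAt_kronecker_line _ _ _ hi).mul (analyticAt_kronecker_line _ _ _ hj))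
  by_cases hex : ∃ i ∈ S, theta τ (u i + s₀ * n i) = 0
  swap
  · push Not at hex
    exact ⟨_, Finset.analyticAt_fun_sum _ fun i hi => Finset.analyticAt_fun_sum _ fun j hj =>
      hfan i j (hex i hi) (hex j hj), Filter.EventuallyEq.rfl⟩
  obtain ⟨i, hi, hi0⟩ := hex
  have hne : ∀ j ∈ S, j ≠ i → theta τ (u j + s₀ * n j) ≠ 0 :=
    fun j hj hji => hmult i hi j hj hji.symm hi0
  have hsymm : ∀ i j s, f i j s = f j i s := by
    intro i j s
    simp only [hf]
    rw [planeDet_swap a b i j, h.antisymm i j]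
    ring
  have hsplit : ∀ s, (∑ i' ∈ S, ∑ j ∈ S, f i' j s) = 2 * (∑ j ∈ S, f i j s) +
      ∑ i' ∈ S.erase i, ∑ j ∈ S.erase i, f i' j s := by
    intro s
    have hii : f i i s = 0 := by simp [hf, h.diag]
    have h1 : ∑ i' ∈ S.erase i, f i' i s = ∑ j ∈ S, f i j s := by
      rw [← Finset.add_sum_erase S _ hi, hii, zero_add]
      exact Finset.sum_congr rfl fun j _ => hsymm _ _ _
    rw [← Finset.add_sum_erase S _ hi]
    have h2 : ∀ i' ∈ S.erase i, ∑ j ∈ S, f i' j s = f i' i s + ∑ j ∈ S.erase i, f i' j s :=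
      fun i' _ => (Finset.add_sum_erase S _ hi).symm
    rw [Finset.sum_congr rfl h2, Finset.sum_add_distrib, h1]
    ring
  set N : ℂ → ℂ := fun s => ∑ j ∈ S, planeDet a b i j * T i j *
    (theta τ (u i + s * n i + planeCoord a b p₁ p₂ i j) *
      (theta τ (planeCoord a b p₁ p₂ i j))⁻¹ *
      kronecker τ (u j + s * n j) (planeCoord a b p₁ p₂ j i)) with hN
  have hd := differentiable_theta τ
  have hNan : AnalyticAt ℂ N s₀ := by
    refine Finset.analyticAt_fun_sum _ fun j hj => ?_
    rcases eq_or_ne j i with rfl | hji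
    · simp only [h.diag, mul_zero, zero_mul]; exact analyticAt_const
    · refine analyticAt_const.mul (AnalyticAt.mul (Differentiable.analyticAt (by fun_prop) s₀)
        (analyticAt_kronecker_line _ _ _ (hne j hj hji)))
  have hcomb : ∀ i s, u i + s * n i = a i * (z₁ + s * m₁) + b i * (z₂ + s * m₂) := by
    intro i s; simp only [hu, hn]; ring
  have hN0 : N s₀ = 0 := by
    simp only [hN, hcomb]
    rw [hcomb] at hi0
    exact h.residue_eq_zero τ hξ hi hi0
  have hθan : AnalyticAt ℂ (fun s => theta τ (u i + s * n i)) s₀ :=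
    Differentiable.analyticAt (by fun_prop) s₀
  have hθ' : deriv (fun s => theta τ (u i + s * n i)) s₀ ≠ 0 := by
    have h1 : HasDerivAt (fun s : ℂ => u i + s * n i) (n i) s₀ := by
      simpa using ((hasDerivAt_id s₀).mul_const (n i)).const_add (u i)
    have h2 := (hd (u i + s₀ * n i)).hasDerivAt.comp s₀ h1
    have h3 : deriv (fun s => theta τ (u i + s * n i)) s₀ =
      deriv (theta τ) (u i + s₀ * n i) * n i := h2.deriv
    rw [h3]
    exact mul_ne_zero (deriv_theta_ne_zero hi0) (htrans i hi hi0)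
  obtain ⟨F, hF, hFe⟩ := exists_analyticAt_div hNan hθan hN0 hi0 hθ'
  refine ⟨fun s => 2 * F s + ∑ i' ∈ S.erase i, ∑ j ∈ S.erase i, f i' j s,
    (analyticAt_const.mul hF).add (Finset.analyticAt_fun_sum _ fun i' hi' =>
      Finset.analyticAt_fun_sum _ fun j hj => hfan i' j
        (hne i' (Finset.mem_of_mem_erase hi') (Finset.ne_of_mem_erase hi'))
        (hne j (Finset.mem_of_mem_erase hj) (Finset.ne_of_mem_erase hj))), ?_⟩
  filter_upwards [hFe] with s hs
  have h1 : N s / theta τ (u i + s * n i) = ∑ j ∈ S, f i j s := by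
    rw [hN, Finset.sum_div]
    refine Finset.sum_congr rfl fun j _ => ?_
    simp only [hf]
    rw [kronecker_eq_mul τ (u i + s * n i)]
    ring
  rw [← hs, h1, ← hsplit]
  rfl

/-- ξ_ij and ξ_ji are the coordinates of p in the basis α_i, α_j. The multipliers of the two
Kronecker factors therefore multiply to an exponential depending only on p(m), the same for all
pairs. -/
lemma kroneckerSum_add_lattice (h : IsPlaneConfig S a b T) (τ : ℍ) (p₁ p₂ m₁ m₂ : ℂ) (ζ : ι → ℂ)
    (hm : ∀ i ∈ S, ∃ n : ℤ, a i * m₁ + b i * m₂ = n) (k l : ℤ) :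
    kroneckerSum τ S a b T p₁ p₂ (fun i => ζ i + (k + l * τ) * (a i * m₁ + b i * m₂)) =
      Complex.exp (-(2 * Real.pi * Complex.I) * (l * (p₁ * m₁ + p₂ * m₂))) *
        kroneckerSum τ S a b T p₁ p₂ ζ := by
  simp only [kroneckerSum, Finset.mul_sum]
  refine Finset.sum_congr rfl fun i hi => Finset.sum_congr rfl fun j hj => ?_
  rcases eq_or_ne j i with rfl | hji
  · simp [h.diag]
  have hd := h.det_ne_zero i hi j hj hji
  obtain ⟨n, hn⟩ := hm i hi
  obtain ⟨n', hn'⟩ := hm j hj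
  have hpm : n * planeCoord a b p₁ p₂ i j + n' * planeCoord a b p₁ p₂ j i = p₁ * m₁ + p₂ * m₂ := by
    rw [← hn, ← hn', planeCoord, planeCoord, planeDet_swap a b i j]
    field_simp
    simp only [planeDet]
    ring
  have hexp : Complex.exp (-(2 * Real.pi * Complex.I) * (l * (p₁ * m₁ + p₂ * m₂))) =
      Complex.exp (-(2 * Real.pi * Complex.I) * ((n * l : ℤ) * planeCoord a b p₁ p₂ i j)) *
      Complex.exp (-(2 * Real.pi * Complex.I) * ((n' * l : ℤ) * planeCoord a b p₁ p₂ j i)) := by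
    rw [← Complex.exp_add, ← hpm]
    congr 1; push_cast; ring
  have e : ∀ n : ℤ, ((k : ℂ) + l * τ) * n = ((n * k : ℤ) : ℂ) + (n * l : ℤ) * τ := by
    intro n; push_cast; ring
  rw [hn, hn', e, e, kronecker_add_lattice, kronecker_add_lattice, hexp]
  ring

lemma countable_theta_eq_zero (τ : ℍ) : {z : ℂ | theta τ z = 0}.Countable := by
  refine (Set.countable_range fun mn : ℤ × ℤ => (mn.1 : ℂ) + mn.2 * τ).mono ?_
  intro z hz
  obtain ⟨m, n, hmn⟩ := (theta_eq_zero_iff τ z).mp hz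
  exact ⟨(m, n), hmn.symm⟩

/-- The sum of products of Kronecker functions attached to a plane configuration vanishes. -/
theorem kroneckerSum_eq_zero (h : IsPlaneConfig S a b T) (τ : ℍ) {p₁ p₂ m₁ m₂ : ℂ}
    (hξ : ∀ i ∈ S, ∀ j ∈ S, j ≠ i → theta τ (planeCoord a b p₁ p₂ i j) ≠ 0)
    (hm : ∀ i ∈ S, ∃ n : ℤ, a i * m₁ + b i * m₂ = n) (hm₁ : m₁ ≠ 0)
    (hp : theta τ (p₁ * m₁ + p₂ * m₂) ≠ 0) {z₁ z₂ : ℂ}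
    (hz : ∀ i ∈ S, theta τ (a i * z₁ + b i * z₂) ≠ 0) :
    kroneckerSum τ S a b T p₁ p₂ (fun i => a i * z₁ + b i * z₂) = 0 := by
  classical
  have hd := differentiable_theta τ
  -- The base point is displaced by ε in the second coordinate. Because m₁ ≠ 0 this displacement is
  -- transverse to the line, so outside a countable set of ε the line meets the divisors one at a
  -- time; continuity in ε then reaches ε = 0.
  set u : ι → ℂ → ℂ := fun i ε => a i * z₁ + b i * (z₂ + ε) with hu
  set n : ι → ℂ := fun i => a i * m₁ + b i * m₂ with hn
  set B : Set ℂ := (⋃ i ∈ S, {ε | theta τ (u i ε) = 0}) ∪ ⋃ i ∈ S, ⋃ j ∈ S, ⋃ (_ : i ≠ j),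
    {ε | ∃ s, theta τ (u i ε + s * n i) = 0 ∧ theta τ (u j ε + s * n j) = 0} with hB
  have hBc : B.Countable := by
    refine Set.Countable.union ?_ ?_
    · refine Set.Countable.biUnion S.countable_toSet fun i hi => ?_
      rcases eq_or_ne (b i) 0 with h0 | h0
      · refine Set.countable_empty.mono fun ε hε => hz i hi ?_
        simpa [hu, h0] using hε
      · refine ((countable_theta_eq_zero τ).preimage_of_injOn (f := u i) ?_)
        intro x _ y _ hxy
        simpa [hu, h0] using hxy
    · refine Set.Countable.biUnion S.countable_toSet fun i hi =>
        Set.Countable.biUnion S.countable_toSet fun j hj => Set.countable_iUnion fun hij => ?_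
      have hdet := h.det_ne_zero i hi j hj hij.symm
      have hc : n j * b i - n i * b j ≠ 0 := by
        have : n j * b i - n i * b j = -(planeDet a b i j * m₁) := by
          simp only [hn, planeDet]; ring
        rw [this]
        exact neg_ne_zero.mpr (mul_ne_zero hdet hm₁)
      refine (((countable_theta_eq_zero τ).prod (countable_theta_eq_zero τ)).image
        fun x : ℂ × ℂ => (n j * (x.1 - u i 0) - n i * (x.2 - u j 0)) /
          (n j * b i - n i * b j)).mono ?_
      rintro ε ⟨s, h1, h2⟩
      refine ⟨(u i ε + s * n i, u j ε + s * n j), ⟨h1, h2⟩, ?_⟩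
      simp only [hu]
      field_simp
      ring
  have hvan : ∀ ε ∈ Bᶜ, kroneckerSum τ S a b T p₁ p₂ (fun i => u i ε) = 0 := by
    intro ε hε
    have hreg : ∀ i ∈ S, theta τ (u i ε) ≠ 0 := fun i hi h0 =>
      hε (Or.inl (Set.mem_biUnion hi h0))
    have hmult : ∀ i ∈ S, ∀ j ∈ S, i ≠ j → ∀ s, theta τ (u i ε + s * n i) = 0 →
        theta τ (u j ε + s * n j) ≠ 0 := fun i hi j hj hij s h0 h1 =>
      hε (Or.inr (Set.mem_biUnion hi (Set.mem_biUnion hj (Set.mem_iUnion.mpr ⟨hij, s, h0, h1⟩))))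
    set g : ℂ → ℂ := fun s => kroneckerSum τ S a b T p₁ p₂ fun i => u i ε + s * n i with hg
    have hg0 : g 0 = kroneckerSum τ S a b T p₁ p₂ fun i => u i ε := by simp [hg]
    rw [← hg0]
    refine eq_zero_of_quasiPeriodic_of_removable τ (fun s => ?_) hp (fun s => ?_) (fun s => ?_) ?_
    · refine h.removable_kroneckerSum τ hξ z₁ (z₂ + ε) m₁ m₂ s
        (fun i hi j hj hij => hmult i hi j hj hij s) fun i hi h0 hn0 => hreg i hi ?_
      rw [hn0, mul_zero, add_zero] at h0
      exact h0
    · have := h.kroneckerSum_add_lattice τ p₁ p₂ m₁ m₂ (fun i => u i ε + s * n i) hm 1 0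
      simp only [Int.cast_one, Int.cast_zero, zero_mul, add_zero, one_mul, mul_zero,
        Complex.exp_zero] at this
      rw [hg]
      simp only
      rw [← this]
      congr 1; funext i; simp only [hn]; ring
    · have := h.kroneckerSum_add_lattice τ p₁ p₂ m₁ m₂ (fun i => u i ε + s * n i) hm 0 1
      simp only [Int.cast_one, Int.cast_zero, zero_add, one_mul] at this
      rw [hg]
      simp only
      rw [← this]
      congr 1; funext i; simp only [hn]; ring
    · refine tendsto_finsetSum _ fun i hi => tendsto_finsetSum _ fun j hj => ?_
      have hi0 : theta τ (u i ε + 0 * n i) ≠ 0 := by simpa using hreg i hi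
      have hj0 : theta τ (u j ε + 0 * n j) ≠ 0 := by simpa using hreg j hj
      exact (analyticAt_const.mul ((analyticAt_kronecker_line _ _ _ hi0).mul
        (analyticAt_kronecker_line _ _ _ hj0))).continuousAt
  have hcont : ContinuousAt (fun ε => kroneckerSum τ S a b T p₁ p₂ (fun i => u i ε)) 0 := by
    refine tendsto_finsetSum _ fun i hi => tendsto_finsetSum _ fun j hj => ?_
    have e : ∀ i, u i = fun ε => a i * z₁ + b i * z₂ + ε * b i := by
      intro i; funext ε; simp only [hu]; ring
    have hi0 : theta τ (a i * z₁ + b i * z₂ + 0 * b i) ≠ 0 := by simpa using hz i hi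
    have hj0 : theta τ (a j * z₁ + b j * z₂ + 0 * b j) ≠ 0 := by simpa using hz j hj
    simp only [e]
    exact (analyticAt_const.mul ((analyticAt_kronecker_line _ _ _ hi0).mul
      (analyticAt_kronecker_line _ _ _ hj0))).continuousAt
  have hdense : Dense Bᶜ := hBc.dense_compl ℂ
  have hne : (𝓝[Bᶜ] (0 : ℂ)).NeBot := mem_closure_iff_nhdsWithin_neBot.mp (hdense 0)
  have t1 := hcont.tendsto.mono_left (nhdsWithin_le_nhds (s := Bᶜ))
  have h0 := tendsto_nhds_unique_of_eventuallyEq t1 (tendsto_const_nhds (x := (0 : ℂ)))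
    (by filter_upwards [self_mem_nhdsWithin] with ε hε using hvan ε hε)
  simpa [hu] using h0

end IsPlaneConfig

end PlaneConfig

end KZB

end

noncomputable section

namespace KZB

/-! ### The quadratic identity for the Taylor coefficients of `k` -/

section Coefficients

open Polynomial Finset.HasAntidiagonal
open scoped Polynomial.Bivariate

variable {ι : Type*}

lemma coeff_taylor_quadratic {f g e : ℂ → ℂ} (hf : AnalyticAt ℂ f 0) (hg : AnalyticAt ℂ g 0)
    (he : AnalyticAt ℂ e 0) (c c' : ℂ) (d : ℕ) :
    PowerSeries.coeff (d + 1) (taylor fun r => c * (r * (f r * g r) + c' * (e r + -1 * f r))) =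
      c * ((∑ nm ∈ antidiagonal d, PowerSeries.coeff nm.1 (taylor f) *
        PowerSeries.coeff nm.2 (taylor g)) +
        c' * (PowerSeries.coeff (d + 1) (taylor e) - PowerSeries.coeff (d + 1) (taylor f))) := by
  have hfg : AnalyticAt ℂ (fun r => f r * g r) 0 := hf.mul hg
  have hxfg : AnalyticAt ℂ (fun r => r * (f r * g r)) 0 := analyticAt_id.mul hfg
  have hf' : AnalyticAt ℂ (fun r => -1 * f r) 0 := analyticAt_const.mul hf
  have hef : AnalyticAt ℂ (fun r => e r + -1 * f r) 0 := he.add hf'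
  have hcef : AnalyticAt ℂ (fun r => c' * (e r + -1 * f r)) 0 := analyticAt_const.mul hef
  rw [taylor_const_mul (f := fun r => r * (f r * g r) + c' * (e r + -1 * f r)) (hxfg.add hcef),
    taylor_add hxfg hcef, taylor_mul (f := fun r => r) (g := fun r => f r * g r) analyticAt_id hfg,
    taylor_mul hf hg, taylor_const_mul hef, taylor_add he hf', taylor_const_mul hf, taylor_id,
    PowerSeries.coeff_C_mul, map_add, PowerSeries.coeff_succ_X_mul, PowerSeries.coeff_C_mul,
    map_add, PowerSeries.coeff_C_mul, PowerSeries.coeff_mul]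
  ring

/-- The linear form `c₁ X + c₂ Y`. -/
def linForm (c₁ c₂ : ℂ) : ℂ[X][Y] := C (C c₁ * X) + C (C c₂) * X

lemma evalEval_linForm (c₁ c₂ p₁ p₂ : ℂ) : evalEval p₁ p₂ (linForm c₁ c₂) = c₁ * p₁ + c₂ * p₂ := by
  simp [linForm, evalEval]

lemma linForm_ne_zero {c₁ c₂ : ℂ} (h : c₁ ≠ 0 ∨ c₂ ≠ 0) : linForm c₁ c₂ ≠ 0 := by
  intro h0
  rcases h with h | h
  · have := evalEval_linForm c₁ c₂ 1 0
    rw [h0] at this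
    simp at this
    exact h this.symm
  · have := evalEval_linForm c₁ c₂ 0 1
    rw [h0] at this
    simp at this
    exact h this.symm

lemma eq_zero_of_evalEval {Q : ℂ[X][Y]} (h : ∀ p₁ p₂, evalEval p₁ p₂ Q = 0) : Q = 0 := by
  refine Polynomial.eq_zero_of_infinite_isRoot Q ?_
  refine (Set.infinite_range_of_injective (C_injective (R := ℂ))).mono ?_
  rintro _ ⟨y, rfl⟩
  exact Polynomial.funext fun x => by simpa [evalEval] using h x y

/-- The product QG vanishes everywhere, and bivariate polynomials form a domain. -/
lemma eq_zero_of_generic_evalEval {Q G : ℂ[X][Y]} (hG : G ≠ 0)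
    (h : ∀ p₁ p₂, evalEval p₁ p₂ G ≠ 0 → evalEval p₁ p₂ Q = 0) : Q = 0 := by
  refine (mul_eq_zero.mp (eq_zero_of_evalEval (Q := Q * G) fun p₁ p₂ => ?_)).resolve_right hG
  rw [evalEval_mul]
  by_cases hg : evalEval p₁ p₂ G = 0
  · rw [hg, mul_zero]
  · rw [h p₁ p₂ hg, zero_mul]

/-- The polynomial `planeCoord` in `(p₁, p₂)`. -/
def coordPoly (a b : ι → ℂ) (i j : ι) : ℂ[X][Y] :=
  linForm (b j / planeDet a b i j) (-a j / planeDet a b i j)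

lemma evalEval_coordPoly (a b : ι → ℂ) (i j : ι) (p₁ p₂ : ℂ) :
    evalEval p₁ p₂ (coordPoly a b i j) = planeCoord a b p₁ p₂ i j := by
  rw [coordPoly, evalEval_linForm, planeCoord]
  ring

/-- The contribution of the pair `i, j` to the curvature in degree `d`. -/
def pairPoly (τ : ℍ) (a b c₁ c₂ ζ : ι → ℂ) (d : ℕ) (i j : ι) : ℂ[X][Y] :=
  (∑ nm ∈ antidiagonal d, C (C (kCoeff τ (ζ i) nm.1 * kCoeff τ (ζ j) nm.2)) *
    (coordPoly a b i j ^ nm.1 * coordPoly a b j i ^ nm.2)) -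
  C (C (2 * kCoeff τ (ζ i) (d + 1) * (a j * c₁ i + b j * c₂ i))) *
    ∑ nm ∈ antidiagonal d, linForm (c₁ i) (c₂ i) ^ nm.1 * coordPoly a b i j ^ nm.2

namespace IsPlaneConfig

variable {S : Finset ι} {a b : ι → ℂ} {T : ι → ι → ℂ}

/-- 1/ξ_ji is det(i,j) times a factor depending only on i, so the inner sum is a multiple of ∑ T_ij
det(i,j)², an instance of `sum_even_eq_zero`. -/
lemma sum_div_planeCoord_eq_zero (h : IsPlaneConfig S a b T) (p₁ p₂ : ℂ) (f : ι → ℂ) :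
    ∑ i ∈ S, ∑ j ∈ S, planeDet a b i j * T i j * (f i / planeCoord a b p₁ p₂ j i) = 0 := by
  refine Finset.sum_eq_zero fun i hi => ?_
  have h1 := h.sum_even_eq_zero hi (f := fun c => c ^ 2) (fun c => by ring)
  have h2 : ∀ j ∈ S, planeDet a b i j * T i j * (f i / planeCoord a b p₁ p₂ j i) =
      -(f i / (b i * p₁ - a i * p₂)) * (T i j * planeDet a b i j ^ 2) := by
    intro j hj
    rw [planeCoord, planeDet_swap a b i j, div_neg, div_neg, div_div_eq_mul_div]
    ring
  rw [Finset.sum_congr rfl h2, ← Finset.mul_sum, h1, mul_zero]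

/-- From p₁ = a_i ξ_ij + a_j ξ_ji one gets the partial fractions 1/(ξ_ij ξ_ji) = a_i/(p₁ ξ_ji) +
a_j/(p₁ ξ_ij), and each part is of the form treated in `sum_div_planeCoord_eq_zero`. -/
lemma sum_inv_planeCoord_eq_zero (h : IsPlaneConfig S a b T) {p₁ p₂ : ℂ} (hp₁ : p₁ ≠ 0)
    (hδ : ∀ i ∈ S, b i * p₁ - a i * p₂ ≠ 0) :
    ∑ i ∈ S, ∑ j ∈ S, planeDet a b i j * T i j *
      (1 / (planeCoord a b p₁ p₂ i j * planeCoord a b p₁ p₂ j i)) = 0 := by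
  have h1 := h.sum_div_planeCoord_eq_zero p₁ p₂ (fun i => a i / p₁)
  have h2 : ∑ i ∈ S, ∑ j ∈ S, planeDet a b i j * T i j *
      (1 / (planeCoord a b p₁ p₂ i j * planeCoord a b p₁ p₂ j i)) =
      (∑ i ∈ S, ∑ j ∈ S, planeDet a b i j * T i j * (a i / p₁ / planeCoord a b p₁ p₂ j i)) +
      ∑ i ∈ S, ∑ j ∈ S, planeDet a b j i * T j i * (a j / p₁ / planeCoord a b p₁ p₂ i j) := by
    simp only [← Finset.sum_add_distrib]
    refine Finset.sum_congr rfl fun i hi => Finset.sum_congr rfl fun j hj => ?_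
    rcases eq_or_ne j i with rfl | hji
    · simp [h.diag]
    have hd := h.det_ne_zero i hi j hj hji
    have hi' := hδ i hi
    have hj' := hδ j hj
    have hpd : a i * (b j * p₁ - a j * p₂) - a j * (b i * p₁ - a i * p₂) =
        p₁ * planeDet a b i j := by simp only [planeDet]; ring
    rw [h.antisymm j i, planeCoord, planeCoord, planeDet_swap a b i j]
    generalize planeDet a b i j = d at hd hpd ⊢
    generalize b i * p₁ - a i * p₂ = u at hi' hpd ⊢
    generalize b j * p₁ - a j * p₂ = v at hj' hpd ⊢
    field_simp
    linear_combination T i j * hpd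
  rw [h2, h1, Finset.sum_comm, h1, add_zero]

/-- This is p = ξ_ij α_i + ξ_ji α_j paired with c, using α_i(c) = 1. -/
lemma linForm_eq_planeCoord (h : IsPlaneConfig S a b T) {i j : ι} (hi : i ∈ S) (hj : j ∈ S)
    (hji : j ≠ i) {c₁ c₂ : ℂ} (hc : a i * c₁ + b i * c₂ = 1) (p₁ p₂ : ℂ) :
    c₁ * p₁ + c₂ * p₂ = planeCoord a b p₁ p₂ i j +
      (a j * c₁ + b j * c₂) * planeCoord a b p₁ p₂ j i := by
  have hd := h.det_ne_zero i hi j hj hji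
  rw [planeCoord, planeCoord, planeDet_swap a b i j]
  field_simp
  simp only [planeDet]
  linear_combination (b j * p₁ - a j * p₂) * hc

/-- The quadratic identity satisfied by the function `k`. -/
lemma sum_kFun_eq_zero (h : IsPlaneConfig S a b T) (τ : ℍ) {p₁ p₂ m₁ m₂ : ℂ}
    (hξ : ∀ i ∈ S, ∀ j ∈ S, j ≠ i → theta τ (planeCoord a b p₁ p₂ i j) ≠ 0)
    (hm : ∀ i ∈ S, ∃ n : ℤ, a i * m₁ + b i * m₂ = n) (hm₁ : m₁ ≠ 0)
    (hp : theta τ (p₁ * m₁ + p₂ * m₂) ≠ 0) (hp₁ : p₁ ≠ 0)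
    (hδ : ∀ i ∈ S, b i * p₁ - a i * p₂ ≠ 0) {z₁ z₂ : ℂ}
    (hz : ∀ i ∈ S, theta τ (a i * z₁ + b i * z₂) ≠ 0) (η : ι → ℂ) :
    ∑ i ∈ S, ∑ j ∈ S, planeDet a b i j * T i j *
      (kFun τ (a i * z₁ + b i * z₂) (planeCoord a b p₁ p₂ i j) *
        kFun τ (a j * z₁ + b j * z₂) (planeCoord a b p₁ p₂ j i) -
      2 * (kFun τ (a i * z₁ + b i * z₂) (η i) -
        kFun τ (a i * z₁ + b i * z₂) (planeCoord a b p₁ p₂ i j)) /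
          planeCoord a b p₁ p₂ j i) = 0 := by
  set ζ : ι → ℂ := fun i => a i * z₁ + b i * z₂ with hζ
  have h1 := h.kroneckerSum_eq_zero τ hξ hm hm₁ hp hz
  have h2 := h.sum_inv_planeCoord_eq_zero hp₁ hδ
  -- These terms sum to zero whatever η is. They are inserted so that, for η i = c_i(p), the
  -- difference k(ζ_i, η_i) - k(ζ_i, ξ_ij) becomes divisible by ξ_ji.
  have h3 := h.sum_div_planeCoord_eq_zero p₁ p₂ (fun i => 2 * kFun τ (ζ i) (η i))
  -- The two mixed terms of the product (k + 1/ξ_ij)(k + 1/ξ_ji) are exchanged by swapping i and j;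
  -- this is the origin of the factor 2.
  have h4 : ∑ i ∈ S, ∑ j ∈ S, planeDet a b i j * T i j *
      (kFun τ (ζ j) (planeCoord a b p₁ p₂ j i) / planeCoord a b p₁ p₂ i j) =
      ∑ i ∈ S, ∑ j ∈ S, planeDet a b i j * T i j *
      (kFun τ (ζ i) (planeCoord a b p₁ p₂ i j) / planeCoord a b p₁ p₂ j i) := by
    rw [Finset.sum_comm]
    refine Finset.sum_congr rfl fun i hi => Finset.sum_congr rfl fun j hj => ?_
    rw [planeDet_swap a b i j, h.antisymm j i, neg_mul_neg]
  have key : kroneckerSum τ S a b T p₁ p₂ ζ -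
      (∑ i ∈ S, ∑ j ∈ S, planeDet a b i j * T i j *
        (1 / (planeCoord a b p₁ p₂ i j * planeCoord a b p₁ p₂ j i))) -
      (∑ i ∈ S, ∑ j ∈ S, planeDet a b i j * T i j *
        (2 * kFun τ (ζ i) (η i) / planeCoord a b p₁ p₂ j i)) =
      ∑ i ∈ S, ∑ j ∈ S, planeDet a b i j * T i j *
      (kFun τ (ζ i) (planeCoord a b p₁ p₂ i j) * kFun τ (ζ j) (planeCoord a b p₁ p₂ j i) -
      2 * (kFun τ (ζ i) (η i) - kFun τ (ζ i) (planeCoord a b p₁ p₂ i j)) /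
          planeCoord a b p₁ p₂ j i) +
      ((∑ i ∈ S, ∑ j ∈ S, planeDet a b i j * T i j *
        (kFun τ (ζ j) (planeCoord a b p₁ p₂ j i) / planeCoord a b p₁ p₂ i j)) -
      ∑ i ∈ S, ∑ j ∈ S, planeDet a b i j * T i j *
        (kFun τ (ζ i) (planeCoord a b p₁ p₂ i j) / planeCoord a b p₁ p₂ j i)) := by
    simp only [kroneckerSum, ← Finset.sum_add_distrib, ← Finset.sum_sub_distrib]
    refine Finset.sum_congr rfl fun i hi => Finset.sum_congr rfl fun j hj => ?_
    rcases eq_or_ne j i with rfl | hji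
    · simp [h.diag]
    have hne : ∀ {x}, theta τ x ≠ 0 → x ≠ 0 := by
      rintro x hx rfl
      simp at hx
    have hij := hne (hξ i hi j hj hji)
    have hji' := hne (hξ j hj i hi hji.symm)
    have hk : ∀ i ∈ S, ∀ x ≠ 0, kronecker τ (ζ i) x = kFun τ (ζ i) x + 1 / x := by
      intro i hi x hx
      rw [kFun_of_ne (hz i hi) hx, k, kronecker]
      ring
    rw [hk i hi _ hij, hk j hj _ hji']
    field_simp
    ring
  rw [h4, sub_self, add_zero] at key
  rw [← key, h2, h3, h1]
  simp

/-- The homogeneous components of the quadratic identity satisfied by the function `k`, as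
polynomial identities. -/
theorem sum_pairPoly_eq_zero (h : IsPlaneConfig S a b T) (τ : ℍ) {c₁ c₂ : ι → ℂ}
    (hc : ∀ i ∈ S, a i * c₁ i + b i * c₂ i = 1) {z₁ z₂ : ℂ}
    (hz : ∀ i ∈ S, theta τ (a i * z₁ + b i * z₂) ≠ 0) (d : ℕ) :
    ∑ i ∈ S, ∑ j ∈ S, (planeDet a b i j * T i j) •
      pairPoly τ a b c₁ c₂ (fun i => a i * z₁ + b i * z₂) d i j = 0 := by
  classical
  obtain ⟨i₀, hi₀, ha₀, hb₀⟩ := h.base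
  obtain ⟨m₁, m₂, hm, hmS⟩ := h.primitive i₀ hi₀
  have hm₁ : m₁ = 1 := by simpa [ha₀, hb₀] using hm
  set ζ : ι → ℂ := fun i => a i * z₁ + b i * z₂ with hζ
  have hab : ∀ i ∈ S, b i ≠ 0 ∨ -a i ≠ 0 := by
    intro i hi
    by_contra! hcon
    have := hc i hi
    simp [hcon.1, neg_eq_zero.mp hcon.2] at this
  refine eq_zero_of_generic_evalEval
    -- The factors of G exclude the p at which some ξ_ij, p₁ or p(m) vanishes; near the origin of
    -- the ray through any other p, the Kronecker identity applies.
    (G := (∏ i ∈ S, linForm (b i) (-a i)) * linForm 1 0 * linForm m₁ m₂) ?_ ?_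
  · refine mul_ne_zero (mul_ne_zero (Finset.prod_ne_zero_iff.mpr fun i hi =>
      linForm_ne_zero (hab i hi)) (linForm_ne_zero (by simp))) (linForm_ne_zero (by simp [hm₁]))
  intro p₁ p₂ hG
  rw [evalEval_mul, evalEval_mul] at hG
  have hp₁ : p₁ ≠ 0 := by simpa [evalEval_linForm] using right_ne_zero_of_mul (left_ne_zero_of_mul hG)
  have hpm : p₁ * m₁ + p₂ * m₂ ≠ 0 := by
    have := right_ne_zero_of_mul hG
    rw [evalEval_linForm] at this
    rwa [mul_comm p₁, mul_comm p₂]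
  have hδ : ∀ i ∈ S, b i * p₁ - a i * p₂ ≠ 0 := by
    have h1 := left_ne_zero_of_mul (left_ne_zero_of_mul hG)
    rw [← coe_evalEvalRingHom, map_prod, Finset.prod_ne_zero_iff] at h1
    intro i hi
    have := h1 i hi
    rw [coe_evalEvalRingHom, evalEval_linForm] at this
    intro h0
    exact this (by linear_combination h0)
  have hξ0 : ∀ i ∈ S, ∀ j ∈ S, j ≠ i → planeCoord a b p₁ p₂ i j ≠ 0 := fun i hi j hj hji =>
    div_ne_zero (hδ j hj) (h.det_ne_zero i hi j hj hji)
  have hscale : ∀ (r : ℂ) i j, planeCoord a b (r * p₁) (r * p₂) i j =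
      planeCoord a b p₁ p₂ i j * r := by
    intro r i j; simp only [planeCoord]; ring
  set η : ι → ℂ := fun i => c₁ i * p₁ + c₂ i * p₂ with hη
  set ξ : ι → ι → ℂ := fun i j => planeCoord a b p₁ p₂ i j with hξdef
  -- The identity at rp, multiplied by r. The extra r cancels the pole from 1/ξ_ji, so F is analytic
  -- at r = 0, and the homogeneous component of degree d is the coefficient of r^{d+1}.
  set F : ℂ → ℂ := fun r => ∑ i ∈ S, ∑ j ∈ S, planeDet a b i j * T i j *
    (r * (kFun τ (ζ i) (ξ i j * r) * kFun τ (ζ j) (ξ j i * r)) +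
      -(2 / ξ j i) * (kFun τ (ζ i) (η i * r) + (-1) * kFun τ (ζ i) (ξ i j * r))) with hF
  have hcomp : ∀ (i : ι) (c : ℂ), AnalyticAt ℂ (fun r => kFun τ (ζ i) (c * r)) 0 := by
    intro i c
    have h1 : AnalyticAt ℂ (kFun τ (ζ i)) (c * 0) := by rw [mul_zero]; exact analyticAt_kFun τ _
    exact AnalyticAt.fun_comp (f := fun r : ℂ => c * r) h1 (analyticAt_const.mul analyticAt_id)
  have hFan : AnalyticAt ℂ (fun _ : ℂ => (0 : ℂ)) 0 := analyticAt_const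
  have htend : ∀ c : ℂ, c ≠ 0 → ∀ᶠ r in 𝓝[≠] (0 : ℂ), theta τ (c * r) ≠ 0 := by
    intro c hc0
    have h1 := hasDerivAt_theta_zero τ
    have h2 : HasDerivAt (fun r : ℂ => theta τ (c * r)) c 0 := by
      have h3 : HasDerivAt (theta τ) 1 (c * 0) := by rwa [mul_zero]
      exact (h3.comp (0 : ℂ) ((hasDerivAt_id (0 : ℂ)).const_mul c)).congr_deriv (by simp)
    simpa using h2.eventually_ne hc0 (c := 0)
  have hF0 : F =ᶠ[𝓝 0] fun _ => 0 := by
    have hev : ∀ᶠ r in 𝓝[≠] (0 : ℂ), (∀ i ∈ S, ∀ j ∈ S, j ≠ i → theta τ (ξ i j * r) ≠ 0) ∧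
        theta τ ((p₁ * m₁ + p₂ * m₂) * r) ≠ 0 := by
      refine Filter.Eventually.and ?_ (htend _ hpm)
      rw [Filter.eventually_all_finset]
      intro i hi
      rw [Filter.eventually_all_finset]
      intro j hj
      rcases eq_or_ne j i with rfl | hji
      · simp
      · exact (htend _ (hξ0 i hi j hj hji)).mono fun r hr _ => hr
    rw [eventually_nhdsWithin_iff] at hev
    filter_upwards [hev] with r hr
    rcases eq_or_ne r 0 with rfl | hr0
    · refine Finset.sum_eq_zero fun i _ => Finset.sum_eq_zero fun j _ => ?_
      simp
    obtain ⟨hr1, hr2⟩ := hr hr0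
    have h1 := h.sum_kFun_eq_zero τ (p₁ := r * p₁) (p₂ := r * p₂) (m₁ := m₁) (m₂ := m₂)
      (fun i hi j hj hji => by rw [hscale]; exact hr1 i hi j hj hji) hmS (by simp [hm₁])
      (by rw [show r * p₁ * m₁ + r * p₂ * m₂ = (p₁ * m₁ + p₂ * m₂) * r by ring]; exact hr2)
      (mul_ne_zero hr0 hp₁)
      (fun i hi => by
        rw [show b i * (r * p₁) - a i * (r * p₂) = r * (b i * p₁ - a i * p₂) by ring]
        exact mul_ne_zero hr0 (hδ i hi)) hz (fun i => η i * r)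
    have h2 : F r = r * 0 := by
      rw [← h1, Finset.mul_sum]
      refine Finset.sum_congr rfl fun i hi => ?_
      rw [Finset.mul_sum]
      refine Finset.sum_congr rfl fun j hj => ?_
      rcases eq_or_ne j i with rfl | hji
      · simp [h.diag]
      have := hξ0 j hj i hi hji.symm
      simp only [hscale, hξdef, hζ]
      field_simp
      ring
    rw [h2, mul_zero]
  have hT := taylor_congr hF0
  have hTk : ∀ i ∈ S, ∀ c n, PowerSeries.coeff n (taylor fun r => kFun τ (ζ i) (c * r)) =
      c ^ n * kCoeff τ (ζ i) n := by
    intro i hi c n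
    rw [taylor_comp_mul, taylor_kFun (hz i hi), PowerSeries.coeff_rescale, coeff_kSeries]
  have hcoeff := congrArg (PowerSeries.coeff (d + 1)) hT
  have hterm : ∀ i ∈ S, ∀ j ∈ S, AnalyticAt ℂ (fun r : ℂ => planeDet a b i j * T i j *
    (r * (kFun τ (ζ i) (ξ i j * r) * kFun τ (ζ j) (ξ j i * r)) +
      -(2 / ξ j i) * (kFun τ (ζ i) (η i * r) + (-1) * kFun τ (ζ i) (ξ i j * r)))) 0 := by
    intro i hi j hj
    exact analyticAt_const.mul ((analyticAt_id.mul ((hcomp i _).mul (hcomp j _))).add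
      (analyticAt_const.mul ((hcomp i _).add (analyticAt_const.mul (hcomp i _)))))
  rw [hF, taylor_sum S fun i hi => Finset.analyticAt_fun_sum _ (hterm i hi), map_sum,
    taylor_const, map_zero, map_zero] at hcoeff
  rw [← coe_evalEvalRingHom, map_sum, ← hcoeff]
  refine Finset.sum_congr rfl fun i hi => ?_
  rw [taylor_sum S (hterm i hi), map_sum, map_sum]
  refine Finset.sum_congr rfl fun j hj => ?_
  rcases eq_or_ne j i with rfl | hji
  · simp [h.diag, taylor_const]
  rw [coeff_taylor_quadratic (hcomp i _) (hcomp j _) (hcomp i _), hTk i hi, hTk i hi]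
  have hlin : η i = ξ i j + (a j * c₁ i + b j * c₂ i) * ξ j i :=
    h.linForm_eq_planeCoord hi hj hji (hc i hi) p₁ p₂
  -- The difference of powers is divisible by η_i - ξ_ij = α_j(c_i) ξ_ji; this explains why
  -- `pairPoly` is a polynomial.
  have hgeom : η i ^ (d + 1) - ξ i j ^ (d + 1) = (a j * c₁ i + b j * c₂ i) * ξ j i *
      ∑ nm ∈ antidiagonal d, η i ^ nm.1 * ξ i j ^ nm.2 := by
    rw [show (a j * c₁ i + b j * c₂ i) * ξ j i = η i - ξ i j by rw [hlin]; ring,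
      Finset.Nat.sum_antidiagonal_eq_sum_range_succ (fun n m => η i ^ n * ξ i j ^ m), mul_comm]
    have := (geom_sum₂_mul (η i) (ξ i j) (d + 1)).symm
    simpa using this
  have hsmul : ∀ (c : ℂ) (Q : ℂ[X][Y]), evalEvalRingHom p₁ p₂ (c • Q) =
      c * evalEvalRingHom p₁ p₂ Q := by
    intro c Q
    have : c • Q = C (C c) * Q := by
      rw [Algebra.smul_def]; rfl
    rw [this, map_mul]
    simp
  have hCC : ∀ c : ℂ, evalEvalRingHom p₁ p₂ (C (C c)) = c := by intro c; simp
  have hco : ∀ i j, evalEvalRingHom p₁ p₂ (coordPoly a b i j) = ξ i j := fun i j =>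
    evalEval_coordPoly a b i j p₁ p₂
  have hli : evalEvalRingHom p₁ p₂ (linForm (c₁ i) (c₂ i)) = η i := evalEval_linForm _ _ _ _
  rw [hsmul, pairPoly]
  simp only [map_sub, map_mul, map_sum, map_pow, hCC, hco, hli]
  have hji0 : ξ j i ≠ 0 := hξ0 j hj i hi hji.symm
  congr 1
  rw [← sub_mul, hgeom, sub_eq_add_neg]
  congr 1
  · refine Finset.sum_congr rfl fun nm _ => ?_
    rw [hTk i hi, hTk j hj]
    ring
  · field_simp

end IsPlaneConfig

/-- If all scalar specializations of `∑ v ⊗ Q` vanish, then so does its image under a linear map. -/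
lemma sum_apply_eq_zero_of_forall_dual {α M A : Type*} [AddCommGroup M] [Module ℂ M]
    [AddCommGroup A] [Module ℂ A] (s : Finset α) (Q : α → M) (v : α → A)
    (h : ∀ φ : A →ₗ[ℂ] ℂ, ∑ i ∈ s, φ (v i) • Q i = 0) (E : M →ₗ[ℂ] A →ₗ[ℂ] A) :
    ∑ i ∈ s, E (Q i) (v i) = 0 := by
  classical
  set B := Module.Basis.ofVectorSpace ℂ M
  have h1 : ∀ e, ∑ i ∈ s, B.repr (Q i) e • v i = 0 := by
    intro e
    rw [← Module.forall_dual_apply_eq_zero_iff ℂ]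
    intro φ
    have := congrArg (fun x => B.repr x e) (h φ)
    simp only [map_sum, map_smul, Finsupp.coe_finsetSum, Finset.sum_apply, Finsupp.smul_apply,
      smul_eq_mul, map_zero, Finsupp.coe_zero, Pi.zero_apply] at this ⊢
    rw [← this]
    exact Finset.sum_congr rfl fun i _ => mul_comm _ _
  set U := s.biUnion fun i => (B.repr (Q i)).support
  have h2 : ∀ i ∈ s, E (Q i) (v i) = ∑ e ∈ U, E (B e) (B.repr (Q i) e • v i) := by
    intro i hi
    conv_lhs => rw [← B.linearCombination_repr (Q i), Finsupp.linearCombination_apply,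
      Finsupp.sum_of_support_subset (s := U) _ (Finset.subset_biUnion_of_mem
        (fun i => (B.repr (Q i)).support) hi) _ (by simp)]
    simp [map_sum, LinearMap.sum_apply]
  rw [Finset.sum_congr rfl h2, Finset.sum_comm]
  refine Finset.sum_eq_zero fun e _ => ?_
  rw [← map_sum, h1, map_zero]

end Coefficients

end KZB

end

noncomputable section

namespace KZB

/-! ### Series in complete filtered algebras -/

namespace CompleteFiltration

variable {A : Type*} [Ring A] [Algebra ℂ A] (𝓕 : CompleteFiltration A)

lemma mem_of_le {m n : ℤ} (h : m ≤ n) {a : A} (ha : a ∈ 𝓕.F n) : a ∈ 𝓕.F m := 𝓕.antitone h ha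

variable {𝓕} in
lemma eq_of_forall_sub_mem {a b : A} (h : ∀ n, a - b ∈ 𝓕.F n) : a = b :=
  sub_eq_zero.mp (𝓕.separated _ h)

/-- The linear functionals that vanish on some piece of the filtration separate points. -/
lemma eq_zero_of_forall_functional {a : A}
    (h : ∀ φ : A →ₗ[ℂ] ℂ, (∃ n, ∀ c ∈ 𝓕.F n, φ c = 0) → φ a = 0) : a = 0 := by
  refine 𝓕.separated a fun n => ?_
  by_contra hn
  obtain ⟨φ, hφ, hφ'⟩ := Submodule.exists_le_ker_of_notMem hn
  exact hφ (h φ ⟨n, fun c hc => hφ' hc⟩)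

lemma lie_mem {m n : ℤ} {a b : A} (ha : a ∈ 𝓕.F m) (hb : b ∈ 𝓕.F n) : ⁅a, b⁆ ∈ 𝓕.F (m + n) := by
  rw [Ring.lie_def]
  exact Submodule.sub_mem _ (𝓕.mul_mem ha hb) (add_comm n m ▸ 𝓕.mul_mem hb ha)

lemma ConvergesTo.unique {𝓕 : CompleteFiltration A} {s : ℕ → A} {a b : A}
    (ha : 𝓕.ConvergesTo s a) (hb : 𝓕.ConvergesTo s b) : a = b := by
  refine eq_of_forall_sub_mem (𝓕 := 𝓕) fun n => ?_
  obtain ⟨k, hk⟩ := ha n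
  obtain ⟨l, hl⟩ := hb n
  have := Submodule.sub_mem _ (hl (max k l) (le_max_right _ _)) (hk (max k l) (le_max_left _ _))
  simpa using this

/-- The series with terms `f` converges to `a`. -/
def HasSeries (f : ℕ → A) (a : A) : Prop := 𝓕.ConvergesTo (fun n => ∑ i ∈ Finset.range n, f i) a

namespace HasSeries

variable {𝓕} {f g : ℕ → A} {a b : A}

lemma series_eq (h : 𝓕.HasSeries f a) : 𝓕.series f = a := by
  have hex : ∃ a, 𝓕.ConvergesTo (fun n => ∑ i ∈ Finset.range n, f i) a := ⟨a, h⟩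
  rw [series, dif_pos hex]
  exact hex.choose_spec.unique h

lemma add (hf : 𝓕.HasSeries f a) (hg : 𝓕.HasSeries g b) :
    𝓕.HasSeries (fun n => f n + g n) (a + b) := by
  intro n
  obtain ⟨k, hk⟩ := hf n
  obtain ⟨l, hl⟩ := hg n
  refine ⟨max k l, fun i hi => ?_⟩
  have := Submodule.add_mem _ (hk i (le_trans (le_max_left _ _) hi))
    (hl i (le_trans (le_max_right _ _) hi))
  simpa [Finset.sum_add_distrib, add_sub_add_comm] using this

lemma map {L : A →ₗ[ℂ] A} (hL : ∀ n, ∃ m, ∀ a ∈ 𝓕.F m, L a ∈ 𝓕.F n) (hf : 𝓕.HasSeries f a) :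
    𝓕.HasSeries (fun n => L (f n)) (L a) := by
  intro n
  obtain ⟨m, hm⟩ := hL n
  obtain ⟨k, hk⟩ := hf m
  refine ⟨k, fun i hi => ?_⟩
  simpa using hm _ (hk i hi)

lemma smul (c : ℂ) (hf : 𝓕.HasSeries f a) : 𝓕.HasSeries (fun n => c • f n) (c • a) :=
  hf.map (L := LinearMap.lsmul ℂ A c) fun n => ⟨n, fun a ha => by
    rw [LinearMap.lsmul_apply]; exact Submodule.smul_mem _ _ ha⟩

lemma shift (hf : 𝓕.HasSeries (fun n => f (n + 1)) a) : 𝓕.HasSeries f (f 0 + a) := by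
  intro n
  obtain ⟨k, hk⟩ := hf n
  refine ⟨k + 1, fun i hi => ?_⟩
  obtain ⟨j, rfl⟩ : ∃ j, i = j + 1 := ⟨i - 1, by lia⟩
  have := hk j (by lia)
  simp only [Finset.sum_range_succ']
  rwa [add_comm (f 0), add_sub_add_right_eq_sub]

end HasSeries

lemma hasSeries_zero : 𝓕.HasSeries (fun _ => 0) 0 := fun n => ⟨0, fun i _ => by simp⟩

lemma hasSeries_finsetSum {𝓕 : CompleteFiltration A} {α : Type*} (s : Finset α) {f : α → ℕ → A}
    {a : α → A} (h : ∀ i ∈ s, 𝓕.HasSeries (f i) (a i)) :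
    𝓕.HasSeries (fun n => ∑ i ∈ s, f i n) (∑ i ∈ s, a i) := by
  classical
  induction s using Finset.induction_on with
  | empty => simpa using 𝓕.hasSeries_zero
  | insert i s hi ih =>
    simp only [Finset.sum_insert hi]
    exact (h i (by simp)).add (ih fun j hj => h j (by simp [hj]))

/-- The terms of `f` lie in pieces of the filtration of linearly growing index. -/
def IsTame (K : ℤ) (f : ℕ → A) : Prop := ∀ n : ℕ, f n ∈ 𝓕.F (n - K)

namespace IsTame

variable {𝓕} {K : ℤ} {f : ℕ → A}

lemma sum_sub_sum_mem (h : 𝓕.IsTame K f) {M i : ℕ} (hi : M ≤ i) :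
    ∑ n ∈ Finset.range i, f n - ∑ n ∈ Finset.range M, f n ∈ 𝓕.F (M - K) := by
  rw [← Finset.sum_range_add_sum_Ico _ hi, add_sub_cancel_left]
  exact Submodule.sum_mem _ fun n hn => 𝓕.mem_of_le (by have := (Finset.mem_Ico.mp hn).1; lia) (h n)

lemma hasSeries (h : 𝓕.IsTame K f) : 𝓕.HasSeries f (𝓕.series f) := by
  have hex : ∃ a, 𝓕.ConvergesTo (fun n => ∑ i ∈ Finset.range n, f i) a := by
    refine 𝓕.complete _ fun n => ⟨(n + K).toNat, fun i hi j hj => ?_⟩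
    have := Submodule.sub_mem _ (h.sum_sub_sum_mem hi) (h.sum_sub_sum_mem hj)
    rw [sub_sub_sub_cancel_right] at this
    exact 𝓕.mem_of_le (by lia) this
  rw [series, dif_pos hex]
  exact hex.choose_spec

lemma series_sub_sum_mem (h : 𝓕.IsTame K f) (M : ℕ) :
    𝓕.series f - ∑ n ∈ Finset.range M, f n ∈ 𝓕.F (M - K) := by
  obtain ⟨k, hk⟩ := h.hasSeries (M - K)
  have := Submodule.sub_mem _ (h.sum_sub_sum_mem (le_max_left M k)) (hk _ (le_max_right M k))
  simpa using this

lemma series_mem (h : 𝓕.IsTame K f) : 𝓕.series f ∈ 𝓕.F (-K) := by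
  simpa using h.series_sub_sum_mem 0

/-- A continuous functional sees only finitely many terms, so analytic questions about the series
reduce to finite sums. -/
lemma functional_series (h : 𝓕.IsTame K f) {φ : A →ₗ[ℂ] ℂ} {N : ℤ} (hφ : ∀ c ∈ 𝓕.F N, φ c = 0)
    {M : ℕ} (hM : N + K ≤ M) : φ (𝓕.series f) = ∑ n ∈ Finset.range M, φ (f n) := by
  have := hφ _ (𝓕.mem_of_le (by lia) (h.series_sub_sum_mem M))
  rwa [map_sub, sub_eq_zero, map_sum] at this

end IsTame

/-- A power series in `N` that vanishes at all positive integers has zero coefficients. -/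
lemma eq_zero_of_forall_hasSeries_pow {𝓕 : CompleteFiltration A} {f : ℕ → A}
    (h : ∀ N : ℕ, N ≠ 0 → 𝓕.HasSeries (fun n => (N : ℂ) ^ n • f n) 0) (n : ℕ) : f n = 0 := by
  refine 𝓕.eq_zero_of_forall_functional ?_
  rintro φ ⟨N, hN⟩
  obtain ⟨k, hk⟩ := h 1 one_ne_zero N
  have hf : ∀ i ≥ k, f i ∈ 𝓕.F N := fun i hi => by
    have := Submodule.sub_mem _ (hk (i + 1) (by lia)) (hk i hi)
    simpa [Finset.sum_range_succ] using this
  by_cases hn : k ≤ n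
  · exact hN _ (hf n hn)
  -- Convergence at N = 1 puts all but finitely many terms in the kernel of φ. What remains is a
  -- polynomial in N that vanishes at every positive integer.
  have hp : (∑ m ∈ Finset.range k, Polynomial.monomial m (φ (f m))) = 0 := by
    refine Polynomial.eq_zero_of_infinite_isRoot _
      ((Set.infinite_range_of_injective (f := fun c : ℕ => ((c + 1 : ℕ) : ℂ))
        fun a b hab => by simpa using hab).mono ?_)
    rintro _ ⟨c, rfl⟩
    obtain ⟨l, hl⟩ := h (c + 1) c.succ_ne_zero N
    have h1 := hN _ (hl (max k l) (le_max_right k l))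
    rw [sub_zero, map_sum, ← Finset.sum_range_add_sum_Ico _ (le_max_left k l),
      Finset.sum_eq_zero (s := Finset.Ico k (max k l)), add_zero] at h1
    · rw [Set.mem_ofPred_eq, Polynomial.IsRoot.def, Polynomial.eval_finsetSum, ← h1]
      refine Finset.sum_congr rfl fun m _ => ?_
      rw [Polynomial.eval_monomial, map_smul, smul_eq_mul, mul_comm]
    · intro i hi
      rw [map_smul, hN _ (hf i (Finset.mem_Ico.mp hi).1), smul_zero]
  have := congrArg (fun p => Polynomial.coeff p n) hp
  simp only [Polynomial.finsetSum_coeff, Polynomial.coeff_monomial, Polynomial.coeff_zero] at this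
  rwa [Finset.sum_ite_eq' , if_pos (Finset.mem_range.mpr (by lia))] at this

/-- Summation of a double series along antidiagonals. -/
lemma series_antidiagonal {K : ℤ} {c : ℕ → ℕ → A} (h : ∀ i j : ℕ, c i j ∈ 𝓕.F (i + j - K)) :
    𝓕.series (fun n => ∑ ij ∈ Finset.HasAntidiagonal.antidiagonal n, c ij.1 ij.2) =
      𝓕.series fun i => 𝓕.series (c i) := by
  have h1 : ∀ i : ℕ, 𝓕.IsTame (K - i) (c i) := fun i j => 𝓕.mem_of_le (by lia) (h i j)
  have h2 : 𝓕.IsTame K fun i => 𝓕.series (c i) := fun i => 𝓕.mem_of_le (by lia) (h1 i).series_mem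
  have h3 : 𝓕.IsTame K fun n => ∑ ij ∈ Finset.HasAntidiagonal.antidiagonal n, c ij.1 ij.2 := by
    intro n
    refine Submodule.sum_mem _ fun ij hij => ?_
    have := Finset.HasAntidiagonal.mem_antidiagonal.mp hij
    exact 𝓕.mem_of_le (by lia) (h ij.1 ij.2)
  refine eq_of_forall_sub_mem (𝓕 := 𝓕) fun N => ?_
  -- Both sides differ from the triangular sum over i + j < M by elements of F(M - K).
  set M := (N + K).toNat
  have e1 := h3.series_sub_sum_mem M
  have e2 := h2.series_sub_sum_mem M
  have e3 : ∑ i ∈ Finset.range M, 𝓕.series (c i) -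
      ∑ i ∈ Finset.range M, ∑ j ∈ Finset.range (M - i), c i j ∈ 𝓕.F (M - K) := by
    rw [← Finset.sum_sub_distrib]
    refine Submodule.sum_mem _ fun i hi => ?_
    have := Finset.mem_range.mp hi
    exact 𝓕.mem_of_le (by lia) ((h1 i).series_sub_sum_mem (M - i))
  have e4 : ∑ n ∈ Finset.range M, ∑ ij ∈ Finset.HasAntidiagonal.antidiagonal n, c ij.1 ij.2 =
      ∑ i ∈ Finset.range M, ∑ j ∈ Finset.range (M - i), c i j := by
    rw [← Finset.sum_range_diag_flip]
    refine Finset.sum_congr rfl fun n _ => ?_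
    rw [Finset.Nat.sum_antidiagonal_eq_sum_range_succ c]
  rw [e4] at e1
  have := Submodule.sub_mem _ e1 (Submodule.add_mem _ e2 e3)
  refine 𝓕.mem_of_le (by lia) (n := M - K) ?_
  convert this using 1
  abel

/-- The linear endomorphism raises the filtration degree. -/
def Raises (D : Module.End ℂ A) : Prop := ∀ n : ℤ, ∀ a ∈ 𝓕.F n, D a ∈ 𝓕.F (n + 1)

namespace Raises

variable {𝓕} {D D' : Module.End ℂ A}

lemma pow_mem (h : 𝓕.Raises D) {n : ℤ} {a : A} (ha : a ∈ 𝓕.F n) (k : ℕ) :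
    (D ^ k) a ∈ 𝓕.F (n + k) := by
  induction k with
  | zero => simpa using ha
  | succ k ih =>
    rw [pow_succ', Module.End.mul_apply]
    exact 𝓕.mem_of_le (by lia) (h _ _ ih)

lemma smul (h : 𝓕.Raises D) (c : ℂ) : 𝓕.Raises (c • D) :=
  fun n a ha => Submodule.smul_mem _ _ (h n a ha)

lemma continuous (h : 𝓕.Raises D) (n : ℤ) : ∃ m, ∀ a ∈ 𝓕.F m, D a ∈ 𝓕.F n :=
  ⟨n - 1, fun a ha => by simpa using h _ a ha⟩

lemma isTame (h : 𝓕.Raises D) {K : ℤ} {a : A} (ha : a ∈ 𝓕.F (-K)) (f : ℕ → ℂ) :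
    𝓕.IsTame K fun n => f n • (D ^ n) a :=
  fun n => Submodule.smul_mem _ _ (𝓕.mem_of_le (by lia) (h.pow_mem ha n))

end Raises

/-- The value at `a` of the power series `f` in the endomorphism `D`. -/
def powSeries (f : PowerSeries ℂ) (D : Module.End ℂ A) (a : A) : A :=
  𝓕.series fun n => PowerSeries.coeff n f • (D ^ n) a

section PowSeries

variable {𝓕} {D D' : Module.End ℂ A} (hD : 𝓕.Raises D)

lemma exists_mem_neg (a : A) : ∃ K : ℤ, a ∈ 𝓕.F (-K) := by
  obtain ⟨n, hn⟩ := 𝓕.exhaustive a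
  exact ⟨-n, by simpa using hn⟩

lemma Raises.hasSeries_powSeries (hD : 𝓕.Raises D) (f : PowerSeries ℂ) (a : A) :
    𝓕.HasSeries (fun n => PowerSeries.coeff n f • (D ^ n) a) (𝓕.powSeries f D a) := by
  obtain ⟨K, hK⟩ := exists_mem_neg (𝓕 := 𝓕) a
  exact (hD.isTame hK _).hasSeries

lemma Raises.powSeries_add (hD : 𝓕.Raises D) (f g : PowerSeries ℂ) (a : A) :
    𝓕.powSeries (f + g) D a = 𝓕.powSeries f D a + 𝓕.powSeries g D a := by
  refine HasSeries.series_eq ?_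
  simpa [add_smul] using (hD.hasSeries_powSeries f a).add (hD.hasSeries_powSeries g a)

lemma Raises.powSeries_smul (hD : 𝓕.Raises D) (f : PowerSeries ℂ) (c : ℂ) (a : A) :
    𝓕.powSeries f D (c • a) = c • 𝓕.powSeries f D a := by
  refine HasSeries.series_eq ?_
  simpa [smul_comm c] using (hD.hasSeries_powSeries f a).smul c

lemma Raises.powSeries_apply_add (hD : 𝓕.Raises D) (f : PowerSeries ℂ) (a b : A) :
    𝓕.powSeries f D (a + b) = 𝓕.powSeries f D a + 𝓕.powSeries f D b := by
  refine HasSeries.series_eq ?_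
  simpa using (hD.hasSeries_powSeries f a).add (hD.hasSeries_powSeries f b)

lemma powSeries_one (a : A) : 𝓕.powSeries 1 D a = a := by
  refine HasSeries.series_eq fun n => ⟨1, fun i hi => ?_⟩
  obtain ⟨j, rfl⟩ : ∃ j, i = j + 1 := ⟨i - 1, by lia⟩
  simp [PowerSeries.coeff_one]

lemma Raises.map_powSeries (hD : 𝓕.Raises D) {L : A →ₗ[ℂ] A}
    (hL : ∀ n, ∃ m, ∀ a ∈ 𝓕.F m, L a ∈ 𝓕.F n) (f : PowerSeries ℂ) (a : A)
    {g : ℕ → A} (hg : ∀ n, L ((D ^ n) a) = g n) :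
    L (𝓕.powSeries f D a) = 𝓕.series fun n => PowerSeries.coeff n f • g n := by
  symm
  refine HasSeries.series_eq ?_
  simpa [hg] using (hD.hasSeries_powSeries f a).map hL

lemma Raises.powSeries_X_mul (hD : 𝓕.Raises D) (f : PowerSeries ℂ) (a : A) :
    𝓕.powSeries (PowerSeries.X * f) D a = D (𝓕.powSeries f D a) := by
  refine HasSeries.series_eq ?_
  have h := (hD.hasSeries_powSeries f a).map hD.continuous
  have h2 := HasSeries.shift (f := fun n => PowerSeries.coeff n (PowerSeries.X * f) • (D ^ n) a)
    (a := D (𝓕.powSeries f D a)) (by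
      simpa [PowerSeries.coeff_succ_X_mul, pow_succ', Module.End.mul_apply] using h)
  simpa using h2

lemma Raises.powSeries_apply_comm (hD : 𝓕.Raises D) (f : PowerSeries ℂ) (a : A) :
    𝓕.powSeries f D (D a) = D (𝓕.powSeries f D a) := by
  symm
  refine hD.map_powSeries hD.continuous f a fun n => ?_
  rw [← Module.End.mul_apply, ← Module.End.mul_apply, ← pow_succ, ← pow_succ']

lemma Raises.powSeries_mul (hD : 𝓕.Raises D) (f g : PowerSeries ℂ) (a : A) :
    𝓕.powSeries (f * g) D a = 𝓕.powSeries f D (𝓕.powSeries g D a) := by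
  obtain ⟨K, hK⟩ := exists_mem_neg (𝓕 := 𝓕) a
  have h := 𝓕.series_antidiagonal (K := K)
    (c := fun i j => (PowerSeries.coeff i f * PowerSeries.coeff j g) • (D ^ (i + j)) a)
    fun i j => Submodule.smul_mem _ _ (𝓕.mem_of_le (by push_cast; lia) (hD.pow_mem hK (i + j)))
  rw [powSeries, powSeries]
  convert h using 2
  · funext n
    rw [PowerSeries.coeff_mul, Finset.sum_smul]
    refine Finset.sum_congr rfl fun ij hij => ?_
    rw [Finset.HasAntidiagonal.mem_antidiagonal.mp hij]
  · funext i
    symm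
    refine HasSeries.series_eq ?_
    have h1 := ((hD.hasSeries_powSeries g a).map (L := D ^ i)
      (fun n => ⟨n - i, fun a ha => by simpa using hD.pow_mem ha i⟩)).smul (PowerSeries.coeff i f)
    simpa [mul_smul, pow_add, Module.End.mul_apply] using h1

lemma Raises.powSeries_exp_add (hD : 𝓕.Raises D) (hD' : 𝓕.Raises D') (hc : Commute D D') (a : A) :
    𝓕.powSeries (PowerSeries.exp ℂ) (D + D') a =
      𝓕.powSeries (PowerSeries.exp ℂ) D (𝓕.powSeries (PowerSeries.exp ℂ) D' a) := by
  obtain ⟨K, hK⟩ := exists_mem_neg (𝓕 := 𝓕) a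
  have h := 𝓕.series_antidiagonal (K := K)
    (c := fun i j => (((i.factorial : ℂ)⁻¹) * (j.factorial : ℂ)⁻¹) • (D ^ i) ((D' ^ j) a))
    fun i j => Submodule.smul_mem _ _
      (𝓕.mem_of_le (by lia) (hD.pow_mem (hD'.pow_mem hK j) i))
  rw [powSeries, powSeries]
  convert h using 2
  · funext n
    rw [hc.add_pow', LinearMap.sum_apply, Finset.smul_sum]
    refine Finset.sum_congr rfl fun ij hij => ?_
    have hij' := Finset.HasAntidiagonal.mem_antidiagonal.mp hij
    rw [PowerSeries.coeff_exp, LinearMap.smul_apply, Module.End.mul_apply, ← Nat.cast_smul_eq_nsmul ℂ,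
      smul_smul]
    congr 1
    have h1 : n.choose ij.1 = (ij.1 + ij.2).choose ij.2 := by rw [← hij', Nat.choose_symm_add]
    have h2 := Nat.add_choose_mul_factorial_mul_factorial ij.1 ij.2
    have h3 : ((ij.1 + ij.2).choose ij.2 : ℂ) * ij.1.factorial * ij.2.factorial =
        (ij.1 + ij.2).factorial := by exact_mod_cast h2
    rw [h1, ← hij']
    have f1 : (ij.1.factorial : ℂ) ≠ 0 := by exact_mod_cast ij.1.factorial_ne_zero
    have f2 : (ij.2.factorial : ℂ) ≠ 0 := by exact_mod_cast ij.2.factorial_ne_zero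
    have f3 : ((ij.1 + ij.2).factorial : ℂ) ≠ 0 := by exact_mod_cast (ij.1 + ij.2).factorial_ne_zero
    simp only [map_div₀, map_one, map_natCast]
    field_simp
    rw [← h3]
  · funext i
    symm
    refine HasSeries.series_eq ?_
    have h1 := ((hD'.hasSeries_powSeries (PowerSeries.exp ℂ) a).map (L := D ^ i)
      (fun n => ⟨n - i, fun a ha => by simpa using hD.pow_mem ha i⟩)).smul
        (PowerSeries.coeff i (PowerSeries.exp ℂ))
    simpa [mul_smul, PowerSeries.coeff_exp] using h1

end PowSeries

/-! ### The exponential and the adjoint action -/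

/-- The adjoint action `b ↦ ⁅a, b⁆`. -/
def adEnd : A →ₗ[ℂ] Module.End ℂ A := LinearMap.mul ℂ A - (LinearMap.mul ℂ A).flip

lemma adEnd_apply (a b : A) : adEnd a b = a * b - b * a := by simp [adEnd]

lemma lie_eq_adEnd (a b : A) : ⁅a, b⁆ = adEnd a b := by rw [adEnd_apply, Ring.lie_def]

lemma adEnd_self (a : A) : adEnd a a = 0 := by simp [adEnd_apply]

lemma adEnd_swap (a b : A) : adEnd a b = -adEnd b a := by simp [adEnd_apply]

lemma adEnd_leibniz (a b c : A) :
    adEnd a (adEnd b c) = adEnd (adEnd a b) c + adEnd b (adEnd a c) := by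
  simp only [adEnd_apply]; noncomm_ring

lemma commute_adEnd {a b : A} (h : adEnd a b = 0) : Commute (adEnd a) (adEnd b) := by
  ext c
  have := adEnd_leibniz a b c
  rw [h, map_zero, LinearMap.zero_apply, zero_add] at this
  simpa using this

variable {𝓕}

lemma raises_mulLeft {a : A} (ha : a ∈ 𝓕.F 1) : 𝓕.Raises (LinearMap.mulLeft ℂ a) :=
  fun n b hb => by simpa [add_comm] using 𝓕.mul_mem ha hb

lemma raises_mulRight {a : A} (ha : a ∈ 𝓕.F 1) : 𝓕.Raises (LinearMap.mulRight ℂ a) :=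
  fun n b hb => by simpa using 𝓕.mul_mem hb ha

lemma raises_adEnd {a : A} (ha : a ∈ 𝓕.F 1) : 𝓕.Raises (adEnd a) := fun n b hb => by
  rw [← lie_eq_adEnd, add_comm]
  exact 𝓕.lie_mem ha hb

lemma continuous_mulLeft (a : A) (n : ℤ) :
    ∃ m, ∀ b ∈ 𝓕.F m, LinearMap.mulLeft ℂ a b ∈ 𝓕.F n := by
  obtain ⟨k, hk⟩ := 𝓕.exhaustive a
  exact ⟨n - k, fun b hb => 𝓕.mem_of_le (by lia) (𝓕.mul_mem hk hb)⟩

lemma continuous_mulRight (a : A) (n : ℤ) :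
    ∃ m, ∀ b ∈ 𝓕.F m, LinearMap.mulRight ℂ a b ∈ 𝓕.F n := by
  obtain ⟨k, hk⟩ := 𝓕.exhaustive a
  exact ⟨n - k, fun b hb => 𝓕.mem_of_le (by lia) (𝓕.mul_mem hb hk)⟩

lemma mulLeft_pow_one (a : A) (n : ℕ) : (LinearMap.mulLeft ℂ a ^ n) 1 = a ^ n := by
  rw [LinearMap.pow_mulLeft]; simp

/-- Reading the exponential as an operator series applied to 1 puts left multiplication, right
multiplication and conjugation by it under the common calculus of `powSeries`. -/
lemma exp_eq_powSeries (a : A) :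
    𝓕.exp a = 𝓕.powSeries (PowerSeries.exp ℂ) (LinearMap.mulLeft ℂ a) 1 := by
  simp [exp, powSeries, PowerSeries.coeff_exp]

lemma exp_mul {a : A} (ha : a ∈ 𝓕.F 1) (b : A) :
    𝓕.exp a * b = 𝓕.powSeries (PowerSeries.exp ℂ) (LinearMap.mulLeft ℂ a) b := by
  rw [exp_eq_powSeries]
  exact (raises_mulLeft ha).map_powSeries (L := LinearMap.mulRight ℂ b) (continuous_mulRight b)
    _ _ fun n => by rw [mulLeft_pow_one, LinearMap.pow_mulLeft]; simp

lemma mul_exp {a : A} (ha : a ∈ 𝓕.F 1) (b : A) :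
    b * 𝓕.exp a = 𝓕.powSeries (PowerSeries.exp ℂ) (LinearMap.mulRight ℂ a) b := by
  rw [exp_eq_powSeries]
  exact (raises_mulLeft ha).map_powSeries (L := LinearMap.mulLeft ℂ b) (continuous_mulLeft b)
    _ _ fun n => by rw [mulLeft_pow_one, LinearMap.pow_mulRight]; simp

lemma exp_add {a b : A} (ha : a ∈ 𝓕.F 1) (hb : b ∈ 𝓕.F 1) (h : Commute a b) :
    𝓕.exp (a + b) = 𝓕.exp a * 𝓕.exp b := by
  rw [exp_mul ha, exp_eq_powSeries, exp_eq_powSeries, ← (raises_mulLeft ha).powSeries_exp_add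
    (raises_mulLeft hb)]
  · congr 1; ext c; simp [add_mul]
  · ext c; simp [← mul_assoc, h.eq]

/-- Left multiplication by a and right multiplication by -a commute, and their sum is ad a. -/
lemma exp_mul_mul_exp_neg {a : A} (ha : a ∈ 𝓕.F 1) (b : A) :
    𝓕.exp a * b * 𝓕.exp (-a) = 𝓕.powSeries (PowerSeries.exp ℂ) (adEnd a) b := by
  have ha' : -a ∈ 𝓕.F 1 := Submodule.neg_mem _ ha
  rw [mul_assoc, mul_exp ha', exp_mul ha, ← (raises_mulLeft ha).powSeries_exp_add
    (raises_mulRight ha')]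
  · congr 1; ext c; simp [adEnd_apply, sub_eq_add_neg]
  · ext c; simp [mul_assoc]

lemma powSeries_smul_end (f : PowerSeries ℂ) (c : ℂ) (D : Module.End ℂ A) (a : A) :
    𝓕.powSeries f (c • D) a = 𝓕.powSeries (PowerSeries.rescale c f) D a := by
  simp [powSeries, smul_pow, smul_smul, mul_comm]

end CompleteFiltration

open CompleteFiltration

lemma kAd_eq_powSeries {A : Type*} [Ring A] [Algebra ℂ A] (𝓕 : CompleteFiltration A) (τ : ℍ)
    (z : ℂ) (X c : A) : kAd 𝓕 τ z X c = 𝓕.powSeries (kSeries τ z) (adEnd X) c := by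
  have : (fun c => ⁅X, c⁆) = ⇑(adEnd X) := by ext; rw [lie_eq_adEnd]
  simp [kAd, powSeries, coeff_kSeries, this, Module.End.pow_apply]

end KZB

end

noncomputable section

namespace KZB

/-! ### Finite sums over integral multiples -/

open Classical in
/-- If the sums of `v` over the `j` with `d j ∈ ℤ c` vanish for all `c`, then so do the sums over the
`j` with `d j = ± c`. -/
lemma sum_filter_sq_eq_zero {ι A : Type*} [AddCommGroup A] (S : Finset ι) (d : ι → ℂ) (v : ι → A)
    (h : ∀ c : ℂ, ∑ j ∈ S with ∃ n : ℤ, d j = n * c, v j = 0) (e : ℂ) :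
    ∑ j ∈ S with d j ^ 2 = e, v j = 0 := by
  by_contra hne
  -- Take a bad fibre with |d| maximal and apply the hypothesis with c = d i. The fibres in ℤc other
  -- than ±c have d = 0, which is the case c = 0, or larger |d|, hence are good by maximality.
  set bad : Finset ι := S.filter fun i => ∑ j ∈ S with d j ^ 2 = d i ^ 2, v j ≠ 0 with hbad
  have hb : bad.Nonempty := by
    obtain ⟨i, hi, -⟩ := Finset.exists_ne_zero_of_sum_ne_zero hne
    have := Finset.mem_filter.mp hi
    exact ⟨i, Finset.mem_filter.mpr ⟨this.1, by rwa [this.2]⟩⟩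
  obtain ⟨i, hi, hmax⟩ := Finset.exists_max_image bad (fun i => ‖d i‖) hb
  obtain ⟨hiS, hi0⟩ := Finset.mem_filter.mp hi
  apply hi0
  have hzero : ∑ j ∈ S with d j ^ 2 = 0, v j = 0 := by
    rw [← h 0]
    congr 1
    ext j
    simp
  by_cases hdi : d i = 0
  · rw [hdi, zero_pow two_ne_zero, hzero]
  have hsum := h (d i)
  set U := S.filter fun j => ∃ n : ℤ, d j = n * d i
  rw [← Finset.sum_fiberwise_of_maps_to (t := U.image fun j => d j ^ 2)
    (g := fun j => d j ^ 2) (fun j hj => Finset.mem_image_of_mem _ hj)] at hsum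
  have hiU : i ∈ U := Finset.mem_filter.mpr ⟨hiS, 1, by simp⟩
  rw [Finset.sum_eq_single_of_mem (d i ^ 2) (Finset.mem_image_of_mem (fun j => d j ^ 2) hiU)] at hsum
  · convert hsum using 2
    ext j
    simp only [Finset.mem_filter, U]
    refine ⟨fun hj => ⟨⟨hj.1, ?_⟩, hj.2⟩, fun hj => ⟨hj.1.1, hj.2⟩⟩
    rcases sq_eq_sq_iff_eq_or_eq_neg.mp hj.2 with h1 | h1
    exacts [⟨1, by simp [h1]⟩, ⟨-1, by simp [h1]⟩]
  · intro e he hne'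
    obtain ⟨j₀, hj₀, rfl⟩ := Finset.mem_image.mp he
    obtain ⟨hj₀S, n, hn⟩ := Finset.mem_filter.mp hj₀
    have hfib : (U.filter fun j => d j ^ 2 = d j₀ ^ 2) = S.filter fun j => d j ^ 2 = d j₀ ^ 2 := by
      ext j
      simp only [Finset.mem_filter, U]
      refine ⟨fun hj => ⟨hj.1.1, hj.2⟩, fun hj => ⟨⟨hj.1, ?_⟩, hj.2⟩⟩
      rcases sq_eq_sq_iff_eq_or_eq_neg.mp hj.2 with h1 | h1
      exacts [⟨n, by rw [h1, hn]⟩, ⟨-n, by rw [h1, hn]; push_cast; ring⟩]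
    rw [hfib]
    by_contra hj₀bad
    have hle := hmax j₀ (Finset.mem_filter.mpr ⟨hj₀S, hj₀bad⟩)
    rw [hn, norm_mul, mul_le_iff_le_one_left (norm_pos_iff.mpr hdi), Complex.norm_intCast] at hle
    have hn1 : |n| ≤ 1 := by exact_mod_cast hle
    rcases abs_le.mp hn1 with ⟨h1, h2⟩
    have h3 : n = -1 ∨ n = 0 ∨ n = 1 := by lia
    rcases h3 with rfl | rfl | rfl
    · exact hne' (by rw [hn]; push_cast; ring)
    · rw [hn] at hj₀bad
      simp only [Int.cast_zero, zero_mul, zero_pow two_ne_zero] at hj₀bad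
      exact hj₀bad hzero
    · exact hne' (by rw [hn]; push_cast; ring)

lemma sum_even_smul_eq_zero {ι A : Type*} [AddCommGroup A] [Module ℂ A] (S : Finset ι) (d : ι → ℂ)
    (v : ι → A) (h : ∀ e : ℂ, ∑ j ∈ S with d j ^ 2 = e, v j = 0) {f : ℂ → ℂ}
    (hf : ∀ c, f (-c) = f c) : ∑ j ∈ S, f (d j) • v j = 0 := by
  classical
  rw [← Finset.sum_fiberwise_of_maps_to (t := S.image fun j => d j ^ 2)
    (g := fun j => d j ^ 2) (fun j hj => Finset.mem_image_of_mem _ hj)]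
  refine Finset.sum_eq_zero fun e he => ?_
  obtain ⟨j₀, hj₀, rfl⟩ := Finset.mem_image.mp he
  have : ∀ j ∈ S.filter (fun j => d j ^ 2 = d j₀ ^ 2), f (d j) • v j = f (d j₀) • v j := by
    intro j hj
    rcases sq_eq_sq_iff_eq_or_eq_neg.mp (Finset.mem_filter.mp hj).2 with h1 | h1 <;> rw [h1]
    rw [hf]
  rw [Finset.sum_congr rfl this, ← Finset.smul_sum, h, smul_zero]

/-! ### Generic points -/

/-- A generic translate by a vector of a subspace avoids finitely many divisors. -/
lemma exists_mem_forall_theta_ne_zero {ι H : Type*} [AddCommGroup H] [Module ℂ H] (τ : ℍ)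
    (V : Submodule ℂ H) (S : Finset ι) (f : ι → H →ₗ[ℂ] ℂ) (hf : ∀ j ∈ S, ∃ v ∈ V, f j v ≠ 0)
    (z : H) : ∃ w ∈ V, ∀ j ∈ S, theta τ (f j (z + w)) ≠ 0 := by
  obtain ⟨v, hv, hv0⟩ : ∃ v ∈ V, ∀ j ∈ S, f j v ≠ 0 := by
    obtain ⟨v, hv, hv0⟩ := Module.Dual.exists_forall_mem_ne_zero_of_forall_exists V
      (fun j : S => f j) fun j => hf j j.2
    exact ⟨v, hv, fun j hj => hv0 ⟨j, hj⟩⟩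
  have hc : (⋃ j ∈ S, {s : ℂ | theta τ (f j (z + s • v)) = 0}).Countable := by
    refine Set.Countable.biUnion S.countable_toSet fun j hj => ?_
    refine (IsPlaneConfig.countable_theta_eq_zero τ).preimage_of_injOn
      (f := fun s => f j (z + s • v)) fun x _ y _ hxy => ?_
    simpa [hv0 j hj] using hxy
  obtain ⟨s, hs⟩ : ∃ s : ℂ, s ∉ ⋃ j ∈ S, {s : ℂ | theta τ (f j (z + s • v)) = 0} := by
    by_contra hall
    push Not at hall
    exact not_countable_complex ((Set.eq_univ_of_forall hall) ▸ hc)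
  refine ⟨s • v, Submodule.smul_mem _ _ hv, fun j hj h0 => hs ?_⟩
  exact Set.mem_biUnion hj h0

/-! ### Roots and coweights -/

section Roots

variable {ι Hd H : Type*} [AddCommGroup Hd] [Module ℂ Hd] [AddCommGroup H] [Module ℂ H]
  (P : RootPairing ι ℂ Hd H)

lemma root'_reflectionPerm (i j : ι) (u : H) :
    P.root' (P.reflectionPerm i j) u = P.root' j (P.coreflection i u) := by
  rw [RootPairing.root', P.root_reflectionPerm, RootPairing.reflection_apply, map_sub, map_smul,
    P.coreflection_apply, map_sub, map_smul, LinearMap.sub_apply, LinearMap.smul_apply, smul_eq_mul,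
    smul_eq_mul, mul_comm]
  rfl

lemma root'_neg (i : ι) (u : H) : P.root' (P.reflectionPerm i i) u = -P.root' i u := by
  rw [root'_reflectionPerm, P.coreflection_apply, map_sub, map_smul, P.root'_coroot_eq_pairing,
    P.pairing_same, smul_eq_mul]
  ring

lemma root'_coroot_self (i : ι) : P.root' i (P.coroot i) = 2 := by
  rw [P.root'_coroot_eq_pairing, P.pairing_same]

lemma root'_half_coroot (i : ι) : P.root' i ((1 / 2 : ℂ) • P.coroot i) = 1 := by
  rw [map_smul, root'_coroot_self]; norm_num

lemma coroot_neg (i : ι) : P.coroot (P.reflectionPerm i i) = -P.coroot i := by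
  rw [P.coroot_reflectionPerm, P.coreflection_apply_self]

lemma reflectionPerm_self_self (i : ι) :
    P.reflectionPerm (P.reflectionPerm i i) (P.reflectionPerm i i) = i :=
  letI := P.indexNeg
  neg_neg i

variable {P}

lemma mem_regularSet_iff {τ : ℍ} {z : H} :
    z ∈ regularSet P τ ↔ ∀ i, theta τ (P.root' i z) ≠ 0 := by
  simp [regularSet, theta_ne_zero_iff]

lemma zsmul_mem_coweightLattice {m : H} (hm : m ∈ coweightLattice P) (n : ℤ) :
    (n : ℂ) • m ∈ coweightLattice P := by
  rw [Int.cast_smul_eq_zsmul]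
  exact zsmul_mem hm n

lemma natCast_smul_mem_coweightLattice {m : H} (hm : m ∈ coweightLattice P) (n : ℕ) :
    (n : ℂ) • m ∈ coweightLattice P := by
  exact_mod_cast zsmul_mem_coweightLattice hm n

variable [P.IsCrystallographic]

lemma pairing_eq_intCast (i j : ι) : P.pairing i j = (P.pairingIn ℤ i j : ℂ) := by
  rw [← P.algebraMap_pairingIn ℤ]; rfl

lemma coroot_mem_coweightLattice (j : ι) : P.coroot j ∈ coweightLattice P :=
  fun i => ⟨P.pairingIn ℤ i j, by rw [P.root'_coroot_eq_pairing, pairing_eq_intCast]⟩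

/-- A linear condition holds for all vectors if it holds for the coweights. -/
lemma forall_of_forall_coweight [P.IsRootSystem] {A : Type*} [AddCommGroup A] [Module ℂ A]
    {f g : H →ₗ[ℂ] A} (h : ∀ m ∈ coweightLattice P, f m = g m) (u : H) : f u = g u := by
  have : f = g := LinearMap.ext_on_range (v := P.coroot) RootPairing.IsRootSystem.span_coroot_eq_top
    fun i => h _ (coroot_mem_coweightLattice i)
  rw [this]

/-- A root takes the value `1` at some coweight. -/
lemma exists_coweight_root'_eq_one [P.IsRootSystem] [P.IsReduced] [Finite ι] (b : P.Base) (i : ι) :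
    ∃ m ∈ coweightLattice P, P.root' i m = 1 := by
  classical
  refine b.induction_reflect (p := fun i => ∃ m ∈ coweightLattice P, P.root' i m = 1) i ?_ ?_ ?_
  · rintro i ⟨m, hm, h1⟩
    exact ⟨-m, neg_mem hm, by rw [root'_neg, map_neg, h1, neg_neg]⟩
  · intro i hi
    -- The fundamental coweight of a simple root; it is integral because all roots are integral
    -- combinations of the simple ones.
    obtain ⟨m, hm⟩ := (LinearMap.IsPerfPair.bijective_right P.toLinearMap).surjective
      (b.toWeightBasis.coord ⟨i, hi⟩)
    have hm' : ∀ j, P.root' j m = b.toWeightBasis.coord ⟨i, hi⟩ (P.root j) :=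
      fun j => by rw [← hm]; rfl
    have hs : ∀ j ∈ b.support, P.root' j m = if j = i then 1 else 0 := by
      intro j hj
      rw [hm', Module.Basis.coord_apply, b.toWeightBasis_repr_root ⟨j, hj⟩, Finsupp.single_apply]
      simp
    refine ⟨m, fun j => ?_, by rw [hs i hi, if_pos rfl]⟩
    obtain ⟨f, -, -, hf⟩ := b.exists_root_eq_sum_int j
    refine ⟨f i, ?_⟩
    have : P.root' j m = ∑ k ∈ b.support, (f k : ℂ) * P.root' k m := by
      rw [RootPairing.root', hf]
      simp [map_sum]
    rw [this, Finset.sum_congr rfl fun k hk => by rw [hs k hk]]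
    simp [hi]
  · rintro i j ⟨m, hm, h1⟩ hj
    refine ⟨P.coreflection j m, fun k => ?_, ?_⟩
    · obtain ⟨n, hn⟩ := hm (P.reflectionPerm j k)
      refine ⟨n, ?_⟩
      rw [← hn, root'_reflectionPerm]
    · rw [root'_reflectionPerm, P.coreflection_same]
      exact h1

end Roots

end KZB

end

noncomputable section

namespace KZB

/-! ### Planes spanned by two roots -/

section Planes

variable {ι Hd H : Type*} [AddCommGroup Hd] [Module ℂ Hd] [AddCommGroup H] [Module ℂ H]
  {P : RootPairing ι ℂ Hd H}

lemma not_isPos_neg {b : P.Base} {i : ι} (hi : b.IsPos i) : ¬b.IsPos (P.reflectionPerm i i) := by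
  have := RootPairing.Base.IsPos.neg_iff_not b i
  exact fun h => this.mp h hi

lemma isPos_neg {b : P.Base} {i : ι} (hi : ¬b.IsPos i) : b.IsPos (P.reflectionPerm i i) :=
  (RootPairing.Base.IsPos.neg_iff_not b i).mpr hi

lemma root_neg (i : ι) : P.root (P.reflectionPerm i i) = -P.root i := by
  rw [P.root_reflectionPerm, P.reflection_apply_self]

open Classical in
/-- A sum over all roots of a function that is invariant under `α ↦ -α`. -/
lemma sum_eq_add_sum_isPos [Fintype ι] {A : Type*} [AddCommMonoid A] (b : P.Base) (f : ι → A)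
    (hf : ∀ i, f (P.reflectionPerm i i) = f i) :
    ∑ i, f i = ∑ i with b.IsPos i, f i + ∑ i with b.IsPos i, f i := by
  rw [← Finset.sum_filter_add_sum_filter_not Finset.univ b.IsPos]
  congr 1
  refine Finset.sum_nbij' (fun i => P.reflectionPerm i i) (fun i => P.reflectionPerm i i) ?_ ?_ ?_ ?_ ?_
  · intro i hi
    simpa using isPos_neg (by simpa using hi)
  · intro i hi
    simpa using not_isPos_neg (by simpa using hi)
  · intro i _
    exact reflectionPerm_self_self P i
  · intro i _
    exact reflectionPerm_self_self P i
  · intro i _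
    exact (hf i).symm

variable (P) in
/-- A coweight on which the root `i` vanishes, but not a root `j` independent of `i`. -/
def orthoCoweight (i j : ι) : H := (2 : ℂ) • P.coroot j - P.pairing i j • P.coroot i

lemma root'_orthoCoweight_left (i j : ι) : P.root' i (orthoCoweight P i j) = 0 := by
  rw [orthoCoweight, map_sub, map_smul, map_smul, P.root'_coroot_eq_pairing,
    P.root'_coroot_eq_pairing, P.pairing_same, smul_eq_mul, smul_eq_mul]
  ring

lemma root'_orthoCoweight_right (i j : ι) :
    P.root' j (orthoCoweight P i j) = 4 - P.coxeterWeight i j := by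
  rw [orthoCoweight, map_sub, map_smul, map_smul, P.root'_coroot_eq_pairing,
    P.root'_coroot_eq_pairing, P.pairing_same, smul_eq_mul, smul_eq_mul, RootPairing.coxeterWeight]
  ring

lemma orthoCoweight_mem [P.IsCrystallographic] (i j : ι) :
    orthoCoweight P i j ∈ coweightLattice P := by
  rw [orthoCoweight, pairing_eq_intCast]
  exact sub_mem (by simpa using zsmul_mem_coweightLattice (coroot_mem_coweightLattice j) 2)
    (zsmul_mem_coweightLattice (coroot_mem_coweightLattice i) _)

/-- The value 4 - coxeterWeight is nonzero for independent roots, and distinct positive roots of a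
reduced system are independent. -/
lemma root'_orthoCoweight_ne_zero [Finite ι] [P.IsReduced] {b : P.Base}
    {i j : ι} (hi : b.IsPos i) (hj : b.IsPos j) (hij : i ≠ j) :
    P.root' j (orthoCoweight P i j) ≠ 0 := by
  have := IsAddTorsionFree.of_isTorsionFree ℂ Hd
  rw [root'_orthoCoweight_right, sub_ne_zero]
  refine (P.coxeterWeight_ne_four_of_linearIndependent ?_).symm
  refine RootPairing.IsReduced.linearIndependent P hij fun h => ?_
  rw [RootPairing.root_eq_neg_iff] at h
  exact not_isPos_neg hj (h ▸ hi)

/-- Vectors dual to two independent roots. -/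
lemma exists_dual_pair [Finite ι] [P.IsReduced] {b : P.Base}
    {i j : ι} (hi : b.IsPos i) (hj : b.IsPos j) (hij : i ≠ j) :
    ∃ e₁ e₂ : H, P.root' i e₁ = 1 ∧ P.root' i e₂ = 0 ∧ P.root' j e₁ = 0 ∧ P.root' j e₂ = 1 := by
  refine ⟨(P.root' i (orthoCoweight P j i))⁻¹ • orthoCoweight P j i,
    (P.root' j (orthoCoweight P i j))⁻¹ • orthoCoweight P i j, ?_, ?_, ?_, ?_⟩
  · rw [map_smul, smul_eq_mul, inv_mul_cancel₀ (root'_orthoCoweight_ne_zero hj hi hij.symm)]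
  · rw [map_smul, root'_orthoCoweight_left, smul_zero]
  · rw [map_smul, root'_orthoCoweight_left, smul_zero]
  · rw [map_smul, smul_eq_mul, inv_mul_cancel₀ (root'_orthoCoweight_ne_zero hi hj hij)]

variable (P) in
/-- The root `k` lies in the plane spanned by the independent roots `i` and `j`. -/
def InPlane (i j k : ι) : Prop := ∀ h : H, P.root' i h = 0 → P.root' j h = 0 → P.root' k h = 0

lemma InPlane.root'_eq {i j k : ι} (h : InPlane P i j k) {e₁ e₂ : H} (h₁ : P.root' i e₁ = 1)
    (h₂ : P.root' i e₂ = 0) (h₃ : P.root' j e₁ = 0) (h₄ : P.root' j e₂ = 1) (u : H) :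
    P.root' k u = P.root' k e₁ * P.root' i u + P.root' k e₂ * P.root' j u := by
  have := h (u - P.root' i u • e₁ - P.root' j u • e₂)
    (by simp only [map_sub, map_smul, h₁, h₂, smul_eq_mul]; ring)
    (by simp only [map_sub, map_smul, h₃, h₄, smul_eq_mul]; ring)
  simp only [map_sub, map_smul, smul_eq_mul] at this
  linear_combination this

open Classical in
/-- The positive roots in the plane spanned by the roots `i` and `j`. -/
def plane [Fintype ι] (b : P.Base) (i j : ι) : Finset ι :=
  Finset.univ.filter fun k => b.IsPos k ∧ InPlane P i j k

variable [Fintype ι] {b : P.Base}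

lemma mem_plane {i j k : ι} : k ∈ plane b i j ↔ b.IsPos k ∧ InPlane P i j k := by simp [plane]

lemma left_mem_plane {i j : ι} (hi : b.IsPos i) : i ∈ plane b i j := mem_plane.mpr ⟨hi, fun _ h _ => h⟩

lemma right_mem_plane {i j : ι} (hj : b.IsPos j) : j ∈ plane b i j :=
  mem_plane.mpr ⟨hj, fun _ _ h => h⟩

/-- Any two distinct positive roots of the plane span it, so pairs of distinct positive roots can be
partitioned by their planes. -/
lemma plane_eq [P.IsReduced] {i j k l : ι} (hi : b.IsPos i) (hj : b.IsPos j) (hij : i ≠ j)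
    (hk : k ∈ plane b i j) (hl : l ∈ plane b i j) (hkl : k ≠ l) : plane b k l = plane b i j := by
  obtain ⟨hk, hk'⟩ := mem_plane.mp hk
  obtain ⟨hl, hl'⟩ := mem_plane.mp hl
  obtain ⟨e₁, e₂, h₁, h₂, h₃, h₄⟩ := exists_dual_pair hi hj hij
  obtain ⟨f₁, f₂, g₁, g₂, g₃, g₄⟩ := exists_dual_pair hk hl hkl
  have key : ∀ h, P.root' k h = 0 → P.root' l h = 0 → P.root' i h = 0 ∧ P.root' j h = 0 := by
    intro h h5 h6
    rw [hk'.root'_eq h₁ h₂ h₃ h₄] at h5 g₁ g₂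
    rw [hl'.root'_eq h₁ h₂ h₃ h₄] at h6 g₃ g₄
    set p := P.root' k e₁
    set q := P.root' k e₂
    set r := P.root' l e₁
    set s := P.root' l e₂
    -- The first factor is the determinant of k, l in terms of i, j; the dual vectors of k, l
    -- provide its inverse.
    have hdet : (p * s - q * r) * (P.root' i f₁ * P.root' j f₂ - P.root' j f₁ * P.root' i f₂) = 1 := by
      linear_combination (r * P.root' i f₂ + s * P.root' j f₂) * g₁ + g₄ -
        (r * P.root' i f₁ + s * P.root' j f₁) * g₂
    have hdet' := left_ne_zero_of_mul_eq_one hdet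
    constructor
    · refine (mul_eq_zero.mp ?_).resolve_left hdet'
      linear_combination s * h5 - q * h6
    · refine (mul_eq_zero.mp ?_).resolve_left hdet'
      linear_combination p * h6 - r * h5
  ext m
  rw [mem_plane, mem_plane]
  refine and_congr_right fun _ => ⟨fun hm h h5 h6 => hm h (hk' h h5 h6) (hl' h h5 h6),
    fun hm h h5 h6 => hm h (key h h5 h6).1 (key h h5 h6).2⟩

open Classical in
/-- A sum over pairs of distinct positive roots vanishes if the sums over pairs of roots in the same
plane do. -/
lemma sum_sum_eq_zero_of_plane [P.IsReduced] {A : Type*} [AddCommGroup A] (f : ι → ι → A) (S : Finset ι)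
    (hS : ∀ i ∈ S, b.IsPos i) (hf0 : ∀ i, f i i = 0)
    (hf : ∀ i j, b.IsPos i → b.IsPos j → i ≠ j →
      ∑ k ∈ S with k ∈ plane b i j, ∑ l ∈ S with l ∈ plane b i j, f k l = 0) :
    ∑ i ∈ S, ∑ j ∈ S, f i j = 0 := by
  have h1 : ∑ i ∈ S, ∑ j ∈ S, f i j = ∑ p ∈ S.offDiag, f p.1 p.2 := by
    rw [← Finset.sum_product', ← Finset.diag_union_offDiag,
      Finset.sum_union (Finset.disjoint_diag_offDiag S), Finset.sum_diag]
    simp [hf0]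
  rw [h1, ← Finset.sum_fiberwise_of_maps_to (t := S.offDiag.image fun p => plane b p.1 p.2)
    (g := fun p => plane b p.1 p.2) (fun p hp => Finset.mem_image_of_mem _ hp)]
  refine Finset.sum_eq_zero fun L hL => ?_
  obtain ⟨⟨i, j⟩, hij, rfl⟩ := Finset.mem_image.mp hL
  obtain ⟨hi, hj, hij⟩ := Finset.mem_offDiag.mp hij
  have hi' := hS i hi
  have hj' := hS j hj
  have h2 := hf i j hi' hj' hij
  rw [← h2, ← Finset.sum_product', ← Finset.diag_union_offDiag,
      Finset.sum_union (Finset.disjoint_diag_offDiag _), Finset.sum_diag,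
      Finset.sum_eq_zero fun i _ => hf0 i, zero_add]
  refine Finset.sum_congr ?_ fun _ _ => rfl
  ext ⟨k, l⟩
  simp only [Finset.mem_filter, Finset.mem_offDiag]
  constructor
  · rintro ⟨⟨hk, hl, hkl⟩, h⟩
    exact ⟨⟨hk, h ▸ left_mem_plane (hS k hk)⟩, ⟨hl, h ▸ right_mem_plane (hS l hl)⟩, hkl⟩
  · rintro ⟨⟨hk, hk'⟩, ⟨hl, hl'⟩, hkl⟩
    exact ⟨⟨hk, hl, hkl⟩, plane_eq hi' hj' hij hk' hl' hkl⟩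

open Classical in
/-- A sum over positive roots vanishes if the sums over the planes through a fixed root do. -/
lemma sum_eq_zero_of_plane [P.IsReduced] {A : Type*} [AddCommGroup A] (f : ι → A) (S : Finset ι)
    (hS : ∀ i ∈ S, b.IsPos i) {i : ι} (hi : b.IsPos i) (hf0 : f i = 0)
    (hf : ∀ j ∈ S, i ≠ j → ∑ k ∈ S with k ∈ plane b i j, f k = 0) : ∑ j ∈ S, f j = 0 := by
  have h1 : ∀ T : Finset ι, ∑ j ∈ T, f j = ∑ j ∈ T.erase i, f j := by
    intro T
    by_cases hiT : i ∈ T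
    · rw [← Finset.add_sum_erase _ _ hiT, hf0, zero_add]
    · rw [Finset.erase_eq_of_notMem hiT]
  rw [h1, ← Finset.sum_fiberwise_of_maps_to (t := (S.erase i).image fun j => plane b i j)
    (g := fun j => plane b i j) (fun p hp => Finset.mem_image_of_mem _ hp)]
  refine Finset.sum_eq_zero fun L hL => ?_
  obtain ⟨j, hj, rfl⟩ := Finset.mem_image.mp hL
  obtain ⟨hij, hj⟩ := Finset.mem_erase.mp hj
  rw [← hf j hj hij.symm, h1 (S.filter fun k => k ∈ plane b i j)]
  refine Finset.sum_congr ?_ fun _ _ => rfl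
  ext k
  simp only [Finset.mem_filter, Finset.mem_erase]
  constructor
  · rintro ⟨⟨hk, hkS⟩, h⟩
    exact ⟨hk, hkS, h ▸ right_mem_plane (hS k hkS)⟩
  · rintro ⟨hk, hkS, h⟩
    exact ⟨⟨hk, hkS⟩, plane_eq hi (hS j hj) hij.symm (left_mem_plane hi) h hk.symm⟩

end Planes

/-! ### The action of the Weyl group -/

section Weyl

variable {ι Hd H : Type*} [AddCommGroup Hd] [Module ℂ Hd] [AddCommGroup H] [Module ℂ H]
  {P : RootPairing ι ℂ Hd H}

lemma weylAct_eq_coweightMap (w : P.weylGroup) (u : H) :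
    weylAct P w u = ((w⁻¹ : P.weylGroup) : P.Aut).toHom.coweightMap u := rfl

lemma weylAct_smul (w : P.weylGroup) (c : ℂ) (u : H) : weylAct P w (c • u) = c • weylAct P w u := by
  rw [weylAct, map_smul]; rfl

lemma weylAct_add (w : P.weylGroup) (u v : H) :
    weylAct P w (u + v) = weylAct P w u + weylAct P w v := by
  rw [weylAct, map_add]; rfl

lemma root'_weylAct (w : P.weylGroup) (i : ι) (u : H) :
    P.root' (P.weylGroupToPerm w i) (weylAct P w u) = P.root' i u := by
  have h := LinearMap.congr_fun (RootPairing.Hom.weight_coweight_transpose_apply P P u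
    ((w⁻¹ : P.weylGroup) : P.Aut).toHom) (P.root (P.weylGroupToPerm w i))
  have h2 : ((w⁻¹ : P.weylGroup) : P.Aut).toHom.weightMap (P.root (P.weylGroupToPerm w i)) =
      P.root i := by
    rw [RootPairing.Hom.root_weightMap_apply]
    congr 1
    exact (P.weylGroupToPerm w).symm_apply_apply i
  rw [LinearMap.dualMap_apply, h2] at h
  exact h.symm

lemma root'_weylAct' (w : P.weylGroup) (i : ι) (u : H) :
    P.root' i (weylAct P w u) = P.root' (P.weylGroupToPerm w⁻¹ i) u := by
  rw [← root'_weylAct w (P.weylGroupToPerm w⁻¹ i), map_inv]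
  congr 2
  exact ((P.weylGroupToPerm w).apply_symm_apply i).symm

lemma weylAct_coroot (w : P.weylGroup) (i : ι) :
    weylAct P w (P.coroot i) = P.coroot (P.weylGroupToPerm w i) := by
  rw [weylAct_eq_coweightMap, RootPairing.Hom.coroot_coweightMap_apply]
  rfl

lemma weylAct_mem_regularSet {τ : ℍ} (w : P.weylGroup) {z : H} (hz : z ∈ regularSet P τ) :
    weylAct P w z ∈ regularSet P τ := fun i => by
  rw [root'_weylAct']
  exact hz _

lemma weylGroupToPerm_neg (w : P.weylGroup) (i : ι) :
    P.weylGroupToPerm w (P.reflectionPerm i i) =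
      P.reflectionPerm (P.weylGroupToPerm w i) (P.weylGroupToPerm w i) := by
  apply P.root.injective
  rw [root_neg, ← P.weylGroup_apply_root, ← P.weylGroup_apply_root, root_neg, smul_neg]

end Weyl

end KZB

end

noncomputable section

namespace KZB

/-! ### Limits in complete filtered algebras -/

namespace CompleteFiltration

variable {A : Type*} [Ring A] [Algebra ℂ A] {𝓕 : CompleteFiltration A} {X : Type*} {l : Filter X}

/-- The functions `∑ c i • a i` with convergent scalar coefficients `c i`, paired with their limits. -/
def limPairs (A : Type*) [Ring A] [Algebra ℂ A] (l : Filter X) : Submodule ℂ ((X → A) × A) :=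
  Submodule.span ℂ {p | ∃ (c : X → ℂ) (γ : ℂ) (a : A), Filter.Tendsto c l (𝓝 γ) ∧
    p = (fun s => c s • a, γ • a)}

lemma limPairs_bounded {p : (X → A) × A} (hp : p ∈ limPairs A l) :
    ∃ K : ℤ, (∀ s, p.1 s ∈ 𝓕.F (-K)) ∧ p.2 ∈ 𝓕.F (-K) := by
  refine Submodule.span_induction ?_ ?_ ?_ ?_ hp
  · rintro _ ⟨c, γ, a, -, rfl⟩
    obtain ⟨K, hK⟩ := exists_mem_neg (𝓕 := 𝓕) a
    exact ⟨K, fun s => Submodule.smul_mem _ _ hK, Submodule.smul_mem _ _ hK⟩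
  · exact ⟨0, fun s => Submodule.zero_mem _, Submodule.zero_mem _⟩
  · rintro p q - - ⟨K, hK, hK'⟩ ⟨L, hL, hL'⟩
    have h1 : -max K L ≤ -K := neg_le_neg (le_max_left _ _)
    have h2 : -max K L ≤ -L := neg_le_neg (le_max_right _ _)
    exact ⟨max K L, fun s => Submodule.add_mem _ (𝓕.mem_of_le h1 (hK s)) (𝓕.mem_of_le h2 (hL s)),
      Submodule.add_mem _ (𝓕.mem_of_le h1 hK') (𝓕.mem_of_le h2 hL')⟩
  · rintro c p - ⟨K, hK, hK'⟩
    exact ⟨K, fun s => Submodule.smul_mem _ _ (hK s), Submodule.smul_mem _ _ hK'⟩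

lemma limPairs_tendsto {p : (X → A) × A} (hp : p ∈ limPairs A l) (φ : A →ₗ[ℂ] ℂ) :
    Filter.Tendsto (fun s => φ (p.1 s)) l (𝓝 (φ p.2)) := by
  refine Submodule.span_induction ?_ ?_ ?_ ?_ hp
  · rintro _ ⟨c, γ, a, h, rfl⟩
    simpa using h.mul_const (φ a)
  · simpa using tendsto_const_nhds
  · rintro p q - - h1 h2
    simpa using h1.add h2
  · rintro c p - h
    simpa using h.const_mul c

lemma limPairs_mul {p q : (X → A) × A} (hp : p ∈ limPairs A l) (hq : q ∈ limPairs A l) :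
    p * q ∈ limPairs A l := by
  refine Submodule.span_induction₂ (p := fun p q _ _ => p * q ∈ limPairs A l)
    ?_ ?_ ?_ ?_ ?_ ?_ ?_ hp hq
  · rintro _ _ ⟨c, γ, a, h, rfl⟩ ⟨d, δ, b, h', rfl⟩
    refine Submodule.subset_span ⟨fun s => c s * d s, γ * δ, a * b, h.mul h', ?_⟩
    simp only [Prod.mk_mul_mk, Pi.mul_def, smul_mul_smul_comm]
  · intro q _; simp
  · intro p _; simp
  · intro p q r _ _ _ h1 h2; rw [add_mul]; exact Submodule.add_mem _ h1 h2
  · intro p q r _ _ _ h1 h2; rw [mul_add]; exact Submodule.add_mem _ h1 h2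
  · intro c p q _ _ h; rw [smul_mul_assoc]; exact Submodule.smul_mem _ _ h
  · intro c p q _ _ h; rw [mul_smul_comm]; exact Submodule.smul_mem _ _ h

lemma limPairs_map {p : (X → A) × A} (hp : p ∈ limPairs A l) (L : A →ₗ[ℂ] A) :
    ((fun s => L (p.1 s), L p.2) : (X → A) × A) ∈ limPairs A l := by
  refine Submodule.span_induction ?_ ?_ ?_ ?_ hp
  · rintro _ ⟨c, γ, a, h, rfl⟩
    refine Submodule.subset_span ⟨c, γ, L a, h, ?_⟩
    simp
  · simp only [Prod.fst_zero, Pi.zero_apply, map_zero, Prod.snd_zero]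
    exact Submodule.zero_mem _
  · rintro p q - - h1 h2
    simp only [Prod.fst_add, Prod.snd_add, Pi.add_apply, map_add]
    exact Submodule.add_mem _ h1 h2
  · rintro c p - h
    simp only [Prod.smul_fst, Prod.smul_snd, Pi.smul_apply, map_smul]
    exact Submodule.smul_mem _ c h

variable (𝓕 l) in
/-- Convergence along a filter, up to each piece of the filtration by functions with values in a
finite-dimensional space. -/
def HasLim (g : X → A) (a : A) : Prop :=
  ∀ N, ∃ p ∈ limPairs A l, (∀ᶠ s in l, g s - p.1 s ∈ 𝓕.F N) ∧ a - p.2 ∈ 𝓕.F N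

namespace HasLim

variable {g h : X → A} {a b : A}

lemma tendsto (hg : 𝓕.HasLim l g a) {φ : A →ₗ[ℂ] ℂ} {N : ℤ} (hφ : ∀ c ∈ 𝓕.F N, φ c = 0) :
    Filter.Tendsto (fun s => φ (g s)) l (𝓝 (φ a)) := by
  obtain ⟨p, hp, h1, h2⟩ := hg N
  have h3 := hφ _ h2
  rw [map_sub, sub_eq_zero] at h3
  rw [h3]
  refine (limPairs_tendsto hp φ).congr' ?_
  filter_upwards [h1] with s hs
  have h4 := hφ _ hs
  rw [map_sub, sub_eq_zero] at h4
  exact h4.symm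

lemma unique [l.NeBot] (ha : 𝓕.HasLim l g a) (hb : 𝓕.HasLim l g b) : a = b := by
  refine sub_eq_zero.mp (𝓕.eq_zero_of_forall_functional ?_)
  rintro φ ⟨N, hN⟩
  rw [map_sub, sub_eq_zero]
  exact tendsto_nhds_unique (ha.tendsto hN) (hb.tendsto hN)

lemma congr' (hg : 𝓕.HasLim l g a) (hgh : g =ᶠ[l] h) : 𝓕.HasLim l h a := by
  intro N
  obtain ⟨p, hp, h1, h2⟩ := hg N
  refine ⟨p, hp, ?_, h2⟩
  filter_upwards [h1, hgh] with s hs hs'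
  rwa [← hs']

lemma smul_const {c : X → ℂ} {γ : ℂ} (hc : Filter.Tendsto c l (𝓝 γ)) (a : A) :
    𝓕.HasLim l (fun s => c s • a) (γ • a) :=
  fun N => ⟨_, Submodule.subset_span ⟨c, γ, a, hc, rfl⟩, by simp, by simp⟩

lemma const (a : A) : 𝓕.HasLim l (fun _ => a) a := by
  simpa using smul_const (𝓕 := 𝓕) (l := l) (c := fun _ => 1) tendsto_const_nhds a

lemma add (hg : 𝓕.HasLim l g a) (hh : 𝓕.HasLim l h b) : 𝓕.HasLim l (fun s => g s + h s) (a + b) := by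
  intro N
  obtain ⟨p, hp, h1, h2⟩ := hg N
  obtain ⟨q, hq, h3, h4⟩ := hh N
  refine ⟨p + q, Submodule.add_mem _ hp hq, ?_, ?_⟩
  · filter_upwards [h1, h3] with s hs hs'
    have := Submodule.add_mem _ hs hs'
    simpa [add_sub_add_comm] using this
  · have := Submodule.add_mem _ h2 h4
    simpa [add_sub_add_comm] using this

/-- The reason for the form of `HasLim`: convergence tested on functionals alone would not control
products. Here gh - pq = (g - p)h + p(h - q), with h and p bounded in the filtration uniformly in s.
-/
lemma mul (hg : 𝓕.HasLim l g a) (hh : 𝓕.HasLim l h b) : 𝓕.HasLim l (fun s => g s * h s) (a * b) := by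
  intro N
  obtain ⟨p₀, hp₀, h1, h2⟩ := hh 0
  obtain ⟨K, hK, hK'⟩ := limPairs_bounded (𝓕 := 𝓕) hp₀
  have e0 : -max K 0 ≤ -K := neg_le_neg (le_max_left _ _)
  have e0' : -max K 0 ≤ 0 := by simp
  have hb : b ∈ 𝓕.F (-max K 0) := by
    have := Submodule.add_mem _ (𝓕.mem_of_le e0' h2) (𝓕.mem_of_le e0 hK')
    simpa using this
  have hh' : ∀ᶠ s in l, h s ∈ 𝓕.F (-max K 0) := by
    filter_upwards [h1] with s hs
    have := Submodule.add_mem _ (𝓕.mem_of_le e0' hs) (𝓕.mem_of_le e0 (hK s))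
    simpa using this
  obtain ⟨p, hp, h3, h4⟩ := hg (N + max K 0)
  obtain ⟨M, hM, hM'⟩ := limPairs_bounded (𝓕 := 𝓕) hp
  obtain ⟨q, hq, h5, h6⟩ := hh (N + M)
  refine ⟨p * q, limPairs_mul hp hq, ?_, ?_⟩
  · filter_upwards [hh', h3, h5] with s k1 k2 k3
    have e1 := 𝓕.mul_mem k2 k1
    have e2 := 𝓕.mul_mem (hM s) k3
    rw [add_neg_cancel_right] at e1
    rw [neg_add_cancel_comm_assoc] at e2
    have e3 := Submodule.add_mem _ e1 e2
    rw [sub_mul, mul_sub, sub_add_sub_cancel] at e3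
    exact e3
  · have e1 := 𝓕.mul_mem h4 hb
    have e2 := 𝓕.mul_mem hM' h6
    rw [add_neg_cancel_right] at e1
    rw [neg_add_cancel_comm_assoc] at e2
    have e3 := Submodule.add_mem _ e1 e2
    rw [sub_mul, mul_sub, sub_add_sub_cancel] at e3
    exact e3

lemma map (hg : 𝓕.HasLim l g a) {L : A →ₗ[ℂ] A} (hL : ∀ n, ∃ m, ∀ a ∈ 𝓕.F m, L a ∈ 𝓕.F n) :
    𝓕.HasLim l (fun s => L (g s)) (L a) := by
  intro N
  obtain ⟨m, hm⟩ := hL N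
  obtain ⟨p, hp, h1, h2⟩ := hg m
  refine ⟨_, limPairs_map hp L, ?_, ?_⟩
  · filter_upwards [h1] with s hs
    simpa using hm _ hs
  · simpa using hm _ h2

lemma smul {c : X → ℂ} {γ : ℂ} (hc : Filter.Tendsto c l (𝓝 γ)) (hg : 𝓕.HasLim l g a) :
    𝓕.HasLim l (fun s => c s • g s) (γ • a) := by
  simpa using (smul_const (𝓕 := 𝓕) hc 1).mul hg

lemma neg (hg : 𝓕.HasLim l g a) : 𝓕.HasLim l (fun s => -g s) (-a) := by
  simpa using smul (c := fun _ => -1) (γ := -1) tendsto_const_nhds hg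

lemma sub (hg : 𝓕.HasLim l g a) (hh : 𝓕.HasLim l h b) : 𝓕.HasLim l (fun s => g s - h s) (a - b) := by
  simpa [sub_eq_add_neg] using hg.add hh.neg

lemma lie (hg : 𝓕.HasLim l g a) (hh : 𝓕.HasLim l h b) : 𝓕.HasLim l (fun s => ⁅g s, h s⁆) ⁅a, b⁆ := by
  simpa [Ring.lie_def] using (hg.mul hh).sub (hh.mul hg)

lemma sum {ι : Type*} (S : Finset ι) {g : ι → X → A} {a : ι → A}
    (hg : ∀ i ∈ S, 𝓕.HasLim l (g i) (a i)) :
    𝓕.HasLim l (fun s => ∑ i ∈ S, g i s) (∑ i ∈ S, a i) := by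
  classical
  induction S using Finset.induction_on with
  | empty => simpa using const (𝓕 := 𝓕) (l := l) (0 : A)
  | insert i S hi ih =>
    simp only [Finset.sum_insert hi]
    exact (hg i (by simp)).add (ih fun j hj => hg j (by simp [hj]))

lemma series {D : Module.End ℂ A} (hD : 𝓕.Raises D) (a : A) {c : X → ℕ → ℂ} {γ : ℕ → ℂ}
    (hc : ∀ n, Filter.Tendsto (fun s => c s n) l (𝓝 (γ n))) :
    𝓕.HasLim l (fun s => 𝓕.series fun n => c s n • (D ^ n) a) (𝓕.series fun n => γ n • (D ^ n) a) := by
  intro N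
  obtain ⟨K, hK⟩ := exists_mem_neg (𝓕 := 𝓕) a
  set M := (N + K).toNat
  have hM : N ≤ M - K := by lia
  refine ⟨∑ n ∈ Finset.range M, (fun s => c s n • (D ^ n) a, γ n • (D ^ n) a),
    Submodule.sum_mem _ fun n _ => Submodule.subset_span ⟨_, _, _, hc n, rfl⟩,
    Filter.Eventually.of_forall fun s => ?_, ?_⟩
  · rw [Prod.fst_sum, Finset.sum_apply]
    exact 𝓕.mem_of_le hM ((hD.isTame hK fun n => c s n).series_sub_sum_mem M)
  · rw [Prod.snd_sum]
    exact 𝓕.mem_of_le hM ((hD.isTame hK γ).series_sub_sum_mem M)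

end HasLim

end CompleteFiltration

open CompleteFiltration

variable {A : Type*} [Ring A] [Algebra ℂ A] {𝓕 : CompleteFiltration A} {X : A}

lemma kAd_eq_series (τ : ℍ) (z : ℂ) (X a : A) :
    kAd 𝓕 τ z X a = 𝓕.series fun n => kCoeff τ z n • (adEnd X ^ n) a := by
  simp [kAd_eq_powSeries, powSeries, coeff_kSeries]

lemma hasLim_kAd (hX : X ∈ 𝓕.F 1) (a : A) {τ : ℍ} {z : ℂ} (hz : theta τ z ≠ 0) (c : ℂ) :
    𝓕.HasLim (𝓝[≠] (0 : ℂ)) (fun s => kAd 𝓕 τ (z + c * s) X a) (kAd 𝓕 τ z X a) := by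
  simp only [kAd_eq_series]
  refine HasLim.series (raises_adEnd hX) a fun n => ?_
  have h1 : ContinuousAt (fun s : ℂ => kCoeff τ (z + c * s) n) 0 := by
    have h2 : ContinuousAt (fun w => kCoeff τ w n) (z + c * 0) := by
      simpa using (differentiableAt_kCoeff hz n).continuousAt
    exact h2.comp (f := fun s : ℂ => z + c * s) (by fun_prop)
  have h3 := h1.tendsto
  simp only [mul_zero, add_zero] at h3
  exact h3.mono_left nhdsWithin_le_nhds

/-- At an integer only the constant Taylor coefficient of k has a pole, so the residue contains no
commutator with X. -/
lemma hasLim_smul_kAd (hX : X ∈ 𝓕.F 1) (a : A) (τ : ℍ) (m : ℤ) {c : ℂ} (hc : c ≠ 0) :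
    𝓕.HasLim (𝓝[≠] (0 : ℂ)) (fun s => s • kAd 𝓕 τ (m + c * s) X a) (c⁻¹ • a) := by
  have h1 := HasLim.series (𝓕 := 𝓕) (raises_adEnd hX) a (tendsto_mul_kCoeff τ m hc)
  have h2 : 𝓕.series (fun n => (if n = 0 then c⁻¹ else 0) • (adEnd X ^ n) a) = c⁻¹ • a := by
    refine HasSeries.series_eq fun N => ⟨1, fun i hi => ?_⟩
    obtain ⟨j, rfl⟩ : ∃ j, i = j + 1 := ⟨i - 1, by lia⟩
    simp
  rw [h2] at h1
  refine h1.congr' (Filter.Eventually.of_forall fun s => ?_)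
  simp only [kAd_eq_series]
  refine HasSeries.series_eq ?_
  obtain ⟨K, hK⟩ := exists_mem_neg (𝓕 := 𝓕) a
  simpa [smul_smul] using ((raises_adEnd hX).isTame hK _).hasSeries.smul s

end KZB

end

noncomputable section

namespace KZB

open CompleteFiltration

/-! ### Consequences of the relations for the weight components of the curvature -/

section AdEnd

variable {A : Type*} [Ring A] [Algebra ℂ A]

lemma adEnd_pow_adEnd_left {e c : A} (h : adEnd e c = 0) (n : ℕ) (a : A) :
    (adEnd e ^ n) (adEnd a c) = adEnd ((adEnd e ^ n) a) c := by
  induction n with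
  | zero => simp
  | succ n ih =>
    rw [pow_succ', Module.End.mul_apply, Module.End.mul_apply, ih, adEnd_leibniz, h, map_zero, add_zero]

lemma adEnd_pow_adEnd_right {e a : A} (h : adEnd e a = 0) (n : ℕ) (c : A) :
    (adEnd e ^ n) (adEnd a c) = adEnd a ((adEnd e ^ n) c) := by
  induction n with
  | zero => simp
  | succ n ih =>
    rw [pow_succ', Module.End.mul_apply, Module.End.mul_apply, ih, adEnd_leibniz, h, map_zero,
      LinearMap.zero_apply, zero_add]

/-- The derivation `adEnd a` applied to a power of `adEnd X`. -/
lemma adEnd_apply_pow_succ (a X c : A) (d : ℕ) :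
    adEnd a ((adEnd X ^ (d + 1)) c) = (adEnd X ^ (d + 1)) (adEnd a c) +
      ∑ nm ∈ Finset.HasAntidiagonal.antidiagonal d,
        (adEnd X ^ nm.1) (adEnd (adEnd a X) ((adEnd X ^ nm.2) c)) := by
  induction d with
  | zero => simp [adEnd_leibniz a X c, add_comm]
  | succ d ih =>
    rw [pow_succ', Module.End.mul_apply, adEnd_leibniz, ih, map_add, ← Module.End.mul_apply,
      ← pow_succ', Finset.Nat.sum_antidiagonal_succ, map_sum]
    simp only [pow_succ' (adEnd X), Module.End.mul_apply, pow_zero, Module.End.one_apply]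
    abel

end AdEnd

variable {ι Hd H A : Type*} [AddCommGroup Hd] [Module ℂ Hd] [AddCommGroup H]
  [Module ℂ H] [Ring A] [Algebra ℂ A]

open Classical in
/-- The positive roots. -/
def posRoots [Fintype ι] {P : RootPairing ι ℂ Hd H} (b : P.Base) : Finset ι :=
  Finset.univ.filter fun i => b.IsPos i

lemma mem_posRoots [Fintype ι] {P : RootPairing ι ℂ Hd H} {b : P.Base} {i : ι} :
    i ∈ posRoots b ↔ b.IsPos i := by simp [posRoots]

open Classical in
lemma filter_posRoots_plane [Fintype ι] {P : RootPairing ι ℂ Hd H} (b : P.Base) (i j : ι) :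
    (posRoots b).filter (fun k => k ∈ plane b i j) = plane b i j := by
  ext k
  simp only [Finset.mem_filter, mem_posRoots, mem_plane]
  tauto

/-- The element `x(α^∨)/2`. -/
def halfX (P : RootPairing ι ℂ Hd H) (x : H →ₗ[ℂ] A) (i : ι) : A := x ((1 / 2 : ℂ) • P.coroot i)

lemma kzbForm_eq [Fintype ι] (P : RootPairing ι ℂ Hd H) (b : P.Base) (τ : ℍ) (𝓕 : CompleteFiltration A)
    (t : ι → A) (x y : H →ₗ[ℂ] A) (z u : H) :
    kzbForm P b τ 𝓕 t x y z u =
      -(∑ i ∈ posRoots b, P.root' i u • kAd 𝓕 τ (P.root' i z) (halfX P x i) (t i)) + y u := rfl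

/-- The relations (xx) and (tx), in terms of `adEnd`. -/
structure XRelations (P : RootPairing ι ℂ Hd H) (t : ι → A) (x : H →ₗ[ℂ] A) : Prop where
  xx : ∀ u v : H, adEnd (x u) (x v) = 0
  tx : ∀ i, ∀ u : H, P.root' i u = 0 → adEnd (x u) (t i) = 0

/-- The relation (yx), in terms of `adEnd`. -/
def YXRelation [Fintype ι] (P : RootPairing ι ℂ Hd H) (b : P.Base) (t : ι → A) (x y : H →ₗ[ℂ] A) : Prop :=
  ∀ u v : H, adEnd (y u) (x v) = ∑ i ∈ posRoots b, (P.root' i v * P.root' i u) • t i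

open Classical in
/-- The relation (tt), in terms of `adEnd`. -/
def TTRelation (P : RootPairing ι ℂ Hd H) (b : P.Base) (t : ι → A) : Prop :=
  ∀ Ψ : Finset ι, IsRootSubsystem P Ψ → ∀ i ∈ Ψ,
    ∑ j ∈ Ψ.filter fun j => b.IsPos j, adEnd (t i) (t j) = 0

/-- The relation (ty), in terms of `adEnd`. -/
def TYRelation (P : RootPairing ι ℂ Hd H) (t : ι → A) (y : H →ₗ[ℂ] A) : Prop :=
  ∀ i, ∀ u : H, P.root' i u = 0 → adEnd (y u) (t i) = 0

namespace XRelations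

variable {P : RootPairing ι ℂ Hd H} {t : ι → A} {x : H →ₗ[ℂ] A}

lemma commute (h : XRelations P t x) (u v : H) : Commute (adEnd (x u)) (adEnd (x v)) :=
  commute_adEnd (h.xx u v)

/-- The vector u - α_i(u) α_i^∨/2 is killed by α_i, so (tx) makes ad x(u) on t_i depend only on
α_i(u). -/
lemma apply (h : XRelations P t x) (i : ι) (u : H) :
    adEnd (x u) (t i) = P.root' i u • adEnd (halfX P x i) (t i) := by
  have h := h.tx i (u - P.root' i u • (1 / 2 : ℂ) • P.coroot i)
    (by rw [map_sub, map_smul, root'_half_coroot, smul_eq_mul, mul_one, sub_self])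
  rw [map_sub, map_smul, map_sub, map_smul, LinearMap.sub_apply, LinearMap.smul_apply,
    sub_eq_zero] at h
  exact h

lemma commute_halfX (h : XRelations P t x) (i : ι) (u : H) :
    Commute (adEnd (x u)) (adEnd (halfX P x i)) := h.commute _ _

lemma apply_pow (h : XRelations P t x) (i : ι) (u : H) (n : ℕ) :
    adEnd (x u) ((adEnd (halfX P x i) ^ n) (t i)) =
      P.root' i u • (adEnd (halfX P x i) ^ (n + 1)) (t i) := by
  rw [← Module.End.mul_apply, ((h.commute_halfX i u).pow_right n).eq, Module.End.mul_apply, h.apply, map_smul,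
    ← Module.End.mul_apply, ← pow_succ]

lemma pow_apply (h : XRelations P t x) (i : ι) (u : H) (n : ℕ) :
    (adEnd (x u) ^ n) (t i) = P.root' i u ^ n • (adEnd (halfX P x i) ^ n) (t i) := by
  induction n with
  | zero => simp
  | succ n ih =>
    rw [pow_succ', Module.End.mul_apply, ih, map_smul, h.apply_pow, smul_smul, ← pow_succ]

/-- For v, v' dual to the two roots, ad x(v) kills the factor coming from t_j and acts as ad X_i on
the other, and symmetrically for v'. All derivations can thus be moved outside the bracket. -/
lemma lie_pow_pow (h : XRelations P t x) {i j : ι} {v v' : H} (h₁ : P.root' i v = 1)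
    (h₂ : P.root' j v = 0) (h₃ : P.root' i v' = 0) (h₄ : P.root' j v' = 1) (n m : ℕ) :
    adEnd ((adEnd (halfX P x i) ^ n) (t i)) ((adEnd (halfX P x j) ^ m) (t j)) =
      (adEnd (x v) ^ n) ((adEnd (x v') ^ m) (adEnd (t i) (t j))) := by
  rw [adEnd_pow_adEnd_right (by rw [h.apply, h₃, zero_smul]), adEnd_pow_adEnd_left, h.pow_apply,
    h.pow_apply, h₁, h₄, one_pow, one_pow, one_smul, one_smul]
  rw [h.pow_apply, map_smul, h.apply_pow, h₂, zero_smul, smul_zero]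

lemma adEnd_lie_eq_zero (h : XRelations P t x) {i j : ι} {u : H} (h₁ : P.root' i u = 0)
    (h₂ : P.root' j u = 0) : adEnd (x u) (adEnd (t i) (t j)) = 0 := by
  rw [adEnd_leibniz, h.apply, h.apply, h₁, h₂]
  simp

end XRelations

/-! ### The weight components of the curvature -/

section Weights

variable {P : RootPairing ι ℂ Hd H} {t : ι → A} {x y : H →ₗ[ℂ] A}

/-- The roots of the plane with value in ℤc at e form a root subsystem, which contains i since
α_i(e) = 0. Applying (tt) to these for every c isolates the roots with prescribed squared value by
`sum_filter_sq_eq_zero`. -/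
lemma TTRelation.sum_filter_eq_zero [Fintype ι] {b : P.Base} (h : TTRelation P b t) {i j : ι} {e : H}
    (he : P.root' i e = 0) (c : ℂ) :
    ∑ k ∈ plane b i j with P.root' k e ^ 2 = c, adEnd (t i) (t k) = 0 := by
  classical
  refine sum_filter_sq_eq_zero (plane b i j) (fun k => P.root' k e) _ (fun c => ?_) c
  set Ψ : Finset ι := Finset.univ.filter fun k => InPlane P i j k ∧ ∃ n : ℤ, P.root' k e = n * c
  have hΨ : IsRootSubsystem P Ψ := by
    intro k hk
    let G : AddSubgroup Hd :=
      { carrier := {v | (∀ u, P.root' i u = 0 → P.root' j u = 0 → P.toLinearMap v u = 0) ∧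
          ∃ n : ℤ, P.toLinearMap v e = n * c}
        zero_mem' := ⟨by simp, 0, by simp⟩
        add_mem' := by
          rintro v w ⟨h1, n, hn⟩ ⟨h2, m, hm⟩
          refine ⟨fun u hu hu' => ?_, n + m, ?_⟩
          · rw [map_add, LinearMap.add_apply, h1 u hu hu', h2 u hu hu', add_zero]
          · rw [map_add, LinearMap.add_apply, hn, hm]; push_cast; ring
        neg_mem' := by
          rintro v ⟨h1, n, hn⟩
          refine ⟨fun u hu hu' => ?_, -n, ?_⟩
          · rw [map_neg, LinearMap.neg_apply, h1 u hu hu', neg_zero]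
          · rw [map_neg, LinearMap.neg_apply, hn]; push_cast; ring }
    have hG : AddSubgroup.closure (P.root '' (Ψ : Set ι)) ≤ G := by
      rw [AddSubgroup.closure_le]
      rintro _ ⟨l, hl, rfl⟩
      exact (Finset.mem_filter.mp hl).2
    exact Finset.mem_filter.mpr ⟨Finset.mem_univ _, hG hk⟩
  have := h Ψ hΨ i (Finset.mem_filter.mpr ⟨Finset.mem_univ _, fun _ h _ => h, 0, by simp [he]⟩)
  rw [← this]
  refine Finset.sum_congr ?_ fun _ _ => rfl
  ext k
  simp only [Finset.mem_filter, mem_plane, Ψ, Finset.mem_univ, true_and]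
  tauto

/-- The coefficient of `α_i ∧ α_j` in the weight `d` component of the curvature. -/
def pairTerm (P : RootPairing ι ℂ Hd H) (τ : ℍ) (t : ι → A) (x : H →ₗ[ℂ] A) (z : H) (d : ℕ)
    (i j : ι) : A :=
  ∑ nm ∈ Finset.HasAntidiagonal.antidiagonal d,
      (kCoeff τ (P.root' i z) nm.1 * kCoeff τ (P.root' j z) nm.2) •
        adEnd ((adEnd (halfX P x i) ^ nm.1) (t i)) ((adEnd (halfX P x j) ^ nm.2) (t j)) -
    (2 * kCoeff τ (P.root' i z) (d + 1) * P.root' j ((1 / 2 : ℂ) • P.coroot i)) •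
      ∑ nm ∈ Finset.HasAntidiagonal.antidiagonal d,
        (adEnd (halfX P x i) ^ nm.1) (adEnd ((adEnd (halfX P x i) ^ nm.2) (t i)) (t j))

/-- The value of the `2`-form `α_i ∧ α_j`. -/
def rootWedge (P : RootPairing ι ℂ Hd H) (u v : H) (i j : ι) : ℂ :=
  P.root' i u * P.root' j v - P.root' j u * P.root' i v

lemma rootWedge_self (P : RootPairing ι ℂ Hd H) (u v : H) (i : ι) : rootWedge P u v i i = 0 := by
  simp [rootWedge]

section Eval

open Polynomial
open scoped Polynomial.Bivariate

/-- Substitution of commuting endomorphisms in a polynomial in two variables. -/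
def evalEnd {B C : Module.End ℂ A} (h : Commute B C) : ℂ[X][Y] →+* Module.End ℂ A :=
  Polynomial.eval₂RingHom' (Polynomial.aeval B).toRingHom C fun p => by
    change Commute (Polynomial.aeval B p) C
    induction p using Polynomial.induction_on' with
    | add p q hp hq => rw [map_add]; exact hp.add_left hq
    | monomial n a =>
      rw [Polynomial.aeval_monomial]
      exact Commute.mul_left (Algebra.commutes a C) (h.pow_left n)

lemma evalEnd_C {B D : Module.End ℂ A} (h : Commute B D) (p : ℂ[X]) :
    evalEnd h (C p) = Polynomial.aeval B p := by
  simp [evalEnd]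

lemma evalEnd_C_C {B D : Module.End ℂ A} (h : Commute B D) (c : ℂ) :
    evalEnd h (C (C c)) = c • 1 := by
  rw [evalEnd_C, Polynomial.aeval_C, Algebra.algebraMap_eq_smul_one]

lemma evalEnd_smul {B D : Module.End ℂ A} (h : Commute B D) (c : ℂ) (p : ℂ[X][Y]) :
    evalEnd h (c • p) = c • evalEnd h p := by
  have : c • p = C (C c) * p := by
    rw [← Polynomial.smul_eq_C_mul]
    ext
    simp
  rw [this, map_mul, evalEnd_C_C, smul_mul_assoc, one_mul]

lemma evalEnd_linForm {B D : Module.End ℂ A} (h : Commute B D) (c₁ c₂ : ℂ) :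
    evalEnd h (linForm c₁ c₂) = c₁ • B + c₂ • D := by
  have hX : evalEnd h X = D := by simp [evalEnd]
  rw [linForm, map_add, evalEnd_C, map_mul (Polynomial.aeval B), Polynomial.aeval_C,
    Polynomial.aeval_X, map_mul, evalEnd_C_C, hX, Algebra.algebraMap_eq_smul_one, smul_one_mul, smul_one_mul]

/-- Substitution of commuting endomorphisms, as a linear map. -/
def evalEndLinear {B D : Module.End ℂ A} (h : Commute B D) : ℂ[X][Y] →ₗ[ℂ] A →ₗ[ℂ] A where
  toFun := evalEnd h
  map_add' := map_add _
  map_smul' := evalEnd_smul h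

end Eval

end Weights

end KZB

end

/-! ### The pair terms of one plane as polynomials in commuting derivations. -/

noncomputable section

namespace KZB

open CompleteFiltration

variable {ι Hd H A : Type*} [AddCommGroup Hd] [Module ℂ Hd] [AddCommGroup H]
  [Module ℂ H] [Ring A] [Algebra ℂ A]
  {P : RootPairing ι ℂ Hd H} {t : ι → A} {x y : H →ₗ[ℂ] A}

/-- The eigenvalue-free form of `pairTerm`, as the value of a polynomial in two commuting derivations. -/
lemma pairTerm_eq_evalEnd (h : XRelations P t x) (τ : ℍ) (z : H) (d : ℕ)
    {i₀ j₀ : ι} {e₁ e₂ : H}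
    (h₁ : P.root' i₀ e₁ = 1) (h₂ : P.root' i₀ e₂ = 0) (h₃ : P.root' j₀ e₁ = 0)
    (h₄ : P.root' j₀ e₂ = 1) {i j : ι} (hi : InPlane P i₀ j₀ i) (hj : InPlane P i₀ j₀ j)
    (hdet : planeDet (fun i => P.root' i e₁) (fun i => P.root' i e₂) i j ≠ 0) :
    pairTerm P τ t x z d i j = evalEnd (h.commute e₁ e₂)
      (pairPoly τ (fun i => P.root' i e₁) (fun i => P.root' i e₂)
        (fun i => P.root' i₀ ((1 / 2 : ℂ) • P.coroot i))
        (fun i => P.root' j₀ ((1 / 2 : ℂ) • P.coroot i)) (fun i => P.root' i z) d i j)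
      (adEnd (t i) (t j)) := by
  set a : ι → ℂ := fun i => P.root' i e₁ with ha
  set b : ι → ℂ := fun i => P.root' i e₂ with hb
  -- v and v' are the vectors in the span of e₁, e₂ dual to α_i, α_j; the two coordinate polynomials
  -- evaluate to ad x(v) and ad x(v').
  set v : H := (b j / planeDet a b i j) • e₁ + (-a j / planeDet a b i j) • e₂ with hv
  set v' : H := (b i / planeDet a b j i) • e₁ + (-a i / planeDet a b j i) • e₂ with hv'
  have hdet' : planeDet a b j i ≠ 0 := by rw [planeDet_swap]; exact neg_ne_zero.mpr hdet
  have k₁ : P.root' i v = 1 := by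
    simp only [hv, map_add, map_smul, smul_eq_mul]
    field_simp
    simp only [planeDet, ha, hb]; ring
  have k₂ : P.root' j v = 0 := by
    simp only [hv, map_add, map_smul, smul_eq_mul]
    field_simp
    simp only [ha, hb]; ring
  have k₃ : P.root' i v' = 0 := by
    simp only [hv', map_add, map_smul, smul_eq_mul]
    field_simp
    simp only [ha, hb]; ring
  have k₄ : P.root' j v' = 1 := by
    simp only [hv', map_add, map_smul, smul_eq_mul]
    field_simp
    simp only [planeDet, ha, hb]; ring
  have hE : ∀ c₁ c₂, evalEnd (h.commute e₁ e₂) (linForm c₁ c₂) = adEnd (x (c₁ • e₁ + c₂ • e₂)) := by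
    intro c₁ c₂
    rw [evalEnd_linForm]; simp only [map_add, map_smul]
  -- The component of α_i^∨/2 in the span of e₁, e₂. The roots of the plane do not see the
  -- difference, so ad x(f) and ad X_i agree on [t_i, t_j] and on its images under the commuting
  -- derivations.
  set f : H := P.root' i₀ ((1 / 2 : ℂ) • P.coroot i) • e₁ + P.root' j₀ ((1 / 2 : ℂ) • P.coroot i) • e₂
    with hf
  have hpow : ∀ n m : ℕ, (adEnd (x f) ^ n) ((adEnd (x v) ^ m) (adEnd (t i) (t j))) =
      (adEnd (halfX P x i) ^ n) ((adEnd (x v) ^ m) (adEnd (t i) (t j))) := by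
    intro n m
    have hk : ∀ k : ι, InPlane P i₀ j₀ k → P.root' k (f - (1 / 2 : ℂ) • P.coroot i) = 0 := by
      intro k hk
      rw [map_sub, hk.root'_eq h₁ h₂ h₃ h₄ ((1 / 2 : ℂ) • P.coroot i), hf]
      simp only [map_add, map_smul, smul_eq_mul]
      ring
    have h0 : adEnd (x f) (adEnd (t i) (t j)) = adEnd (halfX P x i) (adEnd (t i) (t j)) := by
      have := h.adEnd_lie_eq_zero (hk i hi) (hk j hj)
      rw [map_sub, map_sub, LinearMap.sub_apply, sub_eq_zero] at this
      exact this
    generalize adEnd (t i) (t j) = c at h0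
    rw [← Module.End.mul_apply, ← Module.End.mul_apply,
      ((h.commute f v).pow_pow n m).eq, (((h.commute_halfX i v).symm).pow_pow n m).eq,
      Module.End.mul_apply, Module.End.mul_apply]
    congr 1
    induction n with
    | zero => simp
    | succ n ih =>
      rw [pow_succ', Module.End.mul_apply, ih, ← Module.End.mul_apply,
        ((h.commute_halfX i f).pow_right n).eq, Module.End.mul_apply, h0, pow_succ,
        Module.End.mul_apply]
  have hcoef : a j * P.root' i₀ ((1 / 2 : ℂ) • P.coroot i) +
      b j * P.root' j₀ ((1 / 2 : ℂ) • P.coroot i) = P.root' j ((1 / 2 : ℂ) • P.coroot i) :=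
    (hj.root'_eq h₁ h₂ h₃ h₄ _).symm
  rw [pairTerm, pairPoly, map_sub, LinearMap.sub_apply, map_sum, LinearMap.sum_apply, map_mul,
    evalEnd_C_C, smul_mul_assoc, one_mul, LinearMap.smul_apply, map_sum, LinearMap.sum_apply, hcoef]
  congr 1
  · refine Finset.sum_congr rfl fun nm _ => ?_
    rw [map_mul, evalEnd_C_C, smul_mul_assoc, one_mul, LinearMap.smul_apply, map_mul, map_pow, map_pow,
      coordPoly, coordPoly, hE, hE, Module.End.mul_apply, h.lie_pow_pow k₁ k₂ k₃ k₄]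
  · congr 1
    refine Finset.sum_congr rfl fun nm _ => ?_
    rw [map_mul, map_pow, map_pow, coordPoly, hE, hE, Module.End.mul_apply, ← hf, ← hv, hpow]
    have := h.lie_pow_pow k₁ k₂ k₃ k₄ nm.2 0
    rw [pow_zero, pow_zero, Module.End.one_apply, Module.End.one_apply] at this
    rw [this]

variable [Fintype ι] {b : P.Base}

lemma planeDet_root'_ne_zero [P.IsReduced] {i₀ j₀ i j : ι} {e₁ e₂ : H}
    (h₁ : P.root' i₀ e₁ = 1) (h₂ : P.root' i₀ e₂ = 0) (h₃ : P.root' j₀ e₁ = 0)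
    (h₄ : P.root' j₀ e₂ = 1) (hi : i ∈ plane b i₀ j₀) (hj : j ∈ plane b i₀ j₀) (hij : j ≠ i) :
    planeDet (fun i => P.root' i e₁) (fun i => P.root' i e₂) i j ≠ 0 := by
  obtain ⟨hi, hi'⟩ := mem_plane.mp hi
  obtain ⟨hj, hj'⟩ := mem_plane.mp hj
  obtain ⟨f₁, f₂, g₁, g₂, g₃, g₄⟩ := exists_dual_pair hi hj hij.symm
  rw [hi'.root'_eq h₁ h₂ h₃ h₄] at g₁ g₂
  rw [hj'.root'_eq h₁ h₂ h₃ h₄] at g₃ g₄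
  have hdet : planeDet (fun i => P.root' i e₁) (fun i => P.root' i e₂) i j *
      (P.root' i₀ f₁ * P.root' j₀ f₂ - P.root' j₀ f₁ * P.root' i₀ f₂) = 1 := by
    simp only [planeDet]
    linear_combination (P.root' j e₁ * P.root' i₀ f₂ + P.root' j e₂ * P.root' j₀ f₂) * g₁ + g₄ -
      (P.root' j e₁ * P.root' i₀ f₁ + P.root' j e₂ * P.root' j₀ f₁) * g₂
  exact left_ne_zero_of_mul_eq_one hdet

/-- `primitive` comes from a coweight on which the root is 1. For `rel`, det(i,·) is evaluation at
α_i(e₁)e₂ - α_i(e₂)e₁, a vector killed by α_i, so (tt) applies through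
`TTRelation.sum_filter_eq_zero`. -/
lemma isPlaneConfig_root' [P.IsRootSystem] [P.IsCrystallographic] [P.IsReduced]
    (htt : TTRelation P b t) {i₀ j₀ : ι} (hi₀ : b.IsPos i₀) (hj₀ : b.IsPos j₀) (hij : i₀ ≠ j₀)
    {e₁ e₂ : H}
    (h₁ : P.root' i₀ e₁ = 1) (h₂ : P.root' i₀ e₂ = 0) (h₃ : P.root' j₀ e₁ = 0)
    (h₄ : P.root' j₀ e₂ = 1) (φ : A →ₗ[ℂ] ℂ) :
    IsPlaneConfig (plane b i₀ j₀) (fun i => P.root' i e₁) (fun i => P.root' i e₂)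
      fun i j => φ (adEnd (t i) (t j)) where
  det_ne_zero i hi j hj hij := planeDet_root'_ne_zero h₁ h₂ h₃ h₄ hi hj hij
  primitive i hi := by
    obtain ⟨m, hm, h1⟩ := exists_coweight_root'_eq_one b i
    refine ⟨P.root' i₀ m, P.root' j₀ m, ?_, fun j hj => ?_⟩
    · rw [← (mem_plane.mp hi).2.root'_eq h₁ h₂ h₃ h₄, h1]
    · obtain ⟨n, hn⟩ := hm j
      exact ⟨n, by rw [← (mem_plane.mp hj).2.root'_eq h₁ h₂ h₃ h₄, hn]⟩
  base := ⟨i₀, left_mem_plane hi₀, h₁, h₂⟩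
  antisymm i j := by rw [adEnd_swap, map_neg]
  rel i hi e := by
    have he : P.root' i (P.root' i e₁ • e₂ - P.root' i e₂ • e₁) = 0 := by
      rw [map_sub, map_smul, map_smul, smul_eq_mul, smul_eq_mul]; ring
    obtain ⟨j₁, hj₁, hne⟩ : ∃ j₁ ∈ plane b i₀ j₀, j₁ ≠ i := by
      rcases eq_or_ne i₀ i with rfl | h
      exacts [⟨j₀, right_mem_plane hj₀, hij.symm⟩, ⟨i₀, left_mem_plane hi₀, h⟩]
    have key := htt.sum_filter_eq_zero (j := j₁) he e
    rw [plane_eq hi₀ hj₀ hij hi hj₁ hne.symm] at key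
    rw [← map_sum, ← map_zero φ, ← key]
    congr 2
    ext k
    rw [Finset.mem_filter, Finset.mem_filter, map_sub, map_smul, map_smul, smul_eq_mul, smul_eq_mul,
      mul_comm (P.root' i e₂), planeDet]

/-- The sum of the pair terms over a plane vanishes. -/
lemma sum_plane_pairTerm_eq_zero [P.IsRootSystem] [P.IsCrystallographic] [P.IsReduced]
    (h : XRelations P t x) (htt : TTRelation P b t) {τ : ℍ} {z : H} (hz : z ∈ regularSet P τ)
    (u v : H) (d : ℕ) {i₀ j₀ : ι} (hi₀ : b.IsPos i₀) (hj₀ : b.IsPos j₀) (hij : i₀ ≠ j₀) :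
    ∑ i ∈ plane b i₀ j₀, ∑ j ∈ plane b i₀ j₀,
      rootWedge P u v i j • pairTerm P τ t x z d i j = 0 := by
  obtain ⟨e₁, e₂, h₁, h₂, h₃, h₄⟩ := exists_dual_pair hi₀ hj₀ hij
  set S := plane b i₀ j₀ with hS
  have hmem : ∀ {i}, i ∈ S → InPlane P i₀ j₀ i := fun hi => (mem_plane.mp hi).2
  obtain ⟨p, hp⟩ : ∃ p, p = pairPoly τ (fun i => P.root' i e₁) (fun i => P.root' i e₂)
        (fun i => P.root' i₀ ((1 / 2 : ℂ) • P.coroot i))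
        (fun i => P.root' j₀ ((1 / 2 : ℂ) • P.coroot i)) (fun i => P.root' i z) d := ⟨_, rfl⟩
  obtain ⟨D, hD⟩ : ∃ D, D = planeDet (fun i => P.root' i e₁) (fun i => P.root' i e₂) := ⟨_, rfl⟩
  have hdual : ∀ φ : A →ₗ[ℂ] ℂ, ∑ ij ∈ S ×ˢ S,
      φ (adEnd (t ij.1) (t ij.2)) • (D ij.1 ij.2 • p ij.1 ij.2) = 0 := by
    intro φ
    have hcfg := isPlaneConfig_root' htt hi₀ hj₀ hij h₁ h₂ h₃ h₄ φ
    have hζ : ∀ i ∈ S, P.root' i e₁ * P.root' i₀ z + P.root' i e₂ * P.root' j₀ z = P.root' i z :=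
      fun i hi => ((hmem hi).root'_eq h₁ h₂ h₃ h₄ z).symm
    have := hcfg.sum_pairPoly_eq_zero τ (c₁ := fun i => P.root' i₀ ((1 / 2 : ℂ) • P.coroot i))
      (c₂ := fun i => P.root' j₀ ((1 / 2 : ℂ) • P.coroot i))
      (fun i hi => by rw [← (hmem hi).root'_eq h₁ h₂ h₃ h₄, root'_half_coroot])
      (z₁ := P.root' i₀ z) (z₂ := P.root' j₀ z)
      (fun i hi => by rw [hζ i hi]; exact mem_regularSet_iff.mp hz i) d
    rw [Finset.sum_product, ← this]
    refine Finset.sum_congr rfl fun i hi => Finset.sum_congr rfl fun j hj => ?_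
    have hpp : p i j = pairPoly τ (fun i => P.root' i e₁) (fun i => P.root' i e₂)
        (fun i => P.root' i₀ ((1 / 2 : ℂ) • P.coroot i))
        (fun i => P.root' j₀ ((1 / 2 : ℂ) • P.coroot i))
        (fun i => P.root' i e₁ * P.root' i₀ z + P.root' i e₂ * P.root' j₀ z) d i j := by
      rw [hp]
      simp only [pairPoly, hζ i hi, hζ j hj]
    rw [hpp, smul_smul, mul_comm (φ _), hD]
  have key := sum_apply_eq_zero_of_forall_dual (S ×ˢ S) _ _ hdual (evalEndLinear (h.commute e₁ e₂))
  rw [Finset.sum_product] at key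
  -- In a plane every α_i ∧ α_j is det(i,j) times the fixed form α_{i₀} ∧ α_{j₀}.
  have : ∀ i ∈ S, ∀ j ∈ S, rootWedge P u v i j • pairTerm P τ t x z d i j =
      rootWedge P u v i₀ j₀ • evalEndLinear (h.commute e₁ e₂) (D i j • p i j) (adEnd (t i) (t j)) := by
    intro i hi j hj
    rcases eq_or_ne j i with rfl | hne
    · rw [rootWedge_self, hD, planeDet_self]; simp
    · rw [map_smul, LinearMap.smul_apply, smul_smul,
        pairTerm_eq_evalEnd h τ z d h₁ h₂ h₃ h₄ (hmem hi) (hmem hj)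
          (planeDet_root'_ne_zero h₁ h₂ h₃ h₄ hi hj hne), ← hp]
      change _ • _ = _ • evalEnd (h.commute e₁ e₂) _ _
      congr 1
      simp only [rootWedge, hD, planeDet]
      rw [(hmem hi).root'_eq h₁ h₂ h₃ h₄ u, (hmem hi).root'_eq h₁ h₂ h₃ h₄ v,
        (hmem hj).root'_eq h₁ h₂ h₃ h₄ u, (hmem hj).root'_eq h₁ h₂ h₃ h₄ v]
      ring
  rw [Finset.sum_congr rfl fun i hi => Finset.sum_congr rfl fun j hj => this i hi j hj]
  simp only [← Finset.smul_sum]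
  rw [key, smul_zero]

/-- The sum of the pair terms over all pairs of positive roots vanishes. -/
lemma sum_pairTerm_eq_zero [P.IsRootSystem] [P.IsCrystallographic] [P.IsReduced]
    (h : XRelations P t x) (htt : TTRelation P b t) {τ : ℍ} {z : H} (hz : z ∈ regularSet P τ)
    (u v : H) (d : ℕ) :
    ∑ i ∈ posRoots b, ∑ j ∈ posRoots b, rootWedge P u v i j • pairTerm P τ t x z d i j = 0 := by
  classical
  refine sum_sum_eq_zero_of_plane (b := b) _ _ (fun i hi => mem_posRoots.mp hi)
    (fun i => by rw [rootWedge_self, zero_smul]) fun i j hi hj hij => ?_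
  simp only [filter_posRoots_plane]
  exact sum_plane_pairTerm_eq_zero h htt hz u v d hi hj hij

end KZB

end

/-! ### The commutator of two values of the connection form. -/

noncomputable section

namespace KZB

open CompleteFiltration

section

variable {A : Type*} [Ring A] [Algebra ℂ A] {𝓕 : CompleteFiltration A}

lemma CompleteFiltration.adEnd_mem {m n : ℤ} {a b : A} (ha : a ∈ 𝓕.F m) (hb : b ∈ 𝓕.F n) :
    adEnd a b ∈ 𝓕.F (m + n) := by
  rw [← lie_eq_adEnd]; exact 𝓕.lie_mem ha hb

lemma CompleteFiltration.continuous_adEnd (a : A) (n : ℤ) :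
    ∃ m, ∀ b ∈ 𝓕.F m, adEnd a b ∈ 𝓕.F n := by
  obtain ⟨k, hk⟩ := 𝓕.exhaustive a
  exact ⟨n - k, fun b hb => 𝓕.mem_of_le (by lia) (adEnd_mem hk hb)⟩

lemma CompleteFiltration.continuous_adEnd_flip (a : A) (n : ℤ) :
    ∃ m, ∀ b ∈ 𝓕.F m, adEnd.flip a b ∈ 𝓕.F n := by
  obtain ⟨k, hk⟩ := 𝓕.exhaustive a
  exact ⟨n - k, fun b hb => 𝓕.mem_of_le (by lia) (adEnd_mem hb hk)⟩

lemma CompleteFiltration.HasSeries.unshift {f : ℕ → A} {a : A} (h : 𝓕.HasSeries f a) :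
    𝓕.HasSeries (fun n => f (n + 1)) (a - f 0) := by
  intro n
  obtain ⟨k, hk⟩ := h n
  refine ⟨k, fun i hi => ?_⟩
  have := hk (i + 1) (by lia)
  simp only [Finset.sum_range_succ'] at this
  convert this using 1
  abel

lemma hasSeries_kAd {X : A} (hX : X ∈ 𝓕.F 1) (τ : ℍ) (z : ℂ) (a : A) :
    𝓕.HasSeries (fun n => kCoeff τ z n • (adEnd X ^ n) a) (kAd 𝓕 τ z X a) := by
  rw [kAd_eq_series]
  obtain ⟨K, hK⟩ := exists_mem_neg (𝓕 := 𝓕) a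
  exact ((raises_adEnd hX).isTame hK _).hasSeries

lemma hasSeries_adEnd_kAd_kAd {X Y : A} (hX : X ∈ 𝓕.F 1) (hY : Y ∈ 𝓕.F 1) (τ : ℍ) (z w : ℂ)
    (a b : A) :
    𝓕.HasSeries (fun d => ∑ nm ∈ Finset.HasAntidiagonal.antidiagonal d,
      (kCoeff τ z nm.1 * kCoeff τ w nm.2) • adEnd ((adEnd X ^ nm.1) a) ((adEnd Y ^ nm.2) b))
      (adEnd (kAd 𝓕 τ z X a) (kAd 𝓕 τ w Y b)) := by
  obtain ⟨K, hK⟩ := exists_mem_neg (𝓕 := 𝓕) a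
  obtain ⟨L, hL⟩ := exists_mem_neg (𝓕 := 𝓕) b
  have hmem : ∀ n m : ℕ, (kCoeff τ z n * kCoeff τ w m) •
      adEnd ((adEnd X ^ n) a) ((adEnd Y ^ m) b) ∈ 𝓕.F (n + m - (K + L)) := fun n m =>
    Submodule.smul_mem _ _ (𝓕.mem_of_le (by lia)
      (adEnd_mem ((raises_adEnd hX).pow_mem hK n) ((raises_adEnd hY).pow_mem hL m)))
  have h1 : 𝓕.IsTame (K + L) fun d => ∑ nm ∈ Finset.HasAntidiagonal.antidiagonal d,
      (kCoeff τ z nm.1 * kCoeff τ w nm.2) • adEnd ((adEnd X ^ nm.1) a) ((adEnd Y ^ nm.2) b) := by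
    intro d
    refine Submodule.sum_mem _ fun nm hnm => 𝓕.mem_of_le ?_ (hmem nm.1 nm.2)
    have := Finset.HasAntidiagonal.mem_antidiagonal.mp hnm
    lia
  have h2 := h1.hasSeries
  rw [𝓕.series_antidiagonal (c := fun n m => (kCoeff τ z n * kCoeff τ w m) •
      adEnd ((adEnd X ^ n) a) ((adEnd Y ^ m) b)) hmem] at h2
  have h3 : ∀ n, 𝓕.series (fun m => (kCoeff τ z n * kCoeff τ w m) •
      adEnd ((adEnd X ^ n) a) ((adEnd Y ^ m) b)) =
      kCoeff τ z n • adEnd ((adEnd X ^ n) a) (kAd 𝓕 τ w Y b) := by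
    intro n
    refine HasSeries.series_eq ?_
    simpa [mul_smul] using ((hasSeries_kAd hY τ w b).map
      (continuous_adEnd ((adEnd X ^ n) a))).smul (kCoeff τ z n)
  have h4 : 𝓕.series (fun n => kCoeff τ z n • adEnd ((adEnd X ^ n) a) (kAd 𝓕 τ w Y b)) =
      adEnd (kAd 𝓕 τ z X a) (kAd 𝓕 τ w Y b) := by
    refine HasSeries.series_eq ?_
    simpa using (hasSeries_kAd hX τ z a).map (continuous_adEnd_flip (kAd 𝓕 τ w Y b))
  simp only [h3, h4] at h2
  exact h2

end

variable {ι Hd H A : Type*} [AddCommGroup Hd] [Module ℂ Hd] [AddCommGroup H]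
  [Module ℂ H] [Ring A] [Algebra ℂ A] {𝓕 : CompleteFiltration A}
  {P : RootPairing ι ℂ Hd H} {t : ι → A} {x y : H →ₗ[ℂ] A}

lemma halfX_mem (hx : ∀ u, x u ∈ 𝓕.F 1) (i : ι) : halfX P x i ∈ 𝓕.F 1 := hx _

variable [Fintype ι] {b : P.Base}

/-- The commutator of `y u` with a term of the connection form. -/
lemma adEnd_y_pow_succ (hyx : YXRelation P b t x y) (hty : TYRelation P t y) (u : H) (i : ι) (d : ℕ) :
    adEnd (y u) ((adEnd (halfX P x i) ^ (d + 1)) (t i)) =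
      P.root' i u • (adEnd (halfX P x i) ^ (d + 1)) (adEnd (y ((1 / 2 : ℂ) • P.coroot i)) (t i)) -
      ∑ j ∈ posRoots b, (P.root' j ((1 / 2 : ℂ) • P.coroot i) * P.root' j u) •
        ∑ nm ∈ Finset.HasAntidiagonal.antidiagonal d,
          (adEnd (halfX P x i) ^ nm.1) (adEnd ((adEnd (halfX P x i) ^ nm.2) (t i)) (t j)) := by
  -- By (ty) this bracket depends on u only through α_i(u), which later makes it cancel in the
  -- antisymmetrization in u, v.
  have hy : adEnd (y u) (t i) = P.root' i u • adEnd (y ((1 / 2 : ℂ) • P.coroot i)) (t i) := by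
    have h := hty i (u - P.root' i u • (1 / 2 : ℂ) • P.coroot i)
      (by rw [map_sub, map_smul, root'_half_coroot, smul_eq_mul, mul_one, sub_self])
    rw [map_sub, map_smul, map_sub, map_smul, LinearMap.sub_apply, LinearMap.smul_apply,
      sub_eq_zero] at h
    exact h
  rw [adEnd_apply_pow_succ, hy, map_smul, sub_eq_add_neg]
  congr 1
  rw [halfX, hyx, ← Finset.sum_neg_distrib]
  simp only [map_sum, LinearMap.sum_apply, map_smul, LinearMap.smul_apply]
  rw [Finset.sum_comm]
  refine Finset.sum_congr rfl fun j _ => ?_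
  rw [Finset.smul_sum, ← Finset.sum_neg_distrib]
  refine Finset.sum_congr rfl fun nm _ => ?_
  rw [adEnd_swap (t j), map_neg, smul_neg]

/-- The weight components of the commutator of the values of the connection form vanish. -/
lemma weight_eq_zero [P.IsRootSystem] [P.IsCrystallographic] [P.IsReduced]
    (h : XRelations P t x) (hyx : YXRelation P b t x y) (htt : TTRelation P b t)
    (hty : TYRelation P t y) {τ : ℍ} {z : H} (hz : z ∈ regularSet P τ) (u v : H) (d : ℕ) :
    ∑ i ∈ posRoots b, ∑ j ∈ posRoots b, (P.root' i u * P.root' j v) •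
      ∑ nm ∈ Finset.HasAntidiagonal.antidiagonal d,
        (kCoeff τ (P.root' i z) nm.1 * kCoeff τ (P.root' j z) nm.2) •
          adEnd ((adEnd (halfX P x i) ^ nm.1) (t i)) ((adEnd (halfX P x j) ^ nm.2) (t j)) +
    ∑ i ∈ posRoots b, P.root' i u • kCoeff τ (P.root' i z) (d + 1) •
      adEnd (y v) ((adEnd (halfX P x i) ^ (d + 1)) (t i)) -
    ∑ i ∈ posRoots b, P.root' i v • kCoeff τ (P.root' i z) (d + 1) •
      adEnd (y u) ((adEnd (halfX P x i) ^ (d + 1)) (t i)) = 0 := by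
  set B : ι → ι → A := fun i j => ∑ nm ∈ Finset.HasAntidiagonal.antidiagonal d,
        (kCoeff τ (P.root' i z) nm.1 * kCoeff τ (P.root' j z) nm.2) •
          adEnd ((adEnd (halfX P x i) ^ nm.1) (t i)) ((adEnd (halfX P x j) ^ nm.2) (t j)) with hB
  set G : ι → ι → A := fun i j => ∑ nm ∈ Finset.HasAntidiagonal.antidiagonal d,
          (adEnd (halfX P x i) ^ nm.1) (adEnd ((adEnd (halfX P x i) ^ nm.2) (t i)) (t j)) with hG
  have hswap : ∀ i j, B j i = -B i j := by
    intro i j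
    simp only [hB, ← Finset.sum_neg_distrib]
    rw [← Finset.Nat.sum_antidiagonal_swap]
    refine Finset.sum_congr rfl fun nm _ => ?_
    rw [adEnd_swap, smul_neg, Prod.fst_swap, Prod.snd_swap, mul_comm]
  have hpt : ∀ i j, pairTerm P τ t x z d i j = B i j -
    (2 * kCoeff τ (P.root' i z) (d + 1) * P.root' j ((1 / 2 : ℂ) • P.coroot i)) • G i j :=
    fun i j => rfl
  have hsum := sum_pairTerm_eq_zero h htt hz u v d
  -- Since B is antisymmetric, its wedge sum is twice the plain sum; this matches the factor 2 in
  -- `pairTerm`.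
  have hBB : ∑ i ∈ posRoots b, ∑ j ∈ posRoots b, (P.root' j u * P.root' i v) • B i j =
      -∑ i ∈ posRoots b, ∑ j ∈ posRoots b, (P.root' i u * P.root' j v) • B i j := by
    rw [Finset.sum_comm, ← Finset.sum_neg_distrib]
    refine Finset.sum_congr rfl fun i _ => ?_
    rw [← Finset.sum_neg_distrib]
    refine Finset.sum_congr rfl fun j _ => ?_
    rw [hswap, smul_neg]
  have hterm : ∀ i j, rootWedge P u v i j • pairTerm P τ t x z d i j =
      (P.root' i u * P.root' j v) • B i j - (P.root' j u * P.root' i v) • B i j +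
      (2 : ℂ) • (((P.root' i v * P.root' j u - P.root' i u * P.root' j v) *
        (kCoeff τ (P.root' i z) (d + 1) * P.root' j ((1 / 2 : ℂ) • P.coroot i))) • G i j) := by
    intro i j
    rw [hpt, rootWedge]
    module
  simp only [hterm, Finset.sum_add_distrib, Finset.sum_sub_distrib, ← Finset.smul_sum] at hsum
  rw [hBB, sub_neg_eq_add, ← two_smul ℂ, ← smul_add, smul_eq_zero_iff_right two_ne_zero] at hsum
  rw [← hsum, add_sub_assoc]
  congr 1
  rw [← Finset.sum_sub_distrib]
  refine Finset.sum_congr rfl fun i _ => ?_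
  -- The first terms of the two expansions both carry α_i(u)α_i(v) and cancel; the sums over j are
  -- the part of the pair terms coming from (yx).
  rw [adEnd_y_pow_succ hyx hty, adEnd_y_pow_succ hyx hty]
  have hR : ∑ j ∈ posRoots b, ((P.root' i v * P.root' j u - P.root' i u * P.root' j v) *
        (kCoeff τ (P.root' i z) (d + 1) * P.root' j ((1 / 2 : ℂ) • P.coroot i))) • G i j =
      (P.root' i v * kCoeff τ (P.root' i z) (d + 1)) •
        ∑ j ∈ posRoots b, (P.root' j ((1 / 2 : ℂ) • P.coroot i) * P.root' j u) • G i j -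
      (P.root' i u * kCoeff τ (P.root' i z) (d + 1)) •
        ∑ j ∈ posRoots b, (P.root' j ((1 / 2 : ℂ) • P.coroot i) * P.root' j v) • G i j := by
    rw [Finset.smul_sum, Finset.smul_sum, ← Finset.sum_sub_distrib]
    refine Finset.sum_congr rfl fun j _ => ?_
    module
  rw [hR]
  change _ • _ • (_ • _ - ∑ j ∈ posRoots b, (P.root' j ((1 / 2 : ℂ) • P.coroot i) * P.root' j v) • G i j) -
    _ • _ • (_ • _ - ∑ j ∈ posRoots b, (P.root' j ((1 / 2 : ℂ) • P.coroot i) * P.root' j u) • G i j) = _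
  module

/-- The commutator of two values of the connection form. -/
lemma adEnd_kzbForm [P.IsRootSystem] [P.IsCrystallographic] [P.IsReduced]
    (hx : ∀ u, x u ∈ 𝓕.F 1) (h : XRelations P t x) (hyx : YXRelation P b t x y)
    (htt : TTRelation P b t) (hty : TYRelation P t y) {τ : ℍ} {z : H} (hz : z ∈ regularSet P τ)
    (u v : H) :
    adEnd (kzbForm P b τ 𝓕 t x y z u) (kzbForm P b τ 𝓕 t x y z v) = adEnd (y u) (y v) := by
  set κ : ι → A := fun i => kAd 𝓕 τ (P.root' i z) (halfX P x i) (t i) with hκ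
  have hexp : adEnd (kzbForm P b τ 𝓕 t x y z u) (kzbForm P b τ 𝓕 t x y z v) =
      ∑ i ∈ posRoots b, ∑ j ∈ posRoots b, (P.root' i u * P.root' j v) • adEnd (κ i) (κ j) +
      ∑ i ∈ posRoots b, P.root' i u • adEnd (y v) (κ i) -
      ∑ i ∈ posRoots b, P.root' i v • adEnd (y u) (κ i) + adEnd (y u) (y v) := by
    rw [kzbForm_eq, kzbForm_eq]
    have e1 : ∀ S₁ S₂ : A, adEnd (-S₁ + y u) (-S₂ + y v) =
        adEnd S₁ S₂ + adEnd (y v) S₁ - adEnd (y u) S₂ + adEnd (y u) (y v) := by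
      intro S₁ S₂
      rw [adEnd_swap (y v) S₁]
      simp only [map_add, map_neg, LinearMap.add_apply, LinearMap.neg_apply]
      abel
    rw [e1]
    simp only [map_sum, map_smul, LinearMap.sum_apply, LinearMap.smul_apply, hκ, Finset.smul_sum,
      smul_smul]
    congr 3
    rw [Finset.sum_comm]
    refine Finset.sum_congr rfl fun i _ => Finset.sum_congr rfl fun j _ => ?_
    rw [mul_comm]
  have hcancel : ∀ i, P.root' i u • adEnd (y v) (t i) = P.root' i v • adEnd (y u) (t i) := by
    intro i
    have := hty i (P.root' i u • v - P.root' i v • u)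
      (by rw [map_sub, map_smul, map_smul, smul_eq_mul, smul_eq_mul]; ring)
    rw [map_sub, map_smul, map_smul, map_sub, map_smul, map_smul, LinearMap.sub_apply, sub_eq_zero]
      at this
    exact this
  -- The shift by one aligns degrees: (yx) consumes one x, so the y-brackets of degree d + 1 balance
  -- the brackets of two k-terms of degree d. The terms omitted by the shift, of degree 0, cancel by
  -- `hcancel`.
  have hκs : ∀ (w : H) (i : ι), 𝓕.HasSeries
      (fun d => kCoeff τ (P.root' i z) (d + 1) •
        adEnd (y w) ((adEnd (halfX P x i) ^ (d + 1)) (t i)))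
      (adEnd (y w) (κ i) - kCoeff τ (P.root' i z) 0 • adEnd (y w) (t i)) := by
    intro w i
    simpa using ((hasSeries_kAd (halfX_mem hx i) τ (P.root' i z) (t i)).map
      (continuous_adEnd (y w))).unshift
  have h1 := hasSeries_finsetSum (posRoots b) fun i _ =>
    hasSeries_finsetSum (posRoots b) fun j _ =>
      (hasSeries_adEnd_kAd_kAd (halfX_mem (P := P) hx i) (halfX_mem (P := P) hx j) τ
        (P.root' i z) (P.root' j z) (t i) (t j)).smul (P.root' i u * P.root' j v)
  have h2 := hasSeries_finsetSum (posRoots b) fun i _ => (hκs v i).smul (P.root' i u)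
  have h3 := (hasSeries_finsetSum (posRoots b) fun i _ => (hκs u i).smul (P.root' i v)).smul (-1)
  have h4 := ((h1.add h2).add h3).series_eq
  have h5 : ∀ d, _ = (0 : A) := fun d => weight_eq_zero h hyx htt hty hz u v d
  simp only [neg_smul, one_smul, ← sub_eq_add_neg, h5, 𝓕.hasSeries_zero.series_eq] at h4
  have h6 : ∑ i ∈ posRoots b, P.root' i u • kCoeff τ (P.root' i z) 0 • adEnd (y v) (t i) =
      ∑ i ∈ posRoots b, P.root' i v • kCoeff τ (P.root' i z) 0 • adEnd (y u) (t i) :=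
    Finset.sum_congr rfl fun i _ => by rw [smul_comm, hcancel, smul_comm]
  simp only [smul_sub, Finset.sum_sub_distrib] at h4
  rw [hexp, ← sub_eq_zero, add_sub_cancel_right, h4, h6]
  abel

end KZB

end

noncomputable section

namespace KZB

open CompleteFiltration

/-! ### Derivatives of the connection form -/

section Derivative

variable {A : Type*} [Ring A] [Algebra ℂ A] {𝓕 : CompleteFiltration A}

lemma CompleteFiltration.HasDerivInDirection.unique {V : Type*} [AddCommGroup V] [Module ℂ V]
    {g : V → A} {z v : V} {a a' : A} (h : 𝓕.HasDerivInDirection g z v a)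
    (h' : 𝓕.HasDerivInDirection g z v a') : a = a' := by
  refine sub_eq_zero.mp (𝓕.eq_zero_of_forall_functional fun φ hφ => ?_)
  rw [map_sub, (h φ hφ).unique (h' φ hφ), sub_self]

/-- The derivative of `kAd` in its first variable. -/
def kAdDeriv (𝓕 : CompleteFiltration A) (τ : ℍ) (z : ℂ) (X a : A) : A :=
  𝓕.series fun n => deriv (fun w => kCoeff τ w n) z • (adEnd X ^ n) a

/-- A continuous functional truncates the series to a finite sum, which is differentiated term by
term. -/
lemma hasDerivAt_kAd {X : A} (hX : X ∈ 𝓕.F 1) (a : A) {τ : ℍ} {z : ℂ} (hz : theta τ z ≠ 0) (c : ℂ)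
    {φ : A →ₗ[ℂ] ℂ} {N : ℤ} (hφ : ∀ c ∈ 𝓕.F N, φ c = 0) :
    HasDerivAt (fun s : ℂ => φ (kAd 𝓕 τ (z + s * c) X a)) (c * φ (kAdDeriv 𝓕 τ z X a)) 0 := by
  obtain ⟨K, hK⟩ := exists_mem_neg (𝓕 := 𝓕) a
  have hD := raises_adEnd hX
  have h1 : ∀ f : ℕ → ℂ, φ (𝓕.series fun n => f n • (adEnd X ^ n) a) =
      ∑ n ∈ Finset.range (N + K).toNat, f n * φ ((adEnd X ^ n) a) := by
    intro f
    rw [(hD.isTame hK f).functional_series hφ (M := (N + K).toNat) (by lia)]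
    simp
  simp only [kAd_eq_series, kAdDeriv, h1]
  rw [Finset.mul_sum]
  refine HasDerivAt.fun_sum fun n _ => ?_
  have h2 : HasDerivAt (fun w => kCoeff τ w n) (deriv (fun w => kCoeff τ w n) z) (z + 0 * c) := by
    simpa using (differentiableAt_kCoeff hz n).hasDerivAt
  have h3 : HasDerivAt (fun s : ℂ => z + s * c) c 0 := by
    simpa using ((hasDerivAt_id (0 : ℂ)).mul_const c).const_add z
  have h4 := (h2.comp (0 : ℂ) h3).mul_const (φ ((adEnd X ^ n) a))
  exact h4.congr_deriv (by ring)

variable {ι Hd H : Type*} [Fintype ι] [AddCommGroup Hd] [Module ℂ Hd] [AddCommGroup H]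
  [Module ℂ H] {P : RootPairing ι ℂ Hd H} {b : P.Base} {t : ι → A} {x y : H →ₗ[ℂ] A}

/-- The derivative of the connection form, a symmetric bilinear form. -/
def kzbDeriv (P : RootPairing ι ℂ Hd H) (b : P.Base) (τ : ℍ) (𝓕 : CompleteFiltration A)
    (t : ι → A) (x : H →ₗ[ℂ] A) (z u v : H) : A :=
  -∑ i ∈ posRoots b, (P.root' i u * P.root' i v) • kAdDeriv 𝓕 τ (P.root' i z) (halfX P x i) (t i)

lemma kzbDeriv_comm (τ : ℍ) (z u v : H) : kzbDeriv P b τ 𝓕 t x z u v = kzbDeriv P b τ 𝓕 t x z v u := by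
  simp only [kzbDeriv, mul_comm]

lemma hasDerivInDirection_kzbForm (hx : ∀ u, x u ∈ 𝓕.F 1) {τ : ℍ} {z : H} (hz : z ∈ regularSet P τ)
    (u v : H) : 𝓕.HasDerivInDirection (fun p => kzbForm P b τ 𝓕 t x y p v) z u
      (kzbDeriv P b τ 𝓕 t x z u v) := by
  rintro φ ⟨N, hN⟩
  simp only [kzbForm_eq, kzbDeriv, map_add, map_neg, map_sum, map_smul, smul_eq_mul]
  refine HasDerivAt.add_const _ (HasDerivAt.neg (HasDerivAt.fun_sum fun i _ => ?_))
  have h1 := (hasDerivAt_kAd (halfX_mem (P := P) hx i) (t i) (mem_regularSet_iff.mp hz i)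
    (P.root' i u) hN).const_mul (P.root' i v)
  exact h1.congr_deriv (by ring)

/-- Each term of the form is a function of α times dα, hence closed: the derivative is symmetric in
u, v and drops out of the curvature. -/
lemma zeroCurvatureOn_iff (hx : ∀ u, x u ∈ 𝓕.F 1) (τ : ℍ) :
    𝓕.ZeroCurvatureOn (kzbForm P b τ 𝓕 t x y) (regularSet P τ) ↔ ∀ z ∈ regularSet P τ, ∀ u v,
      adEnd (kzbForm P b τ 𝓕 t x y z u) (kzbForm P b τ 𝓕 t x y z v) = 0 := by
  refine forall₂_congr fun z hz => forall₂_congr fun u v => ⟨?_, fun h => ?_⟩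
  · rintro ⟨a, a', h, h', h0⟩
    rw [h.unique (hasDerivInDirection_kzbForm hx hz u v),
      h'.unique (hasDerivInDirection_kzbForm hx hz v u), kzbDeriv_comm, sub_self, zero_add] at h0
    rw [← lie_eq_adEnd, h0]
  · refine ⟨_, _, hasDerivInDirection_kzbForm hx hz u v, hasDerivInDirection_kzbForm hx hz v u, ?_⟩
    rw [kzbDeriv_comm, sub_self, zero_add, lie_eq_adEnd, h]

end Derivative

/-! ### Invariance of the connection form under lattice translations -/

section Descends

/-- The power series `(exp (c X) - 1) / X`. -/
def expQuot (c : ℂ) : PowerSeries ℂ := PowerSeries.mk fun n => c ^ (n + 1) / (n + 1).factorial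

lemma X_mul_expQuot (c : ℂ) :
    PowerSeries.X * expQuot c = PowerSeries.rescale c (PowerSeries.exp ℂ) - 1 := by
  ext n
  rcases n with _ | n
  · rw [map_sub, PowerSeries.coeff_rescale, PowerSeries.coeff_exp]
    simp
  · rw [PowerSeries.coeff_succ_X_mul, expQuot, PowerSeries.coeff_mk, map_sub, PowerSeries.coeff_rescale,
      PowerSeries.coeff_exp, PowerSeries.coeff_one, if_neg n.succ_ne_zero, sub_zero]
    simp [div_eq_mul_inv]

lemma C_mul_rescale_expQuot (a c : ℂ) :
    PowerSeries.C a * PowerSeries.rescale a (expQuot c) = expQuot (a * c) := by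
  ext n
  rw [PowerSeries.coeff_C_mul, PowerSeries.coeff_rescale, expQuot, expQuot, PowerSeries.coeff_mk,
    PowerSeries.coeff_mk]
  ring

lemma kSeries_add_lattice' {τ : ℍ} {z : ℂ} (hz : theta τ z ≠ 0) (m n : ℤ) :
    kSeries τ (z + (m + n * τ)) = PowerSeries.rescale (-(2 * Real.pi * Complex.I) * n)
      (PowerSeries.exp ℂ) * kSeries τ z + expQuot (-(2 * Real.pi * Complex.I) * n) := by
  refine mul_left_cancel₀ (PowerSeries.X_ne_zero (R := ℂ)) ?_
  have := kSeries_add_lattice hz m n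
  rw [mul_add PowerSeries.X, X_mul_expQuot]
  linear_combination this

variable {A : Type*} [Ring A] [Algebra ℂ A] {𝓕 : CompleteFiltration A}

/-- The value of a power series in an endomorphism that raises the filtration degree, as a linear
map. -/
def CompleteFiltration.Raises.powSeriesLinear {D : Module.End ℂ A} (hD : 𝓕.Raises D)
    (f : PowerSeries ℂ) : A →ₗ[ℂ] A where
  toFun := 𝓕.powSeries f D
  map_add' := hD.powSeries_apply_add f
  map_smul' c a := hD.powSeries_smul f c a

lemma CompleteFiltration.Raises.powSeries_C_mul {D : Module.End ℂ A} (hD : 𝓕.Raises D)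
    (c : ℂ) (f : PowerSeries ℂ) (a : A) :
    𝓕.powSeries (PowerSeries.C c * f) D a = c • 𝓕.powSeries f D a := by
  refine HasSeries.series_eq ?_
  simpa [smul_smul] using (hD.hasSeries_powSeries f a).smul c

lemma CompleteFiltration.Raises.powSeries_exp {D : Module.End ℂ A} (hD : 𝓕.Raises D) (a : A) :
    𝓕.powSeries (PowerSeries.exp ℂ) D a = a + 𝓕.powSeries (expQuot 1) D (D a) := by
  have h : PowerSeries.exp ℂ = 1 + PowerSeries.X * expQuot 1 := by
    rw [X_mul_expQuot, PowerSeries.rescale_one]; simp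
  rw [h, hD.powSeries_add, powSeries_one, hD.powSeries_X_mul, hD.powSeries_apply_comm]

variable {ι Hd H : Type*} [AddCommGroup Hd] [Module ℂ Hd] [AddCommGroup H]
  [Module ℂ H] {P : RootPairing ι ℂ Hd H} {t : ι → A} {x y : H →ₗ[ℂ] A}

lemma XRelations.apply_powSeries (h : XRelations P t x) (hx : ∀ u, x u ∈ 𝓕.F 1) (i : ι) (u : H)
    (f : PowerSeries ℂ) :
    adEnd (x u) (𝓕.powSeries f (adEnd (halfX P x i)) (t i)) =
      P.root' i u • adEnd (halfX P x i) (𝓕.powSeries f (adEnd (halfX P x i)) (t i)) := by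
  have hD := raises_adEnd (halfX_mem (P := P) hx i)
  rw [hD.map_powSeries (continuous_adEnd (x u)) f (t i) (fun n => h.apply_pow i u n),
    ← LinearMap.smul_apply, hD.map_powSeries (g := fun n =>
      P.root' i u • (adEnd (halfX P x i) ^ (n + 1)) (t i)) ((hD.smul (P.root' i u)).continuous) f (t i)]
  intro n
  rw [LinearMap.smul_apply, pow_succ', Module.End.mul_apply]

/-- On the elements generated from t_i by ad X_i, the derivation ad x(u) acts as α_i(u) ad X_i. -/
lemma XRelations.powSeries_powSeries (h : XRelations P t x) (hx : ∀ u, x u ∈ 𝓕.F 1) (i : ι) (u : H)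
    (f g : PowerSeries ℂ) :
    𝓕.powSeries f (adEnd (x u)) (𝓕.powSeries g (adEnd (halfX P x i)) (t i)) =
      𝓕.powSeries (PowerSeries.rescale (P.root' i u) f * g) (adEnd (halfX P x i)) (t i) := by
  have hD := raises_adEnd (halfX_mem (P := P) hx i)
  have hpow : ∀ n : ℕ, (adEnd (x u) ^ n) (𝓕.powSeries g (adEnd (halfX P x i)) (t i)) =
      P.root' i u ^ n • (adEnd (halfX P x i) ^ n) (𝓕.powSeries g (adEnd (halfX P x i)) (t i)) := by
    intro n
    induction n with
    | zero => simp
    | succ n ih =>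
      rw [pow_succ', Module.End.mul_apply, ih, map_smul, ← Module.End.mul_apply,
        ((h.commute_halfX i u).pow_right n).eq, Module.End.mul_apply, h.apply_powSeries hx, map_smul,
        smul_smul, ← Module.End.mul_apply, ← pow_succ, ← pow_succ]
  rw [hD.powSeries_mul]
  simp only [powSeries] at hpow ⊢
  simp only [hpow, PowerSeries.coeff_rescale, smul_smul, mul_comm]

lemma XRelations.multiplier_add (h : XRelations P t x) (hx : ∀ u, x u ∈ 𝓕.F 1) (m m' : H) :
    multiplier 𝓕 x (m + m') = multiplier 𝓕 x m * multiplier 𝓕 x m' := by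
  rw [multiplier, map_add, smul_add, exp_add (Submodule.smul_mem _ _ (hx m))
    (Submodule.smul_mem _ _ (hx m'))]
  · rfl
  · have := h.xx m m'
    rw [adEnd_apply, sub_eq_zero] at this
    exact (show Commute (x m) (x m') from this).smul_left _ |>.smul_right _

lemma multiplier_mul_mul (hx : ∀ u, x u ∈ 𝓕.F 1) (m : H) (a : A) :
    multiplier 𝓕 x m * a * multiplier 𝓕 x (-m) =
      𝓕.powSeries (PowerSeries.exp ℂ) (adEnd (x ((-(2 * Real.pi * Complex.I) : ℂ) • m))) a := by
  rw [multiplier, multiplier, map_neg, smul_neg,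
    exp_mul_mul_exp_neg (Submodule.smul_mem _ _ (hx m)), map_smul, map_smul, map_smul]

variable [Fintype ι] {b : P.Base}

/-- Conjugation is exp(ad x(m')). It multiplies the k-terms by the exponentials of
`kSeries_add_lattice'`, and on y(u) it adds (exp - 1)/ad x(m') of [x(m'), y(u)], which by (yx) is
the inhomogeneous term there. -/
lemma kzbForm_add_lattice (hx : ∀ u, x u ∈ 𝓕.F 1) (h : XRelations P t x)
    (hyx : YXRelation P b t x y) {τ : ℍ} {z n m : H} (hz : z ∈ regularSet P τ)
    (hn : n ∈ coweightLattice P) (hm : m ∈ coweightLattice P) (u : H) :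
    kzbForm P b τ 𝓕 t x y (z + n + (τ : ℂ) • m) u =
      multiplier 𝓕 x m * kzbForm P b τ 𝓕 t x y z u * multiplier 𝓕 x (-m) := by
  rw [multiplier_mul_mul hx]
  set m' := (-(2 * Real.pi * Complex.I) : ℂ) • m with hm'
  have hD := raises_adEnd (hx m')
  change _ = hD.powSeriesLinear (PowerSeries.exp ℂ) _
  rw [kzbForm_eq, kzbForm_eq, map_add, map_neg, map_sum]
  have hy : hD.powSeriesLinear (PowerSeries.exp ℂ) (y u) = y u -
      ∑ i ∈ posRoots b, P.root' i u •
        𝓕.powSeries (expQuot (P.root' i m')) (adEnd (halfX P x i)) (t i) := by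
    change 𝓕.powSeries _ _ _ = _
    rw [hD.powSeries_exp, adEnd_swap, hyx]
    change _ + hD.powSeriesLinear (expQuot 1) _ = _
    rw [map_neg, map_sum, ← sub_eq_add_neg]
    congr 1
    refine Finset.sum_congr rfl fun i _ => ?_
    rw [map_smul]
    change _ • 𝓕.powSeries _ _ _ = _
    have e1 := h.powSeries_powSeries hx i m' (expQuot 1) 1
    rw [powSeries_one, mul_one] at e1
    have e2 := C_mul_rescale_expQuot (P.root' i m') 1
    rw [mul_one] at e2
    rw [e1, ← e2, (raises_adEnd (halfX_mem hx i)).powSeries_C_mul, smul_smul,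
      mul_comm]
  have e0 : ∀ p q r : A, -p + (q - r) = -(p + r) + q := fun p q r => by abel
  rw [hy, e0, ← Finset.sum_add_distrib]
  congr 2
  refine Finset.sum_congr rfl fun i _ => ?_
  rw [map_smul, ← smul_add]
  congr 1
  obtain ⟨k, hk⟩ := hn i
  obtain ⟨l, hl⟩ := hm i
  have e2 : P.root' i (z + n + (τ : ℂ) • m) = P.root' i z + (k + l * τ) := by
    rw [map_add, map_add, map_smul, hk, hl, smul_eq_mul]; ring
  have e3 : P.root' i m' = -(2 * Real.pi * Complex.I) * l := by rw [hm', map_smul, hl, smul_eq_mul]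
  change _ = 𝓕.powSeries _ _ _ + _
  rw [e2, kAd_eq_powSeries, kSeries_add_lattice' (mem_regularSet_iff.mp hz i),
    (raises_adEnd (halfX_mem hx i)).powSeries_add, kAd_eq_powSeries, h.powSeries_powSeries hx, e3]

end Descends

variable {ι Hd H A : Type*} [Fintype ι] [AddCommGroup Hd] [Module ℂ Hd] [AddCommGroup H]
  [Module ℂ H] [Ring A] [Algebra ℂ A] {P : RootPairing ι ℂ Hd H} {b : P.Base} {t : ι → A}
  {x y : H →ₗ[ℂ] A} {𝓕 : CompleteFiltration A}

/-- The relations, split up. -/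
lemma relations_iff :
    Relations P b t x y ↔ TTRelation P b t ∧ XRelations P t x ∧ YXRelation P b t x y ∧
      TYRelation P t y ∧ ∀ u v, adEnd (y u) (y v) = 0 := by
  constructor
  · intro h
    refine ⟨fun Ψ hΨ i hi => ?_, ⟨fun u v => ?_, fun i u hu => ?_⟩, fun u v => ?_, fun i u hu => ?_,
      fun u v => ?_⟩
    · rw [← map_sum, ← lie_eq_adEnd]; exact h.tt Ψ hΨ i hi
    · rw [← lie_eq_adEnd]; exact h.xx u v
    · rw [adEnd_swap, ← lie_eq_adEnd, h.tx i u hu, neg_zero]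
    · rw [← lie_eq_adEnd]; exact h.yx u v
    · rw [adEnd_swap, ← lie_eq_adEnd, h.ty i u hu, neg_zero]
    · rw [← lie_eq_adEnd]; exact h.yy u v
  · rintro ⟨htt, h, hyx, hty, hyy⟩
    refine ⟨fun Ψ hΨ i hi => ?_, fun u v => ?_, fun u v => ?_, fun u v => ?_, fun i u hu => ?_,
      fun i u hu => ?_⟩
    · rw [lie_eq_adEnd, map_sum]; exact htt Ψ hΨ i hi
    · rw [lie_eq_adEnd]; exact h.xx u v
    · rw [lie_eq_adEnd]; exact hyy u v
    · rw [lie_eq_adEnd]; exact hyx u v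
    · rw [lie_eq_adEnd, adEnd_swap, h.tx i u hu, neg_zero]
    · rw [lie_eq_adEnd, adEnd_swap, hty i u hu, neg_zero]

/-- The connection is flat if the relations hold. -/
theorem isFlatConnection_of_relations [P.IsRootSystem] [P.IsCrystallographic] [P.IsReduced] (τ : ℍ)
    (hx : ∀ u, x u ∈ 𝓕.F 1) (h : Relations P b t x y) : IsFlatConnection P b τ 𝓕 t x y := by
  obtain ⟨htt, h, hyx, hty, hyy⟩ := relations_iff.mp h
  refine ⟨fun m _ m' _ => h.multiplier_add hx m m',
    fun z hz n hn m hm u => kzbForm_add_lattice hx h hyx hz hn hm u, ?_⟩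
  rw [zeroCurvatureOn_iff hx]
  intro z hz u v
  rw [adEnd_kzbForm hx h hyx htt hty hz, hyy]

end KZB

end

noncomputable section

namespace KZB

open CompleteFiltration

/-! ### Consequences of invariance under lattice translations -/

section Lattice

variable {A : Type*} [Ring A] [Algebra ℂ A] {𝓕 : CompleteFiltration A}

lemma CompleteFiltration.exp_zero : 𝓕.exp (0 : A) = 1 := by
  refine HasSeries.series_eq fun n => ⟨1, fun i hi => ?_⟩
  obtain ⟨j, rfl⟩ : ∃ j, i = j + 1 := ⟨i - 1, by lia⟩
  simp [Finset.sum_range_succ']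

/-- The conjugate is exp(N ad a)(e), a power series in N whose linear coefficient is [a, e]. -/
lemma CompleteFiltration.adEnd_eq_zero_of_exp {a e : A} (ha : a ∈ 𝓕.F 1)
    (h : ∀ N : ℕ, 𝓕.exp ((N : ℂ) • a) * e * 𝓕.exp (-((N : ℂ) • a)) = e) : adEnd a e = 0 := by
  have hD := raises_adEnd ha
  have h1 := eq_zero_of_forall_hasSeries_pow (𝓕 := 𝓕)
    (f := fun n => PowerSeries.coeff n (PowerSeries.exp ℂ - 1) • (adEnd a ^ n) e) (fun N _ => ?_) 1
  · simpa [PowerSeries.coeff_exp, PowerSeries.coeff_one] using h1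
  · have h2 := h N
    rw [exp_mul_mul_exp_neg (Submodule.smul_mem _ _ ha), map_smul, powSeries_smul_end] at h2
    have h3 : PowerSeries.rescale (N : ℂ) (PowerSeries.exp ℂ) =
        PowerSeries.rescale (N : ℂ) (PowerSeries.exp ℂ - 1) + 1 := by simp
    rw [h3, hD.powSeries_add, powSeries_one, add_eq_right] at h2
    have h4 := hD.hasSeries_powSeries (PowerSeries.rescale (N : ℂ) (PowerSeries.exp ℂ - 1)) e
    rw [h2] at h4
    simpa only [PowerSeries.coeff_rescale, mul_smul] using h4

variable {ι Hd H : Type*} [AddCommGroup Hd] [Module ℂ Hd] [AddCommGroup H]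
  [Module ℂ H] {P : RootPairing ι ℂ Hd H} {x : H →ₗ[ℂ] A}

lemma multiplier_zero : multiplier 𝓕 x 0 = 1 := by
  rw [multiplier, map_zero, smul_zero, exp_zero]

lemma multiplier_natCast_smul (N : ℕ) (m : H) :
    multiplier 𝓕 x ((N : ℂ) • m) = 𝓕.exp ((N : ℂ) • (-(2 * Real.pi * Complex.I) : ℂ) • x m) := by
  rw [multiplier, map_smul, smul_comm]

lemma multiplier_neg_natCast_smul (N : ℕ) (m : H) :
    multiplier 𝓕 x (-((N : ℂ) • m)) =
      𝓕.exp (-((N : ℂ) • (-(2 * Real.pi * Complex.I) : ℂ) • x m)) := by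
  rw [multiplier, map_neg, map_smul, smul_neg, smul_comm]

/-- Multiplicativity makes the multipliers commute. Passing to multiples Nm linearizes one
multiplier and then the other, and the coweights span 𝔥. -/
lemma adEnd_x_x_eq_zero [P.IsRootSystem] [P.IsCrystallographic] (hx : ∀ u, x u ∈ 𝓕.F 1)
    (h : ∀ m ∈ coweightLattice P, ∀ m' ∈ coweightLattice P,
      multiplier 𝓕 x (m + m') = multiplier 𝓕 x m * multiplier 𝓕 x m') (u v : H) :
    adEnd (x u) (x v) = 0 := by
  have hc : (-(2 * Real.pi * Complex.I) : ℂ) ≠ 0 := by simp [Real.pi_ne_zero]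
  have h1 : ∀ m ∈ coweightLattice P, ∀ m' ∈ coweightLattice P,
      adEnd (x m) (multiplier 𝓕 x m') = 0 := by
    intro m hm m' hm'
    have h2 := adEnd_eq_zero_of_exp (𝓕 := 𝓕) (e := multiplier 𝓕 x m')
      (Submodule.smul_mem _ (-(2 * Real.pi * Complex.I) : ℂ) (hx m)) fun N => ?_
    · rw [map_smul, LinearMap.smul_apply] at h2
      exact (smul_eq_zero.mp h2).resolve_left hc
    · have hN := natCast_smul_mem_coweightLattice hm N
      rw [← multiplier_natCast_smul, ← multiplier_neg_natCast_smul, ← h _ hN _ hm', add_comm,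
        h _ hm' _ hN, mul_assoc, ← h _ hN _ (neg_mem hN), add_neg_cancel, multiplier_zero, mul_one]
  have h3 : ∀ m ∈ coweightLattice P, ∀ m' ∈ coweightLattice P, adEnd (x m) (x m') = 0 := by
    intro m hm m' hm'
    have h2 := adEnd_eq_zero_of_exp (𝓕 := 𝓕) (e := x m)
      (Submodule.smul_mem _ (-(2 * Real.pi * Complex.I) : ℂ) (hx m')) fun N => ?_
    · rw [map_smul, LinearMap.smul_apply] at h2
      rw [adEnd_swap, (smul_eq_zero.mp h2).resolve_left hc, neg_zero]
    · have hN := natCast_smul_mem_coweightLattice hm' N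
      have h4 := h1 m hm _ hN
      rw [adEnd_apply, sub_eq_zero] at h4
      rw [← multiplier_natCast_smul, ← multiplier_neg_natCast_smul, ← h4, mul_assoc,
        ← h _ hN _ (neg_mem hN), add_neg_cancel, multiplier_zero, mul_one]
  have h5 : ∀ m ∈ coweightLattice P, adEnd (x m) (x v) = 0 := fun m hm =>
    forall_of_forall_coweight (P := P) (f := adEnd (x m) ∘ₗ x) (g := 0) (fun m' hm' => h3 m hm m' hm') v
  exact forall_of_forall_coweight (P := P) (f := adEnd.flip (x v) ∘ₗ x) (g := 0) h5 u

variable [Fintype ι] {b : P.Base} {t : ι → A} {y : H →ₗ[ℂ] A}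

/-- The infinitesimal form of the invariance of the connection form under lattice translations. -/
lemma adEnd_x_kzbForm [P.IsRootSystem] [P.IsCrystallographic] (hx : ∀ u, x u ∈ 𝓕.F 1) {τ : ℍ} {z : H}
    (hz : z ∈ regularSet P τ) (u : H)
    (h : ∀ m ∈ coweightLattice P, kzbForm P b τ 𝓕 t x y (z + (τ : ℂ) • m) u =
      multiplier 𝓕 x m * kzbForm P b τ 𝓕 t x y z u * multiplier 𝓕 x (-m)) (v : H) :
    adEnd (x v) (kzbForm P b τ 𝓕 t x y z u) = -∑ i ∈ posRoots b, P.root' i v • P.root' i u •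
      (adEnd (halfX P x i) (kAd 𝓕 τ (P.root' i z) (halfX P x i) (t i)) + t i) := by
  set c : ℂ := -(2 * Real.pi * Complex.I) with hc
  have hc0 : c ≠ 0 := by simp [hc, Real.pi_ne_zero]
  set ω := kzbForm P b τ 𝓕 t x y z u with hω
  set B : ι → A := fun i => adEnd (halfX P x i) (kAd 𝓕 τ (P.root' i z) (halfX P x i) (t i)) + t i with hB
  have hD := fun i => raises_adEnd (halfX_mem (P := P) hx i)
  suffices hs : ∀ m ∈ coweightLattice P, adEnd (x m) ω = -∑ i ∈ posRoots b, P.root' i m • P.root' i u • B i by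
    have := forall_of_forall_coweight (P := P) (f := adEnd.flip ω ∘ₗ x)
      (g := -∑ i ∈ posRoots b, (P.root' i).smulRight (P.root' i u • B i))
      (fun m hm => by simpa [-smul_add] using hs m hm) v
    simpa [-smul_add] using this
  intro m hm
  have hDm := raises_adEnd (hx m)
  -- Invariance under translation by τNm, after subtracting the value at z and dividing by N ≠ 0, is
  -- the vanishing of a power series in N. Its constant term is the infinitesimal statement.
  have key := eq_zero_of_forall_hasSeries_pow (𝓕 := 𝓕)
    (f := fun n => PowerSeries.coeff n (expQuot c) • (adEnd (x m) ^ n) (adEnd (x m) ω) +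
      ∑ i ∈ posRoots b, P.root' i u • PowerSeries.coeff n (expQuot (c * P.root' i m)) •
        (adEnd (halfX P x i) ^ n) (B i)) (fun N hN => ?_) 0
  · have e : ∀ d : ℂ, PowerSeries.coeff 0 (expQuot d) = d := fun d => by
      rw [expQuot, PowerSeries.coeff_mk]; simp
    simp only [e, pow_zero, Module.End.one_apply] at key
    have e2 : c • (adEnd (x m) ω + ∑ i ∈ posRoots b, P.root' i m • P.root' i u • B i) = 0 := by
      rw [← key, smul_add, Finset.smul_sum]
      congr 1
      refine Finset.sum_congr rfl fun i _ => ?_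
      simp only [smul_smul]
      congr 1
      ring
    exact eq_neg_of_add_eq_zero_left ((smul_eq_zero.mp e2).resolve_left hc0)
  · have hN0 : (N : ℂ) ≠ 0 := Nat.cast_ne_zero.mpr hN
    have e1 : kzbForm P b τ 𝓕 t x y (z + (τ : ℂ) • (N : ℂ) • m) u = (N : ℂ) •
        𝓕.powSeries (PowerSeries.rescale (N : ℂ) (expQuot c)) (adEnd (x m)) (adEnd (x m) ω) + ω := by
      have e0 : c • (N : ℂ) • m = ((N : ℂ) * c) • m := by rw [smul_smul, mul_comm]
      have e0' : PowerSeries.rescale ((N : ℂ) * c) (PowerSeries.exp ℂ) = PowerSeries.C (N : ℂ) *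
          (PowerSeries.X * PowerSeries.rescale (N : ℂ) (expQuot c)) + 1 := by
        rw [mul_left_comm, C_mul_rescale_expQuot, X_mul_expQuot, sub_add_cancel]
      rw [h _ (natCast_smul_mem_coweightLattice hm N), multiplier_mul_mul hx, e0, map_smul, map_smul,
        powSeries_smul_end, e0', hDm.powSeries_add, hDm.powSeries_C_mul, hDm.powSeries_X_mul,
        powSeries_one, hDm.powSeries_apply_comm]
    have e2 : ∀ i, kAd 𝓕 τ (P.root' i (z + (τ : ℂ) • (N : ℂ) • m)) (halfX P x i) (t i) = (N : ℂ) •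
        𝓕.powSeries (PowerSeries.rescale (N : ℂ) (expQuot (c * P.root' i m))) (adEnd (halfX P x i))
          (B i) + kAd 𝓕 τ (P.root' i z) (halfX P x i) (t i) := by
      intro i
      obtain ⟨l, hl⟩ := hm i
      have f1 : P.root' i (z + (τ : ℂ) • (N : ℂ) • m) =
          P.root' i z + (((0 : ℤ) : ℂ) + ((N * l : ℤ) : ℂ) * τ) := by
        rw [map_add, map_smul, map_smul, hl, smul_eq_mul, smul_eq_mul]; push_cast; ring
      have f2 : -(2 * Real.pi * Complex.I) * ((N * l : ℤ) : ℂ) = (N : ℂ) * (c * l) := by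
        rw [hc]; push_cast; ring
      have f3 : B i = 𝓕.powSeries (PowerSeries.X * kSeries τ (P.root' i z) + 1)
          (adEnd (halfX P x i)) (t i) := by
        rw [(hD i).powSeries_add, (hD i).powSeries_X_mul, powSeries_one, ← kAd_eq_powSeries]
      rw [f1, kAd_eq_powSeries, kSeries_add_lattice' (mem_regularSet_iff.mp hz i), f2, hl, f3,
        ← (hD i).powSeries_mul, ← (hD i).powSeries_C_mul, kAd_eq_powSeries, ← (hD i).powSeries_add]
      congr 1
      have f4 := X_mul_expQuot ((N : ℂ) * (c * l))
      have f5 := C_mul_rescale_expQuot (N : ℂ) (c * l)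
      linear_combination (-kSeries τ (P.root' i z)) * f4 -
        (PowerSeries.X * kSeries τ (P.root' i z) + 1) * f5
    have h2 : (N : ℂ) • (𝓕.powSeries (PowerSeries.rescale (N : ℂ) (expQuot c)) (adEnd (x m))
        (adEnd (x m) ω) + ∑ i ∈ posRoots b, P.root' i u • 𝓕.powSeries (PowerSeries.rescale (N : ℂ)
          (expQuot (c * P.root' i m))) (adEnd (halfX P x i)) (B i)) = 0 := by
      rw [kzbForm_eq] at e1
      simp only [e2, smul_add, Finset.sum_add_distrib] at e1
      rw [neg_add, add_assoc, ← kzbForm_eq, ← hω, add_left_inj, neg_eq_iff_eq_neg] at e1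
      simp only [smul_comm _ (N : ℂ)] at e1
      rw [smul_add, Finset.smul_sum, e1, add_neg_cancel]
    have h3 := (hDm.hasSeries_powSeries (PowerSeries.rescale (N : ℂ) (expQuot c)) (adEnd (x m) ω)).add
      (hasSeries_finsetSum (posRoots b) fun i _ => ((hD i).hasSeries_powSeries (PowerSeries.rescale
        (N : ℂ) (expQuot (c * P.root' i m))) (B i)).smul (P.root' i u))
    rw [(smul_eq_zero.mp h2).resolve_left hN0] at h3
    convert h3 using 2 with n
    simp only [PowerSeries.coeff_rescale, smul_add, Finset.smul_sum, smul_smul]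
    congr 1
    refine Finset.sum_congr rfl fun i _ => ?_
    congr 1
    ring

end Lattice

end KZB

end

noncomputable section

namespace KZB

open CompleteFiltration

/-! ### Residues of the connection form -/

section Residues

open scoped Classical

lemma eventually_theta_add_mul_ne_zero {τ : ℍ} {a c : ℂ} (h : theta τ a ≠ 0 ∨ c ≠ 0) :
    ∀ᶠ s in 𝓝[≠] (0 : ℂ), theta τ (a + c * s) ≠ 0 := by
  have hd : Differentiable ℂ fun s : ℂ => theta τ (a + c * s) := by
    have := differentiable_theta τ
    fun_prop
  refine (hd.analyticAt 0).eventually_eq_zero_or_eventually_ne_zero.resolve_left fun h0 => ?_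
  have h1 : (fun s : ℂ => theta τ (a + c * s)) = 0 :=
    AnalyticOnNhd.eq_of_eventuallyEq (fun s _ => hd.analyticAt s) (fun s _ => analyticAt_const) h0
  rcases h with h | h
  · exact h (by simpa using congrFun h1 0)
  · refine not_countable_complex ((IsPlaneConfig.countable_theta_eq_zero τ).mono fun z _ => ?_)
    have := congrFun h1 ((z - a) / c)
    simpa [mul_div_cancel₀ _ h] using this

variable {ι Hd H A : Type*} [AddCommGroup Hd] [Module ℂ Hd] [AddCommGroup H]
  [Module ℂ H] [Ring A] [Algebra ℂ A] {𝓕 : CompleteFiltration A} {P : RootPairing ι ℂ Hd H}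
  {t : ι → A} {x y : H →ₗ[ℂ] A} {b : P.Base}

lemma root'_add_smul (i : ι) (z w : H) (s : ℂ) :
    P.root' i (z + s • w) = P.root' i z + P.root' i w * s := by
  rw [map_add, map_smul, smul_eq_mul, mul_comm]

lemma mem_regularSet_of_isPos {τ : ℍ} {z : H} (h : ∀ i, b.IsPos i → theta τ (P.root' i z) ≠ 0) :
    z ∈ regularSet P τ := by
  refine mem_regularSet_iff.mpr fun i => ?_
  by_cases hi : b.IsPos i
  · exact h i hi
  · have := h _ (isPos_neg hi)
    rwa [root'_neg, theta_neg, neg_ne_zero] at this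

lemma eventually_mem_regularSet [Finite ι] (b : P.Base) {τ : ℍ} {z w : H}
    (h : ∀ i, b.IsPos i → theta τ (P.root' i z) ≠ 0 ∨ P.root' i w ≠ 0) :
    ∀ᶠ s in 𝓝[≠] (0 : ℂ), z + s • w ∈ regularSet P τ := by
  have h1 : ∀ᶠ s in 𝓝[≠] (0 : ℂ), ∀ i, b.IsPos i → theta τ (P.root' i (z + s • w)) ≠ 0 := by
    rw [Filter.eventually_all]
    intro i
    by_cases hi : b.IsPos i
    · filter_upwards [eventually_theta_add_mul_ne_zero (h i hi)] with s hs _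
      rwa [root'_add_smul]
    · exact Filter.Eventually.of_forall fun s h => absurd h hi
  filter_upwards [h1] with s hs using mem_regularSet_of_isPos hs

/-- The residue of a term of the connection form. -/
lemma hasLim_smul_kAd_root' (hx : ∀ u, x u ∈ 𝓕.F 1) {τ : ℍ} {i : ι} {z w : H}
    (h : theta τ (P.root' i z) ≠ 0 ∨ (∃ n : ℤ, P.root' i z = n) ∧ P.root' i w ≠ 0) :
    𝓕.HasLim (𝓝[≠] (0 : ℂ)) (fun s => s • kAd 𝓕 τ (P.root' i (z + s • w)) (halfX P x i) (t i))
      (if theta τ (P.root' i z) = 0 then (P.root' i w)⁻¹ • t i else 0) := by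
  simp only [root'_add_smul]
  split_ifs with h0
  · obtain ⟨⟨n, hn⟩, hw⟩ := h.resolve_left (not_not.mpr h0)
    rw [hn]
    exact hasLim_smul_kAd (halfX_mem hx i) (t i) τ n hw
  · have h1 := hasLim_kAd (halfX_mem (P := P) hx i) (t i) h0 (P.root' i w)
    have h2 := HasLim.smul (c := fun s : ℂ => s) (γ := 0)
      (Filter.tendsto_id.mono_left nhdsWithin_le_nhds) h1
    rwa [zero_smul] at h2

variable [Fintype ι]

/-- The residue of the connection form. -/
lemma hasLim_smul_kzbForm (hx : ∀ u, x u ∈ 𝓕.F 1) {τ : ℍ} {z w : H}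
    (h : ∀ i, b.IsPos i → theta τ (P.root' i z) ≠ 0 ∨ (∃ n : ℤ, P.root' i z = n) ∧ P.root' i w ≠ 0)
    (u : H) : 𝓕.HasLim (𝓝[≠] (0 : ℂ)) (fun s => s • kzbForm P b τ 𝓕 t x y (z + s • w) u)
      (-∑ i ∈ posRoots b with theta τ (P.root' i z) = 0, (P.root' i u * (P.root' i w)⁻¹) • t i) := by
  have h1 := (HasLim.sum (posRoots b) fun i hi => HasLim.smul (c := fun _ => P.root' i u)
    tendsto_const_nhds (hasLim_smul_kAd_root' (t := t) hx (h i (mem_posRoots.mp hi)))).neg.add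
    (HasLim.smul (c := fun s : ℂ => s) (γ := 0)
      (Filter.tendsto_id.mono_left nhdsWithin_le_nhds) (HasLim.const (𝓕 := 𝓕) (y u)))
  rw [zero_smul, add_zero] at h1
  rw [Finset.sum_filter]
  convert h1 using 2 with s
  · rw [kzbForm_eq, smul_add, smul_neg, Finset.smul_sum]
    simp only [smul_comm s]
  · refine Finset.sum_congr rfl fun i _ => ?_
    split_ifs <;> simp [smul_smul]

/-- The value of the connection form on a tangent vector to a wall, near that wall. -/
lemma hasLim_kzbForm (hx : ∀ u, x u ∈ 𝓕.F 1) {τ : ℍ} {i : ι} {z w v : H}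
    (h : ∀ j ∈ (posRoots b).erase i, theta τ (P.root' j z) ≠ 0) (hv : P.root' i v = 0) :
    𝓕.HasLim (𝓝[≠] (0 : ℂ)) (fun s => kzbForm P b τ 𝓕 t x y (z + s • w) v)
      (-∑ j ∈ (posRoots b).erase i,
        P.root' j v • kAd 𝓕 τ (P.root' j z) (halfX P x j) (t j) + y v) := by
  have h1 := (HasLim.sum ((posRoots b).erase i) fun j hj => HasLim.smul (c := fun _ => P.root' j v)
    tendsto_const_nhds (hasLim_kAd (halfX_mem (P := P) hx j) (t j) (h j hj) (P.root' j w))).neg.add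
    (HasLim.const (𝓕 := 𝓕) (y v))
  convert h1 using 2 with s
  rw [kzbForm_eq, ← Finset.sum_erase (posRoots b) (a := i) (by rw [hv, zero_smul])]
  simp only [root'_add_smul]

end Residues

/-! ### Relations from flatness -/

section Flat

open scoped Classical

variable {ι Hd H A : Type*} [Fintype ι] [AddCommGroup Hd] [Module ℂ Hd] [AddCommGroup H]
  [Module ℂ H] [Ring A] [Algebra ℂ A] {𝓕 : CompleteFiltration A} {P : RootPairing ι ℂ Hd H}
  {t : ι → A} {x y : H →ₗ[ℂ] A} {b : P.Base}

lemma exists_generic_on_wall [P.IsReduced] (τ : ℍ) {i : ι} (hi : b.IsPos i) :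
    ∃ z : H, P.root' i z = 0 ∧ ∀ j ∈ (posRoots b).erase i, theta τ (P.root' j z) ≠ 0 := by
  obtain ⟨z, hz, h⟩ := exists_mem_forall_theta_ne_zero τ (LinearMap.ker (P.root' i))
    ((posRoots b).erase i) P.root' (fun j hj => ⟨orthoCoweight P i j, root'_orthoCoweight_left i j,
      root'_orthoCoweight_ne_zero hi (mem_posRoots.mp (Finset.mem_of_mem_erase hj))
        (Finset.ne_of_mem_erase hj).symm⟩) 0
  exact ⟨z, hz, fun j hj => by simpa using h j hj⟩

lemma exists_mem_regularSet (P : RootPairing ι ℂ Hd H) (τ : ℍ) : ∃ z, z ∈ regularSet P τ := by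
  obtain ⟨z, -, h⟩ := exists_mem_forall_theta_ne_zero τ (⊤ : Submodule ℂ H) Finset.univ P.root'
    (fun j _ => ⟨P.coroot j, trivial, by rw [root'_coroot_self]; norm_num⟩) 0
  exact ⟨z, mem_regularSet_iff.mpr fun j => by simpa using h j (Finset.mem_univ j)⟩

lemma filter_theta_eq_singleton {τ : ℍ} {i : ι} (hi : b.IsPos i) {z : H} (hz : P.root' i z = 0)
    (h : ∀ j ∈ (posRoots b).erase i, theta τ (P.root' j z) ≠ 0) :
    (posRoots b).filter (fun j => theta τ (P.root' j z) = 0) = {i} := by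
  ext j
  rw [Finset.mem_filter, Finset.mem_singleton]
  refine ⟨fun ⟨hj, h0⟩ => by_contra fun hji => h j (Finset.mem_erase.mpr ⟨hji, hj⟩) h0, ?_⟩
  rintro rfl
  exact ⟨mem_posRoots.mpr hi, by rw [hz, theta_eq_zero_iff]; exact ⟨0, 0, by simp⟩⟩

lemma theta_ne_zero_or {τ : ℍ} {i : ι} {z : H} (hz : P.root' i z = 0)
    (h : ∀ j ∈ (posRoots b).erase i, theta τ (P.root' j z) ≠ 0) {w : H} (hw : P.root' i w = 1) (j : ι)
    (hj : b.IsPos j) :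
    theta τ (P.root' j z) ≠ 0 ∨ (∃ n : ℤ, P.root' j z = n) ∧ P.root' j w ≠ 0 := by
  by_cases hji : j = i
  · subst hji
    exact Or.inr ⟨⟨0, by simpa using hz⟩, by rw [hw]; exact one_ne_zero⟩
  · exact Or.inl (h j (Finset.mem_erase.mpr ⟨hji, mem_posRoots.mpr hj⟩))

/-- The residue, along a wall, of the infinitesimal invariance of the connection form. -/
lemma adEnd_x_t_of_lattice [P.IsReduced] (hx : ∀ u, x u ∈ 𝓕.F 1) {τ : ℍ}
    (h : ∀ z ∈ regularSet P τ, ∀ u v : H, adEnd (x v) (kzbForm P b τ 𝓕 t x y z u) =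
      -∑ i ∈ posRoots b, P.root' i v • P.root' i u •
        (adEnd (halfX P x i) (kAd 𝓕 τ (P.root' i z) (halfX P x i) (t i)) + t i))
    {i : ι} (hi : b.IsPos i) (v : H) :
    adEnd (x v) (t i) = P.root' i v • adEnd (halfX P x i) (t i) := by
  obtain ⟨z, hz, hz'⟩ := exists_generic_on_wall τ hi
  obtain ⟨w, hw1⟩ : ∃ w, P.root' i w = 1 := ⟨_, root'_half_coroot P i⟩
  have hor := theta_ne_zero_or (b := b) hz hz' hw1
  have hfil := filter_theta_eq_singleton hi hz hz'
  have h1 := (hasLim_smul_kzbForm (t := t) (y := y) hx hor w).map (continuous_adEnd (x v))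
  have h2 := (HasLim.sum (posRoots b) fun j hj =>
    HasLim.smul (c := fun _ => P.root' j v * P.root' j w) tendsto_const_nhds
      (((hasLim_smul_kAd_root' (t := t) hx (hor j (mem_posRoots.mp hj))).map
        (continuous_adEnd (halfX P x j))).add (HasLim.smul (c := fun s : ℂ => s) (γ := 0)
      (Filter.tendsto_id.mono_left nhdsWithin_le_nhds) (HasLim.const (𝓕 := 𝓕) (t j))))).neg
  have h3 := h1.unique (h2.congr' ?_)
  · rw [hfil, Finset.sum_singleton, hw1] at h3
    simp only [zero_smul, add_zero] at h3
    have h4 : ∀ j, (P.root' j v * P.root' j w) • adEnd (halfX P x j)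
        (if theta τ (P.root' j z) = 0 then (P.root' j w)⁻¹ • t j else 0) =
        if theta τ (P.root' j z) = 0 then (P.root' j v * P.root' j w) • adEnd (halfX P x j)
          ((P.root' j w)⁻¹ • t j) else 0 := fun j => by split_ifs <;> simp
    simp only [h4] at h3
    rw [← Finset.sum_filter, hfil, Finset.sum_singleton, hw1] at h3
    simpa using h3
  · filter_upwards [eventually_mem_regularSet b fun j hj => (hor j hj).imp_right And.right] with s hs
    rw [map_smul, h _ hs, smul_neg, Finset.smul_sum]
    congr 1
    refine Finset.sum_congr rfl fun j _ => ?_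
    rw [(adEnd (halfX P x j)).map_smul s, ← smul_add, smul_smul, smul_smul, smul_smul]
    congr 1
    ring

/-- The wall residues give (tx) for positive roots, and t_{-α} = t_α extends it. Then the k-terms on
both sides of the infinitesimal identity coincide, and what is left is (yx). -/
lemma xRelations_of_isFlatConnection [P.IsRootSystem] [P.IsCrystallographic] [P.IsReduced]
    (ht : ∀ i j, P.root j = -P.root i → t j = t i) (hx : ∀ u, x u ∈ 𝓕.F 1) {τ : ℍ}
    (h : IsFlatConnection P b τ 𝓕 t x y) : XRelations P t x ∧ YXRelation P b t x y := by
  have h1 : ∀ z ∈ regularSet P τ, ∀ u v : H, adEnd (x v) (kzbForm P b τ 𝓕 t x y z u) =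
      -∑ i ∈ posRoots b, P.root' i v • P.root' i u •
        (adEnd (halfX P x i) (kAd 𝓕 τ (P.root' i z) (halfX P x i) (t i)) + t i) :=
    fun z hz u v => adEnd_x_kzbForm hx hz u (fun m hm => by
      simpa using h.descends z hz 0 (zero_mem _) m hm u) v
  have hpos : ∀ i, b.IsPos i → ∀ u, P.root' i u = 0 → adEnd (x u) (t i) = 0 := fun i hi u hu => by
    rw [adEnd_x_t_of_lattice hx h1 hi, hu, zero_smul]
  have hX : XRelations P t x := by
    refine ⟨adEnd_x_x_eq_zero hx h.bundle, fun i u hu => ?_⟩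
    by_cases hi : b.IsPos i
    · exact hpos i hi u hu
    · rw [← ht _ _ (root_neg i)]
      exact hpos _ (isPos_neg hi) u (by rw [root'_neg, hu, neg_zero])
  refine ⟨hX, fun u v => ?_⟩
  obtain ⟨z, hz⟩ := exists_mem_regularSet P τ
  have h2 := h1 z hz u v
  rw [kzbForm_eq, map_add, map_neg, map_sum] at h2
  simp only [smul_add, Finset.sum_add_distrib, neg_add] at h2
  have h3 : ∀ i, adEnd (x v) (P.root' i u • kAd 𝓕 τ (P.root' i z) (halfX P x i) (t i)) =
      P.root' i v • P.root' i u • adEnd (halfX P x i) (kAd 𝓕 τ (P.root' i z) (halfX P x i) (t i)) := by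
    intro i
    rw [map_smul, kAd_eq_powSeries, hX.apply_powSeries hx, smul_comm]
  simp only [h3] at h2
  rw [adEnd_swap, add_left_cancel h2, neg_neg]
  simp only [smul_smul]

/-- The residue of the curvature along a wall. -/
lemma adEnd_t_wall_eq_zero (hx : ∀ u, x u ∈ 𝓕.F 1) {τ : ℍ}
    (h : ∀ z ∈ regularSet P τ, ∀ u v,
      adEnd (kzbForm P b τ 𝓕 t x y z u) (kzbForm P b τ 𝓕 t x y z v) = 0) {i : ι} (hi : b.IsPos i)
    {z v : H} (hz : P.root' i z = 0) (hz' : ∀ j ∈ (posRoots b).erase i, theta τ (P.root' j z) ≠ 0)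
    (hv : P.root' i v = 0) :
    adEnd (t i) (-∑ j ∈ (posRoots b).erase i,
        P.root' j v • kAd 𝓕 τ (P.root' j z) (halfX P x j) (t j) + y v) = 0 := by
  obtain ⟨w, hw1⟩ : ∃ w, P.root' i w = 1 := ⟨_, root'_half_coroot P i⟩
  have hor := theta_ne_zero_or (b := b) hz hz' hw1
  -- The form has a simple pole with residue -t_i on the transverse vector w, and none on v, which
  -- is tangent to the wall; the commutator is multiplied by s before the limit.
  have h1 := (hasLim_smul_kzbForm (t := t) (y := y) hx hor w).lie
    (hasLim_kzbForm (t := t) (y := y) (w := w) hx hz' hv)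
  rw [filter_theta_eq_singleton hi hz hz', Finset.sum_singleton, hw1, lie_eq_adEnd] at h1
  have h2 := h1.unique ((HasLim.const (𝓕 := 𝓕) 0).congr' ?_)
  · simpa only [inv_one, mul_one, one_smul, map_neg, LinearMap.neg_apply, neg_eq_zero] using h2
  · filter_upwards [eventually_mem_regularSet b fun j hj => (hor j hj).imp_right And.right] with s hs
    rw [lie_eq_adEnd, map_smul, LinearMap.smul_apply, h _ hs, smul_zero]

end Flat

end KZB

end

/-! ### The relation (tt) from residues at intersections of walls. -/

noncomputable section

namespace KZB

open CompleteFiltration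

section Flat

open scoped Classical

variable {ι Hd H A : Type*} [Fintype ι] [AddCommGroup Hd] [Module ℂ Hd] [AddCommGroup H]
  [Module ℂ H] {P : RootPairing ι ℂ Hd H} {b : P.Base}

lemma root'_orthoCoweight_ne_zero_of_mem_plane [P.IsReduced] {i j k : ι} (hi : b.IsPos i)
    (hj : b.IsPos j) (hij : i ≠ j) (hk : k ∈ plane b i j) (hik : i ≠ k) :
    P.root' k (orthoCoweight P i j) ≠ 0 := by
  obtain ⟨e₁, e₂, h₁, h₂, h₃, h₄⟩ := exists_dual_pair hi hj hij
  obtain ⟨hk, hk'⟩ := mem_plane.mp hk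
  obtain ⟨f₁, f₂, g₁, g₂, g₃, g₄⟩ := exists_dual_pair hi hk hik
  have h5 := hk'.root'_eq h₁ h₂ h₃ h₄ f₂
  have h6 := hk'.root'_eq h₁ h₂ h₃ h₄ (orthoCoweight P i j)
  rw [g₂, g₄, mul_zero, zero_add] at h5
  rw [root'_orthoCoweight_left, mul_zero, zero_add] at h6
  rw [h6]
  exact mul_ne_zero (left_ne_zero_of_mul (h5 ▸ one_ne_zero)) (root'_orthoCoweight_ne_zero hi hj hij)

/-- A root in the plane of `i` and `j` belongs to a root subsystem that contains `i` if it agrees,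
modulo multiples of `i`, with an integral combination of roots of the subsystem. -/
lemma IsRootSubsystem.mem_of_root'_orthoCoweight_eq [P.IsRootSystem] [P.IsCrystallographic] [P.IsReduced]
    {Ψ : Finset ι} (hΨ : IsRootSubsystem P Ψ) {i j k : ι} (hi : b.IsPos i) (hj : b.IsPos j)
    (hij : i ≠ j) (hiΨ : i ∈ Ψ) (hk : InPlane P i j k) {l : Hd}
    (hl : l ∈ AddSubgroup.closure (P.root '' {k | k ∈ Ψ ∧ InPlane P i j k}))
    (hkl : P.root' k (orthoCoweight P i j) = P.toLinearMap l (orthoCoweight P i j)) : k ∈ Ψ := by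
  have hlat : ∀ m ∈ coweightLattice P, ∃ n : ℤ, P.toLinearMap l m = n := by
    intro m hm
    clear hkl
    induction hl using AddSubgroup.closure_induction with
    | mem l hl => obtain ⟨k, -, rfl⟩ := hl; exact hm k
    | zero => exact ⟨0, by simp⟩
    | add l l' _ _ h h' =>
      obtain ⟨n, hn⟩ := h
      obtain ⟨n', hn'⟩ := h'
      exact ⟨n + n', by rw [map_add, LinearMap.add_apply, hn, hn']; push_cast; rfl⟩
    | neg l _ h =>
      obtain ⟨n, hn⟩ := h
      exact ⟨-n, by rw [map_neg, LinearMap.neg_apply, hn]; push_cast; rfl⟩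
  have hplane : ∀ u, P.root' i u = 0 → P.root' j u = 0 → P.toLinearMap l u = 0 := by
    intro u hu hu'
    clear hkl hlat
    induction hl using AddSubgroup.closure_induction with
    | mem l hl => obtain ⟨k, hk, rfl⟩ := hl; exact hk.2 u hu hu'
    | zero => simp
    | add l l' _ _ h h' => rw [map_add, LinearMap.add_apply, h, h', add_zero]
    | neg l _ h => rw [map_neg, LinearMap.neg_apply, h, neg_zero]
  obtain ⟨m, hm, hm1⟩ := exists_coweight_root'_eq_one b i
  obtain ⟨n, hn⟩ := hm k
  obtain ⟨n', hn'⟩ := hlat m hm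
  obtain ⟨f₁, f₂, h₁, h₂, h₃, h₄⟩ := exists_dual_pair hi hj hij
  -- μ vanishes on the common kernel of α_i, α_j and on the orthogonal coweight, so it is a multiple
  -- of α_i; evaluation at a coweight where α_i is 1 shows that the multiple is an integer.
  set μ : H →ₗ[ℂ] ℂ := P.root' k - P.toLinearMap l with hμ
  have h5 : ∀ u, μ u = μ f₁ * P.root' i u + μ f₂ * P.root' j u := by
    intro u
    have e : u = (u - P.root' i u • f₁ - P.root' j u • f₂) + P.root' i u • f₁ + P.root' j u • f₂ := by
      abel
    have e1 : P.root' i (u - P.root' i u • f₁ - P.root' j u • f₂) = 0 := by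
      simp only [map_sub, map_smul, h₁, h₂, smul_eq_mul]; ring
    have e2 : P.root' j (u - P.root' i u • f₁ - P.root' j u • f₂) = 0 := by
      simp only [map_sub, map_smul, h₃, h₄, smul_eq_mul]; ring
    have e3 : μ (u - P.root' i u • f₁ - P.root' j u • f₂) = 0 := by
      rw [hμ, LinearMap.sub_apply, hk _ e1 e2, hplane _ e1 e2, sub_zero]
    rw [map_sub, map_sub, map_smul, map_smul, smul_eq_mul, smul_eq_mul] at e3
    linear_combination e3
  have h6 : μ f₂ = 0 := by
    have h := h5 (orthoCoweight P i j)
    rw [hμ, LinearMap.sub_apply, hkl, sub_self, ← hμ, root'_orthoCoweight_left, mul_zero, zero_add] at h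
    exact (mul_eq_zero.mp h.symm).resolve_right (root'_orthoCoweight_ne_zero hi hj hij)
  have h7 : μ f₁ = ((n - n' : ℤ) : ℂ) := by
    have h := h5 m
    rw [h6, hm1, zero_mul, add_zero, mul_one] at h
    rw [← h, hμ, LinearMap.sub_apply, hn, hn']
    push_cast
    rfl
  have h8 : P.root k = l + (n - n') • P.root i := by
    refine LinearMap.IsPerfPair.bijective_left P.toLinearMap |>.injective ?_
    ext u
    have h := h5 u
    rw [h6, h7, zero_mul, add_zero, hμ, LinearMap.sub_apply, sub_eq_iff_eq_add'] at h
    rw [map_add, map_zsmul, LinearMap.add_apply, ← Int.cast_smul_eq_zsmul ℂ, LinearMap.smul_apply,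
      smul_eq_mul]
    exact h
  refine hΨ k (h8 ▸ add_mem (AddSubgroup.closure_mono (Set.image_mono fun k hk => hk.1) hl)
    (zsmul_mem (AddSubgroup.subset_closure (Set.mem_image_of_mem P.root (Finset.mem_coe.mpr hiΨ))) _))

variable {A : Type*} [Ring A] [Algebra ℂ A] {𝓕 : CompleteFiltration A} {t : ι → A} {x y : H →ₗ[ℂ] A}

/-- The residue of the curvature along the intersections of walls. -/
lemma sum_adEnd_t_eq_zero (hx : ∀ u, x u ∈ 𝓕.F 1) {τ : ℍ}
    (h : ∀ z ∈ regularSet P τ, ∀ u v,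
      adEnd (kzbForm P b τ 𝓕 t x y z u) (kzbForm P b τ 𝓕 t x y z v) = 0) {i : ι} (hi : b.IsPos i)
    {z e : H} (hz : P.root' i z = 0) (he : P.root' i e = 0) (hor : ∀ j ∈ (posRoots b).erase i,
      theta τ (P.root' j z) ≠ 0 ∨ (∃ n : ℤ, P.root' j z = n) ∧ P.root' j e ≠ 0) :
    ∑ j ∈ (posRoots b).erase i with theta τ (P.root' j z) = 0, adEnd (t i) (t j) = 0 := by
  -- A second residue, taken inside the wall of i along e. Using e also as tangent vector makes the
  -- factor α_j(e) cancel its inverse from the residue.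
  have h1 := (((HasLim.sum ((posRoots b).erase i) fun j hj => HasLim.smul (c := fun _ => P.root' j e)
    tendsto_const_nhds (hasLim_smul_kAd_root' (t := t) hx (hor j hj))).neg.add
    (HasLim.smul (c := fun s : ℂ => s) (γ := 0)
      (Filter.tendsto_id.mono_left nhdsWithin_le_nhds) (HasLim.const (𝓕 := 𝓕) (y e)))).map
      (continuous_adEnd (t i)))
  have h2 := h1.unique ((HasLim.const (𝓕 := 𝓕) 0).congr' ?_)
  · rw [zero_smul, add_zero, map_neg, neg_eq_zero, map_sum] at h2
    rw [Finset.sum_filter]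
    refine Eq.trans ?_ h2
    refine Finset.sum_congr rfl fun j hj => ?_
    split_ifs with h0
    · rw [smul_smul, mul_inv_cancel₀ ((hor j hj).resolve_left (not_not.mpr h0)).2, one_smul]
    · simp
  · have hev : ∀ᶠ s in 𝓝[≠] (0 : ℂ), ∀ j : ι, j ∈ (posRoots b).erase i →
        theta τ (P.root' j (z + s • e)) ≠ 0 := by
      rw [Filter.eventually_all]
      intro j
      by_cases hj : j ∈ (posRoots b).erase i
      · filter_upwards [eventually_theta_add_mul_ne_zero ((hor j hj).imp_right And.right)] with s hs _
        rwa [root'_add_smul]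
      · exact Filter.Eventually.of_forall fun s h => absurd h hj
    filter_upwards [hev] with s hs
    have hzs : P.root' i (z + s • e) = 0 := by rw [root'_add_smul, hz, he, zero_mul, zero_add]
    have h3 := congrArg (s • ·) (adEnd_t_wall_eq_zero hx h hi hzs hs he)
    simp only [smul_zero] at h3
    rw [← h3, ← map_smul, smul_add, smul_neg, Finset.smul_sum]
    simp only [smul_comm s]

lemma sum_plane_adEnd_t_eq_zero [P.IsRootSystem] [P.IsCrystallographic] [P.IsReduced]
    (hx : ∀ u, x u ∈ 𝓕.F 1) {τ : ℍ} (h : ∀ z ∈ regularSet P τ, ∀ u v,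
      adEnd (kzbForm P b τ 𝓕 t x y z u) (kzbForm P b τ 𝓕 t x y z v) = 0) {Ψ : Finset ι}
    (hΨ : IsRootSubsystem P Ψ) {i j : ι} (hi : b.IsPos i) (hj : b.IsPos j) (hij : i ≠ j)
    (hiΨ : i ∈ Ψ) (hjΨ : j ∈ Ψ) :
    ∑ k ∈ (Ψ.filter fun k => b.IsPos k) with k ∈ plane b i j, adEnd (t i) (t k) = 0 := by
  set e := orthoCoweight P i j with he
  set G : AddSubgroup Hd := AddSubgroup.closure (P.root '' {k | k ∈ Ψ ∧ InPlane P i j k}) with hG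
  -- d generates the group of integers that the lattice of the roots of Ψ in the plane takes on e.
  -- At e/d, the roots of the plane with integral value are then exactly those of Ψ.
  obtain ⟨d, hd⟩ := Int.subgroup_cyclic
    ((G.map (P.toLinearMap.flip e).toAddMonoidHom).comap (Int.castAddHom ℂ))
  have hmem : ∀ n : ℤ, (∃ l ∈ G, P.toLinearMap l e = n) ↔ d ∣ n := by
    intro n
    rw [← Int.mem_zmultiples_iff, AddSubgroup.zmultiples_eq_closure, ← hd, AddSubgroup.mem_comap]
    rfl
  have hint := orthoCoweight_mem (P := P) i j
  have hGmem : ∀ k ∈ Ψ, InPlane P i j k → P.root k ∈ G := fun k hk hk' =>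
    AddSubgroup.subset_closure ⟨k, ⟨hk, hk'⟩, rfl⟩
  have hd0 : (d : ℂ) ≠ 0 := by
    obtain ⟨n, hn⟩ := hint j
    have h1 := (hmem n).mp ⟨P.root j, hGmem j hjΨ fun _ _ h => h, hn⟩
    intro h0
    rw [Int.cast_eq_zero.mp h0, zero_dvd_iff] at h1
    exact root'_orthoCoweight_ne_zero hi hj hij (by rw [hn, h1, Int.cast_zero])
  -- A generic w killed by the plane keeps those values and makes all roots outside the plane
  -- regular.
  obtain ⟨w, hw, hwθ⟩ := exists_mem_forall_theta_ne_zero τ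
    (LinearMap.ker (P.root' i) ⊓ LinearMap.ker (P.root' j))
    (Finset.univ.filter fun k => ¬InPlane P i j k) P.root' (fun k hk => by
      have := (Finset.mem_filter.mp hk).2
      rw [InPlane] at this
      push Not at this
      obtain ⟨v, h1, h2, h3⟩ := this
      exact ⟨v, ⟨h1, h2⟩, h3⟩) ((d : ℂ)⁻¹ • e)
  set z := (d : ℂ)⁻¹ • e + w with hz
  have hzk : ∀ k, InPlane P i j k → P.root' k z = (d : ℂ)⁻¹ * P.root' k e := fun k hk => by
    rw [hz, map_add, map_smul, hk w hw.1 hw.2, add_zero, smul_eq_mul]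
  -- The values at z of roots of the plane are real, so they lie in ℤ + ℤτ only if they are
  -- integers.
  have hθ : ∀ k, InPlane P i j k → (theta τ (P.root' k z) = 0 ↔ ∃ n : ℤ, P.root' k z = n) := by
    intro k hk
    rw [theta_eq_zero_iff]
    refine ⟨fun ⟨m, n, hmn⟩ => ⟨m, ?_⟩, fun ⟨n, hn⟩ => ⟨n, 0, by simpa using hn⟩⟩
    obtain ⟨l, hl⟩ := hint k
    rw [hzk k hk, hl] at hmn ⊢
    have him := congrArg Complex.im hmn
    have e1 : ((d : ℂ)⁻¹ * l).im = 0 := by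
      rw [← Complex.ofReal_intCast, ← Complex.ofReal_intCast, ← Complex.ofReal_inv, ← Complex.ofReal_mul,
        Complex.ofReal_im]
    rw [e1] at him
    have hn0 : (n : ℝ) = 0 := by
      have : (n : ℝ) * (τ : ℂ).im = 0 := by simpa using him.symm
      exact (mul_eq_zero.mp this).resolve_right τ.im_ne_zero
    rw [hmn, Int.cast_eq_zero.mp hn0]
    simp
  have hΨ' : ∀ k, InPlane P i j k → (theta τ (P.root' k z) = 0 ↔ k ∈ Ψ) := by
    intro k hk
    obtain ⟨l, hl⟩ := hint k
    have e1 : (∃ n : ℤ, P.root' k z = n) ↔ d ∣ l := by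
      rw [hzk k hk, hl]
      refine exists_congr fun n => ?_
      rw [inv_mul_eq_iff_eq_mul₀ hd0]
      exact_mod_cast Iff.rfl
    rw [hθ k hk, e1, ← hmem]
    refine ⟨fun ⟨m, hm, hml⟩ => ?_, fun hkΨ => ⟨P.root k, hGmem k hkΨ hk, hl⟩⟩
    exact hΨ.mem_of_root'_orthoCoweight_eq hi hj hij hiΨ hk hm (by rw [hl, ← hml])
  have key := sum_adEnd_t_eq_zero hx h hi (z := z) (e := e)
    (by rw [hzk i fun _ h _ => h, he, root'_orthoCoweight_left, mul_zero])
    (root'_orthoCoweight_left i j) fun k hk => by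
      obtain ⟨hki, hk⟩ := Finset.mem_erase.mp hk
      by_cases hkp : InPlane P i j k
      · rw [or_iff_not_imp_left, not_not, hθ k hkp]
        exact fun h => ⟨h, root'_orthoCoweight_ne_zero_of_mem_plane hi hj hij
          (mem_plane.mpr ⟨mem_posRoots.mp hk, hkp⟩) hki.symm⟩
      · exact Or.inl (hwθ k (by simpa using hkp))
  rw [← key, ← Finset.sum_erase (a := i) _ (adEnd_self (t i))]
  refine Finset.sum_congr ?_ fun _ _ => rfl
  ext k
  simp only [Finset.mem_erase, Finset.mem_filter, mem_posRoots, mem_plane]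
  refine ⟨fun ⟨hki, ⟨hk, hk1⟩, _, hk2⟩ => ⟨⟨hki, hk1⟩, (hΨ' k hk2).mpr hk⟩, ?_⟩
  rintro ⟨⟨hki, hk1⟩, h0⟩
  have hk2 : InPlane P i j k := by
    by_contra hk2
    exact hwθ k (by simpa using hk2) h0
  exact ⟨hki, ⟨(hΨ' k hk2).mp h0, hk1⟩, hk1, hk2⟩

lemma ttRelation_of_isFlatConnection [P.IsRootSystem] [P.IsCrystallographic] [P.IsReduced]
    (ht : ∀ i j, P.root j = -P.root i → t j = t i) (hx : ∀ u, x u ∈ 𝓕.F 1) {τ : ℍ}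
    (h : ∀ z ∈ regularSet P τ, ∀ u v,
      adEnd (kzbForm P b τ 𝓕 t x y z u) (kzbForm P b τ 𝓕 t x y z v) = 0) : TTRelation P b t := by
  intro Ψ hΨ
  have hpos : ∀ i ∈ Ψ, b.IsPos i → ∑ j ∈ Ψ.filter fun j => b.IsPos j, adEnd (t i) (t j) = 0 := by
    intro i hi hip
    refine sum_eq_zero_of_plane (fun j => adEnd (t i) (t j)) _ (fun j hj => (Finset.mem_filter.mp hj).2)
      hip (adEnd_self _) fun j hj hij => ?_
    exact sum_plane_adEnd_t_eq_zero hx h hΨ hip (Finset.mem_filter.mp hj).2 hij hi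
      (Finset.mem_filter.mp hj).1
  intro i hi
  by_cases hip : b.IsPos i
  · exact hpos i hi hip
  · rw [← ht _ _ (root_neg i)]
    refine hpos _ (hΨ _ ?_) (isPos_neg hip)
    rw [root_neg]
    exact neg_mem (AddSubgroup.subset_closure ⟨i, hi, rfl⟩)

end Flat

end KZB

end

/-! ### The relations (ty) and (yy), and the end of the converse. -/

noncomputable section

namespace KZB

open CompleteFiltration

section Flat

open scoped Classical

variable {ι Hd H A : Type*} [Fintype ι] [AddCommGroup Hd] [Module ℂ Hd] [AddCommGroup H]
  [Module ℂ H] {P : RootPairing ι ℂ Hd H} {b : P.Base} [Ring A] [Algebra ℂ A]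
  {𝓕 : CompleteFiltration A} {t : ι → A} {x y : H →ₗ[ℂ] A}

/-- On a wall, the regular terms of the connection form in a plane commute with the residue, for
tangent vectors to the wall. -/
lemma sum_plane_adEnd_t_kAd_eq_zero [P.IsReduced] (hx : ∀ u, x u ∈ 𝓕.F 1)
    (hX : XRelations P t x) (htt : TTRelation P b t) {τ : ℍ} {i j : ι} (hi : b.IsPos i)
    (hj : b.IsPos j) (hij : i ≠ j) {z v : H} (hz : P.root' i z = 0)
    (hz' : ∀ j ∈ (posRoots b).erase i, theta τ (P.root' j z) ≠ 0) (hv : P.root' i v = 0) :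
    ∑ k ∈ plane b i j, P.root' k v •
      adEnd (t i) (kAd 𝓕 τ (P.root' k z) (halfX P x k) (t k)) = 0 := by
  obtain ⟨e₁, e₂, h₁, h₂, h₃, h₄⟩ := exists_dual_pair hi hj hij
  -- On the wall, α_k(z) = cα_j(z) and α_k(v) = cα_j(v) with c = α_k(e₂), while (ad X_k)^n t_k =
  -- c^{-n}(ad x(e₂))^n t_k and ad x(e₂) kills t_i. The coefficient of [t_i, t_k] is then even in c
  -- by `kCoeff_neg`, so (tt) applies; the value 0 on the singular locus covers k = i.
  set F : ℕ → ℂ → ℂ := fun n c =>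
    if theta τ (c * P.root' j z) = 0 then 0 else c * kCoeff τ (c * P.root' j z) n * (c ^ n)⁻¹ with hF
  have heven : ∀ n c, F n (-c) = F n c := by
    intro n c
    simp only [hF, neg_mul, theta_neg, neg_eq_zero]
    split_ifs with h0
    · rfl
    · rw [kCoeff_neg h0, neg_pow c, mul_inv, pow_succ]
      have : ((-1 : ℂ) ^ n) * ((-1 : ℂ) ^ n)⁻¹ = 1 := mul_inv_cancel₀ (by simp)
      linear_combination (c * kCoeff τ (c * P.root' j z) n * (c ^ n)⁻¹) * this
  have hsum : ∀ n, ∑ k ∈ plane b i j, F n (P.root' k e₂) • adEnd (t i) (t k) = 0 := fun n =>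
    sum_even_smul_eq_zero (plane b i j) (fun k => P.root' k e₂) _
      (fun c => htt.sum_filter_eq_zero h₂ c) (heven n)
  have hser : ∀ k ∈ plane b i j, 𝓕.HasSeries (fun n => P.root' j v • F n (P.root' k e₂) •
      (adEnd (x e₂) ^ n) (adEnd (t i) (t k)))
      (P.root' k v • adEnd (t i) (kAd 𝓕 τ (P.root' k z) (halfX P x k) (t k))) := by
    intro k hk
    obtain ⟨hk, hkp⟩ := mem_plane.mp hk
    have hkv := hkp.root'_eq h₁ h₂ h₃ h₄ v
    have hkz := hkp.root'_eq h₁ h₂ h₃ h₄ z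
    rw [hv, mul_zero, zero_add] at hkv
    rw [hz, mul_zero, zero_add] at hkz
    by_cases hki : k = i
    · subst hki
      have hF0 : ∀ n, F n 0 = 0 := fun n => by simp [hF]
      simp only [h₂, hv, hF0, zero_smul, smul_zero]
      exact hasSeries_zero 𝓕
    · have hk0 := hz' k (Finset.mem_erase.mpr ⟨hki, mem_posRoots.mpr hk⟩)
      have hkj : P.root' k e₂ ≠ 0 := by
        intro h0
        rw [hkz, h0, zero_mul, theta_ne_zero_iff] at hk0
        exact hk0 0 0 (by simp)
      have h5 := ((hasSeries_kAd (halfX_mem (P := P) hx k) τ (P.root' k z) (t k)).map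
        (continuous_adEnd (t i))).smul (P.root' k v)
      convert h5 using 2 with n
      rw [map_smul, adEnd_pow_adEnd_right (hX.tx i e₂ h₂), hX.pow_apply, map_smul, smul_smul, smul_smul,
        smul_smul]
      congr 1
      simp only [hF, ← hkz, if_neg hk0]
      rw [hkv]
      have := mul_inv_cancel₀ (pow_ne_zero n hkj)
      linear_combination (P.root' j v * P.root' k e₂ * kCoeff τ (P.root' k z) n) * this
  rw [← (hasSeries_finsetSum _ hser).series_eq]
  refine HasSeries.series_eq ?_
  convert hasSeries_zero 𝓕 using 2 with n
  have h6 := congrArg (fun a => P.root' j v • (adEnd (x e₂) ^ n) a) (hsum n)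
  simpa only [map_sum, map_smul, Finset.smul_sum, map_zero, smul_zero] using h6

lemma tyRelation_of_isFlatConnection [P.IsReduced]
    (ht : ∀ i j, P.root j = -P.root i → t j = t i) (hx : ∀ u, x u ∈ 𝓕.F 1) {τ : ℍ}
    (h : ∀ z ∈ regularSet P τ, ∀ u v,
      adEnd (kzbForm P b τ 𝓕 t x y z u) (kzbForm P b τ 𝓕 t x y z v) = 0)
    (hX : XRelations P t x) (htt : TTRelation P b t) : TYRelation P t y := by
  have hpos : ∀ i, b.IsPos i → ∀ v, P.root' i v = 0 → adEnd (y v) (t i) = 0 := by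
    intro i hi v hv
    obtain ⟨z, hz, hz'⟩ := exists_generic_on_wall τ hi
    have h1 := adEnd_t_wall_eq_zero hx h hi hz hz' hv
    have h2 : ∑ j ∈ posRoots b, P.root' j v •
        adEnd (t i) (kAd 𝓕 τ (P.root' j z) (halfX P x j) (t j)) = 0 := by
      refine sum_eq_zero_of_plane _ _ (fun j hj => mem_posRoots.mp hj) hi (by rw [hv, zero_smul])
        fun j hj hij => ?_
      rw [← sum_plane_adEnd_t_kAd_eq_zero hx hX htt hi (mem_posRoots.mp hj) hij hz hz' hv]
      exact Finset.sum_congr (filter_posRoots_plane b i j) fun _ _ => rfl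
    rw [← Finset.sum_erase (a := i) _ (by rw [hv, zero_smul])] at h2
    rw [map_add, map_neg, map_sum] at h1
    simp only [map_smul] at h1
    rw [h2, neg_zero, zero_add] at h1
    rw [adEnd_swap, h1, neg_zero]
  intro i u hu
  by_cases hi : b.IsPos i
  · exact hpos i hi u hu
  · rw [← ht _ _ (root_neg i)]
    exact hpos _ (isPos_neg hi) u (by rw [root'_neg, hu, neg_zero])

/-- The relations hold if the connection is flat. -/
theorem relations_of_isFlatConnection [P.IsRootSystem] [P.IsCrystallographic] [P.IsReduced]
    (ht : ∀ i j, P.root j = -P.root i → t j = t i) (hx : ∀ u, x u ∈ 𝓕.F 1) {τ : ℍ}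
    (h : IsFlatConnection P b τ 𝓕 t x y) : Relations P b t x y := by
  obtain ⟨hX, hyx⟩ := xRelations_of_isFlatConnection ht hx h
  have hflat := (zeroCurvatureOn_iff hx τ).mp h.flat
  have htt := ttRelation_of_isFlatConnection ht hx hflat
  have hty := tyRelation_of_isFlatConnection ht hx hflat hX htt
  obtain ⟨z, hz⟩ := exists_mem_regularSet P τ
  refine relations_iff.mpr ⟨htt, hX, hyx, hty, fun u v => ?_⟩
  -- Once the other relations are known, the commutator of the values of the form is [y(u), y(v)],
  -- so flatness at one regular point gives (yy).
  rw [← adEnd_kzbForm hx hX hyx htt hty hz, hflat z hz]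

end Flat

end KZB

end

noncomputable section

namespace KZB

open CompleteFiltration

/-! ### Equivariance -/

section Equivariance

open scoped Classical

variable {ι Hd H A : Type*} [AddCommGroup Hd] [Module ℂ Hd] [AddCommGroup H]
  [Module ℂ H] {P : RootPairing ι ℂ Hd H} {b : P.Base} [Ring A] [Algebra ℂ A]
  {𝓕 : CompleteFiltration A} {t : ι → A} {x y : H →ₗ[ℂ] A}

/-- A continuous automorphism commutes with the substitution in power series. -/
lemma map_kAd {ρ : A ≃ₐ[ℂ] A} (hρ : ∀ n, ∃ m, ∀ a ∈ 𝓕.F m, ρ a ∈ 𝓕.F n) {X : A} (hX : X ∈ 𝓕.F 1)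
    (τ : ℍ) (z : ℂ) (a : A) : ρ (kAd 𝓕 τ z X a) = kAd 𝓕 τ z (ρ X) (ρ a) := by
  have h1 := (hasSeries_kAd hX τ z a).map (L := ρ.toLinearMap) hρ
  have h2 : ∀ n, ρ ((adEnd X ^ n) a) = (adEnd (ρ X) ^ n) (ρ a) := by
    intro n
    induction n with
    | zero => simp
    | succ n ih =>
      rw [pow_succ', pow_succ', Module.End.mul_apply, Module.End.mul_apply, ← ih, adEnd_apply,
        adEnd_apply, map_sub, map_mul, map_mul]
  rw [AlgEquiv.toLinearMap_apply] at h1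
  rw [← h1.series_eq, kAd_eq_series]
  congr 1
  ext n
  rw [AlgEquiv.toLinearMap_apply, map_smul, h2]

lemma hasSeries_exp {a : A} (ha : a ∈ 𝓕.F 1) :
    𝓕.HasSeries (fun n => ((n.factorial : ℂ)⁻¹) • a ^ n) (𝓕.exp a) := by
  have h := (raises_mulLeft ha).hasSeries_powSeries (PowerSeries.exp ℂ) 1
  rw [← exp_eq_powSeries] at h
  simpa [PowerSeries.coeff_exp] using h

lemma map_exp {ρ : A ≃ₐ[ℂ] A} (hρ : ∀ n, ∃ m, ∀ a ∈ 𝓕.F m, ρ a ∈ 𝓕.F n) {a : A} (ha : a ∈ 𝓕.F 1) :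
    ρ (𝓕.exp a) = 𝓕.exp (ρ a) := by
  have h := ((hasSeries_exp ha).map (L := ρ.toLinearMap) hρ).series_eq
  rw [AlgEquiv.toLinearMap_apply] at h
  rw [← h, exp]
  simp

/-- The exponentials of the multiples of an element determine the element. -/
lemma map_eq_of_map_exp {ρ : A ≃ₐ[ℂ] A} (hρ : ∀ n, ∃ m, ∀ a ∈ 𝓕.F m, ρ a ∈ 𝓕.F n) {a a' : A}
    (ha : a ∈ 𝓕.F 1) (ha' : a' ∈ 𝓕.F 1)
    (h : ∀ N : ℕ, ρ (𝓕.exp ((N : ℂ) • a)) = 𝓕.exp ((N : ℂ) • a')) : ρ a = a' := by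
  have key := eq_zero_of_forall_hasSeries_pow (𝓕 := 𝓕)
    (f := fun n => ((n.factorial : ℂ)⁻¹) • (ρ a ^ n - a' ^ n)) (fun N _ => ?_) 1
  · simpa [sub_eq_zero] using key
  · have h1 := (hasSeries_exp (Submodule.smul_mem _ (N : ℂ) ha)).map (L := ρ.toLinearMap) hρ
    have h2 := (hasSeries_exp (Submodule.smul_mem _ (N : ℂ) ha')).smul (-1)
    have h3 := h1.add h2
    rw [AlgEquiv.toLinearMap_apply, h N, neg_one_smul, add_neg_cancel] at h3
    convert h3 using 2 with n
    rw [AlgEquiv.toLinearMap_apply, map_smul, map_pow, map_smul, smul_pow, smul_pow, neg_one_smul,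
      smul_sub, smul_sub, sub_eq_add_neg]
    simp only [smul_comm ((N : ℂ) ^ n)]

lemma kAd_neg_neg {τ : ℍ} {z : ℂ} (hz : theta τ z ≠ 0) {X : A} (hX : X ∈ 𝓕.F 1) (a : A) :
    kAd 𝓕 τ (-z) (-X) a = -kAd 𝓕 τ z X a := by
  have h1 := (hasSeries_kAd hX τ z a).smul (-1)
  rw [neg_one_smul] at h1
  rw [kAd_eq_series, ← h1.series_eq]
  congr 1
  ext n
  have e : (-adEnd X) ^ n = (-1 : ℂ) ^ n • adEnd X ^ n := by
    rw [← neg_one_smul ℂ (adEnd X), smul_pow]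
  have hsq : ((-1 : ℂ) ^ n) * ((-1 : ℂ) ^ n) = 1 := by rw [← mul_pow]; simp
  rw [kCoeff_neg hz, map_neg, e, LinearMap.smul_apply, smul_smul, smul_smul]
  congr 1
  linear_combination (-kCoeff τ z n) * hsq

/-- The action of an element of the Weyl group, as a linear map. -/
def weylActLinear (P : RootPairing ι ℂ Hd H) (w : P.weylGroup) : H →ₗ[ℂ] H where
  toFun := weylAct P w
  map_add' := weylAct_add w
  map_smul' := weylAct_smul w

lemma halfX_neg (x : H →ₗ[ℂ] A) (i : ι) : halfX P x (P.reflectionPerm i i) = -halfX P x i := by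
  rw [halfX, coroot_neg, smul_neg, map_neg, halfX]

lemma halfX_comp_weylActLinear (x : H →ₗ[ℂ] A) (w : P.weylGroup) (i : ι) :
    halfX P (x ∘ₗ weylActLinear P w) i = halfX P x (P.weylGroupToPerm w i) := by
  change x (weylAct P w _) = _
  rw [weylAct_smul, weylAct_coroot, halfX]

variable [Fintype ι]

/-- The transformation of the connection form by an element of the Weyl group. -/
lemma kzbForm_weylAct (ht : ∀ i j, P.root j = -P.root i → t j = t i) (hx : ∀ u, x u ∈ 𝓕.F 1) {τ : ℍ}
    (w : P.weylGroup) {z : H} (hz : z ∈ regularSet P τ) (u : H) :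
    kzbForm P b τ 𝓕 t x y (weylAct P w z) (weylAct P w u) =
      kzbForm P b τ 𝓕 (t ∘ P.weylGroupToPerm w) (x ∘ₗ weylActLinear P w) (y ∘ₗ weylActLinear P w) z u := by
  set g : ι → A := fun k => P.root' k (weylAct P w u) •
    kAd 𝓕 τ (P.root' k (weylAct P w z)) (halfX P x k) (t k) with hg
  -- The signs of α(u) and of k cancel, so the positive sum is half of the sum over all roots, which
  -- w merely permutes.
  have hneg : ∀ k, g (P.reflectionPerm k k) = g k := by
    intro k
    have hk := mem_regularSet_iff.mp (weylAct_mem_regularSet w hz) k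
    simp only [hg]
    rw [root'_neg, root'_neg, halfX_neg, kAd_neg_neg hk (halfX_mem hx k), ht _ _ (root_neg k),
      neg_smul_neg]
  have h1 := sum_eq_add_sum_isPos b g hneg
  have h2 := sum_eq_add_sum_isPos b (fun i => g (P.weylGroupToPerm w i)) fun i => by
    rw [weylGroupToPerm_neg, hneg]
  rw [Equiv.sum_comp (P.weylGroupToPerm w) g, h1, ← two_smul ℂ, ← two_smul ℂ (∑ i with _, _)] at h2
  have h3 := smul_right_injective A (two_ne_zero (α := ℂ)) h2
  rw [kzbForm_eq, kzbForm_eq]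
  congr 2
  refine h3.trans (Finset.sum_congr rfl fun i _ => ?_)
  simp only [hg]
  rw [root'_weylAct, root'_weylAct, halfX_comp_weylActLinear]
  rfl

lemma map_kzbForm {ρ : A ≃ₐ[ℂ] A} (hρ : ∀ n, ∃ m, ∀ a ∈ 𝓕.F m, ρ a ∈ 𝓕.F n)
    (hx : ∀ u, x u ∈ 𝓕.F 1) (τ : ℍ) (z u : H) : ρ (kzbForm P b τ 𝓕 t x y z u) =
      kzbForm P b τ 𝓕 (ρ ∘ t) (ρ.toLinearMap ∘ₗ x) (ρ.toLinearMap ∘ₗ y) z u := by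
  rw [kzbForm_eq, kzbForm_eq, map_add, map_neg, map_sum]
  congr 2
  refine Finset.sum_congr rfl fun i _ => ?_
  rw [map_smul, map_kAd hρ (halfX_mem hx i)]
  rfl

/-- For fixed x the form is linear in (t, y); equality of two forms thus reduces to the vanishing of
one. -/
lemma kzbForm_sub (hx : ∀ u, x u ∈ 𝓕.F 1) (t' : ι → A) (y' : H →ₗ[ℂ] A) (τ : ℍ) (z u : H) :
    kzbForm P b τ 𝓕 (t - t') x (y - y') z u =
      kzbForm P b τ 𝓕 t x y z u - kzbForm P b τ 𝓕 t' x y' z u := by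
  have h : ∀ i, kAd 𝓕 τ (P.root' i z) (halfX P x i) ((t - t') i) =
      kAd 𝓕 τ (P.root' i z) (halfX P x i) (t i) - kAd 𝓕 τ (P.root' i z) (halfX P x i) (t' i) := by
    intro i
    simp only [kAd_eq_powSeries]
    exact map_sub ((raises_adEnd (halfX_mem (P := P) hx i)).powSeriesLinear
      (kSeries τ (P.root' i z))) (t i) (t' i)
  simp only [kzbForm_eq, h, smul_sub, Finset.sum_sub_distrib, LinearMap.sub_apply]
  abel

/-- The connection form determines its coefficients. -/
lemma eq_zero_of_kzbForm_eq_zero [P.IsReduced] (hx : ∀ u, x u ∈ 𝓕.F 1) {τ : ℍ}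
    (h : ∀ z ∈ regularSet P τ, ∀ u, kzbForm P b τ 𝓕 t x y z u = 0) :
    (∀ i, b.IsPos i → t i = 0) ∧ y = 0 := by
  have h1 : ∀ i, b.IsPos i → t i = 0 := by
    intro i hi
    obtain ⟨z, hz, hz'⟩ := exists_generic_on_wall τ hi
    obtain ⟨w, hw1⟩ : ∃ w, P.root' i w = 1 := ⟨_, root'_half_coroot P i⟩
    have hor := theta_ne_zero_or (b := b) hz hz' hw1
    have h2 := (hasLim_smul_kzbForm (t := t) (y := y) hx hor w).unique
      ((HasLim.const (𝓕 := 𝓕) 0).congr' ?_)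
    · rw [filter_theta_eq_singleton hi hz hz', Finset.sum_singleton, hw1] at h2
      simpa using h2
    · filter_upwards [eventually_mem_regularSet b fun j hj => (hor j hj).imp_right And.right] with s hs
      rw [h _ hs, smul_zero]
  refine ⟨h1, LinearMap.ext fun u => ?_⟩
  obtain ⟨z, hz⟩ := exists_mem_regularSet P τ
  have h3 := h z hz u
  have h4 : ∀ i ∈ posRoots b,
      P.root' i u • kAd 𝓕 τ (P.root' i z) (halfX P x i) (t i) = 0 := fun i hi => by
    rw [h1 i (mem_posRoots.mp hi), kAd_eq_powSeries]
    exact (congrArg _ (map_zero ((raises_adEnd (halfX_mem (P := P) hx i)).powSeriesLinear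
      (kSeries τ (P.root' i z))))).trans (smul_zero _)
  rw [kzbForm_eq, Finset.sum_eq_zero h4, neg_zero, zero_add] at h3
  exact h3

/-- The connection is equivariant if and only if the action of the Weyl group permutes the
generators. -/
theorem isEquivariant_iff [P.IsRootSystem] [P.IsCrystallographic] [P.IsReduced]
    (ht : ∀ i j, P.root j = -P.root i → t j = t i) (hx : ∀ u, x u ∈ 𝓕.F 1) (τ : ℍ)
    {ρ : P.weylGroup →* (A ≃ₐ[ℂ] A)} (hρ : ∀ w, ∀ n : ℤ, ∃ m : ℤ, ∀ a ∈ 𝓕.F m, ρ w a ∈ 𝓕.F n) :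
    IsEquivariant P b τ 𝓕 t x y ρ ↔ ∀ w : P.weylGroup,
      (∀ i, ρ w (t i) = t (P.weylGroupToPerm w i)) ∧ (∀ u, ρ w (x u) = x (weylAct P w u)) ∧
      (∀ v, ρ w (y v) = y (weylAct P w v)) := by
  constructor
  · intro h w
    -- x is recovered first, from the multipliers alone, because comparing forms through
    -- `kzbForm_sub` requires the same x on both sides.
    have hxw : ∀ u, ρ w (x u) = x (weylAct P w u) := by
      refine forall_of_forall_coweight (P := P) (f := (ρ w).toLinearMap ∘ₗ x)
        (g := x ∘ₗ weylActLinear P w) fun m hm => ?_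
      have hc : (-(2 * Real.pi * Complex.I) : ℂ) ≠ 0 := by simp [Real.pi_ne_zero]
      have h1 := map_eq_of_map_exp (hρ w) (Submodule.smul_mem _ (-(2 * Real.pi * Complex.I) : ℂ) (hx m))
        (Submodule.smul_mem _ (-(2 * Real.pi * Complex.I) : ℂ) (hx (weylAct P w m))) fun N => by
          rw [← multiplier_natCast_smul, ← multiplier_natCast_smul, ← weylAct_smul,
            h.bundle w _ (natCast_smul_mem_coweightLattice hm N)]
      rw [map_smul] at h1
      exact smul_right_injective A hc h1
    have hxw' : (ρ w).toLinearMap ∘ₗ x = x ∘ₗ weylActLinear P w := LinearMap.ext hxw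
    have hx' : ∀ u, (x ∘ₗ weylActLinear P w) u ∈ 𝓕.F 1 := fun u => hx _
    have h2 : ∀ z ∈ regularSet P τ, ∀ u, kzbForm P b τ 𝓕 (t ∘ P.weylGroupToPerm w - ρ w ∘ t)
        (x ∘ₗ weylActLinear P w) (y ∘ₗ weylActLinear P w - (ρ w).toLinearMap ∘ₗ y) z u = 0 := by
      intro z hz u
      rw [kzbForm_sub hx', ← kzbForm_weylAct ht hx w hz, h.form w z hz, map_kzbForm (hρ w) hx,
        hxw', sub_self]
    obtain ⟨h3, h4⟩ := eq_zero_of_kzbForm_eq_zero hx' h2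
    refine ⟨fun i => ?_, hxw, fun v => (sub_eq_zero.mp (LinearMap.congr_fun h4 v)).symm⟩
    by_cases hi : b.IsPos i
    · exact (sub_eq_zero.mp (h3 i hi)).symm
    · have h5 := (sub_eq_zero.mp (h3 _ (isPos_neg hi))).symm
      rwa [Function.comp_apply, Function.comp_apply, weylGroupToPerm_neg, ht _ _ (root_neg i),
        ht _ _ (root_neg (P.weylGroupToPerm w i))] at h5
  · refine fun h => ⟨fun w m _ => ?_, fun w z hz u => ?_⟩
    · rw [multiplier, multiplier, map_exp (hρ w) (Submodule.smul_mem _ _ (hx m)), map_smul, (h w).2.1]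
    · have e1 : ρ w ∘ t = t ∘ P.weylGroupToPerm w := funext (h w).1
      have e2 : (ρ w).toLinearMap ∘ₗ x = x ∘ₗ weylActLinear P w := LinearMap.ext (h w).2.1
      have e3 : (ρ w).toLinearMap ∘ₗ y = y ∘ₗ weylActLinear P w := LinearMap.ext (h w).2.2
      rw [map_kzbForm (hρ w) hx, kzbForm_weylAct ht hx w hz, e1, e2, e3]

end Equivariance

end KZB

end

theorem mainTheorem2 {ι Hd H A : Type*} [Fintype ι] [AddCommGroup Hd] [Module ℂ Hd]
    [AddCommGroup H] [Module ℂ H] [Ring A] [Algebra ℂ A]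
    (P : RootPairing ι ℂ Hd H) [P.IsRootSystem] [P.IsCrystallographic] [P.IsReduced]
    (b : P.Base) (τ : UpperHalfPlane) (𝓕 : KZB.CompleteFiltration A)
    (t : ι → A) (ht : ∀ i j, P.root j = -P.root i → t j = t i)
    (x y : H →ₗ[ℂ] A) (hx : ∀ u, x u ∈ 𝓕.F 1) :
    (KZB.IsFlatConnection P b τ 𝓕 t x y ↔ KZB.Relations P b t x y) ∧
    ∀ ρ : P.weylGroup →* (A ≃ₐ[ℂ] A),
      (∀ w, ∀ n : ℤ, ∃ m : ℤ, ∀ a ∈ 𝓕.F m, ρ w a ∈ 𝓕.F n) →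
      (KZB.IsEquivariant P b τ 𝓕 t x y ρ ↔
        ∀ w : P.weylGroup,
          (∀ i, ρ w (t i) = t (P.weylGroupToPerm w i)) ∧
          (∀ u, ρ w (x u) = x (KZB.weylAct P w u)) ∧
          (∀ v, ρ w (y v) = y (KZB.weylAct P w v))) := by
  exact ⟨⟨KZB.relations_of_isFlatConnection ht hx, KZB.isFlatConnection_of_relations τ hx⟩,
    fun _ hρ => KZB.isEquivariant_iff ht hx τ hρ⟩
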